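/- Let $\mathcal H$ be a Krein space: a complex Banach space whose topology is given by some scalar product, with a continuous hermitian form $\langle\cdot|\cdot\rangle$ (antilinear in the first variable) such that every continuous linear form on $\mathcal H$ equals $\langle u|\cdot\rangle$ for a unique $u$. Adjoints and positivity refer to this form: $T\ge0$ means $\langle u|Tu\rangle\ge0$ for all $u$. Let $H$ be a selfadjoint (densely defined, possibly unbounded) operator on $\mathcal H$ with nonempty resolvent set $\rho(H)$, and put $R(z)=(H-z)^{-1}$ for $z\in\rho(H)$. Let $\beta(H)$ be the set of $\lambda\in\mathbb R$ having an open neighbourhood $U\subset\mathbb R$ for which there are $\nu>0$, $n\in\mathbb N$, $C>0$ such that $z\in\rho(H)$ and $\|R(z)\|\le C|\mathrm{Im}\,z|^{1-n}$ whenever $\mathrm{Re}\,z\in U$ and $0<|\mathrm{Im}\,z|\le\nu$. For $\chi\in C_0^\infty(\beta(H))$ put $$\chi(H)=\lim_{\mu\downarrow0}\frac1{2\pi i}\int_{\mathbb R}\big(R(x+i\mu)-R(x-i\mu)\big)\chi(x)\,dx$$ (norm limit). Let $I\subset\beta(H)$ be an open real set on which $H$ admits a $C^0$-functional calculus, that is,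 $\|\chi(H)\|\le C\sup_I|\chi|$ for some constant $C$ and all $\chi\in C_0^\infty(I)$. Then $\chi\mapsto\chi(H)$ extends uniquely to an algebra morphism $\varphi\mapsto\varphi(H)$ from the bounded Borel functions on $I$ to the bounded operators on $\mathcal H$ such that $\varphi_n(H)\to\varphi(H)$ weakly whenever $\varphi_n\to\varphi$ pointwise and boundedly; for a Borel set $S\subset I$, $1_S(H)$ is the operator so associated with the indicator function of $S$. Let $A$ be the generator of a $C_0$-group $W_t=e^{itA}$ on $\mathcal H$ and let $H$ be of class $C^1(A)$: for some $z\in\rho(H)$ the map $t\mapsto e^{-itA}R(z)e^{itA}$ is strongly of class $C^1$. Let $R(z)'$ be its strong derivative at $t=0$, and let $H'=[H,iA]$ be the sesquilinear form on $\mathrm{Dom}\,H$ determined by $R(z)'=-R(z)H'R(z)$, i.e. $\langle u|H'v\rangle=-\langle(H-\bar z)u\,|\,R(z)'(H-z)v\rangle$ (it does not depend on $z$). Let $J\subset I$ be a Borel set with $1_J(H)\ge0$, and assume that there are $a>0$ and a compact operator $K$ on $\mathcal H$ with $$1_J(H)\,H'\,1_J(H)\ \ge\ a\,1_J(H)+K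 ,$$ in the sense that $\mathrm{Re}\,\langle 1_J(H)u|H'1_J(H)u\rangle\ge a\langle u|1_J(H)u\rangle+\mathrm{Re}\,\langle u|Ku\rangle$ for all $u\in\mathrm{Dom}\,H$. Then: 1. $H$ has only finitely many eigenvalues in $J$, and $\mathrm{Ker}(H-\lambda)$ is finite dimensional for each $\lambda\in J$. 2. Let $\lambda\in J$ not be an eigenvalue of $H$, and assume that $\lambda$ has a compact neighbourhood in $J$ for the relative topology (this is automatic if $J$ is an interval, or open, or compact). Then for every real $b<a$ there is a compact neighbourhood $L$ of $\lambda$ in $J$ such that $1_L(H)\mathcal H\subset\mathrm{Dom}\,H$ and $$1_L(H)\,H'\,1_L(H)\ \ge\ b\,1_L(H),$$ i.e. $\mathrm{Re}\,\langle 1_L(H)u|H'1_L(H)u\rangle\ge b\langle u|1_L(H)u\rangle$ for all $u\in\mathcal H$. -/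

import Mathlib

open Filter Topology MeasureTheory
open scoped ContDiff ComplexConjugate

noncomputable section

/-- A Krein structure on a complex Banach space `E`: a continuous hermitian form (antilinear in the
first variable, linear in the second one) representing every continuous linear functional in
exactly one way, the topology of `E` being that of some scalar product. A Krein space is a Banach
space with such a structure. -/
structure KreinStructure (E : Type*) [NormedAddCommGroup E] [NormedSpace ℂ E] where
  form : E →L⋆[ℂ] E →L[ℂ] ℂ
  hermitian : ∀ u v, form u v = conj (form v u)
  represents : ∀ φ : E →L[ℂ] ℂ, ∃! u, φ = form u
  hilbertizable : ∃ c : InnerProductSpace.Core ℂ E, ∃ m M : ℝ, 0 < m ∧ 0 < M ∧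
    ∀ u, m * ‖u‖ ^ 2 ≤ (c.inner u u).re ∧ (c.inner u u).re ≤ M * ‖u‖ ^ 2

/-- A strongly continuous one-parameter group `W t = exp (i t A)` of bounded operators;
`A` is its generator, and each of `W` and `A` determines the other. -/
structure C0Group (E : Type*) [NormedAddCommGroup E] [NormedSpace ℂ E] where
  toFun : ℝ → E →L[ℂ] E
  map_zero : toFun 0 = ContinuousLinearMap.id ℂ E
  map_add : ∀ s t, toFun (s + t) = (toFun s).comp (toFun t)
  strong_continuity : ∀ u, Continuous fun t => toFun t u

variable {E : Type*} [NormedAddCommGroup E] [NormedSpace ℂ E]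

/-- Positivity of a bounded operator with respect to the Krein structure. -/
def KreinStructure.IsNonneg (k : KreinStructure E) (T : E →L[ℂ] E) : Prop :=
  ∀ u, 0 ≤ (k.form u (T u)).re ∧ (k.form u (T u)).im = 0

/-- Selfadjointness `H = H*` of a densely defined operator with respect to the Krein structure:
`(w, w')` is in the graph of `H*` iff it is in the graph of `H`. -/
def KreinStructure.IsSelfAdjointOp (k : KreinStructure E) (H : E →ₗ.[ℂ] E) : Prop :=
  Dense (H.domain : Set E) ∧
    ∀ w w' : E, (∀ v : H.domain, k.form w' v = k.form w (H v)) ↔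
      ∃ hw : w ∈ H.domain, H ⟨w, hw⟩ = w'

/-- `R` is a bounded two-sided inverse of `H - z`. -/
def IsResolventAt (H : E →ₗ.[ℂ] E) (z : ℂ) (R : E →L[ℂ] E) : Prop :=
  (∀ u, ∃ h : R u ∈ H.domain, H ⟨R u, h⟩ - z • R u = u) ∧
    ∀ v : H.domain, R (H v - z • (v : E)) = v

/-- The resolvent set of `H`. -/
def resolventSetOp (H : E →ₗ.[ℂ] E) : Set ℂ := {z | ∃ R, IsResolventAt H z R}

open Classical in
/-- `(H - z)⁻¹` for `z` in the resolvent set (and `0` otherwise). -/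
def resolventOp (H : E →ₗ.[ℂ] E) (z : ℂ) : E →L[ℂ] E :=
  if h : ∃ R, IsResolventAt H z R then h.choose else 0

/-- `Ker (H - z)`. -/
def eigenspaceOp (H : E →ₗ.[ℂ] E) (z : ℂ) : Submodule ℂ E :=
  (LinearMap.ker (H.toFun - z • H.domain.subtype)).map H.domain.subtype

/-- The set `β(H)` of the real points near which the resolvent has at most polynomial growth. -/
def polyGrowthSet (H : E →ₗ.[ℂ] E) : Set ℝ :=
  {l | ∃ U : Set ℝ, IsOpen U ∧ l ∈ U ∧ ∃ (ν : ℝ) (n : ℕ) (C : ℝ), 0 < ν ∧ 0 < C ∧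
    ∀ z : ℂ, z.re ∈ U → 0 < |z.im| → |z.im| ≤ ν →
      z ∈ resolventSetOp H ∧ ‖resolventOp H z‖ ≤ C * |z.im| ^ (1 - (n : ℤ))}

/-- The class of smooth functions with compact support in the open set `I`. -/
def IsTestFunctionOn (I : Set ℝ) (χ : ℝ → ℂ) : Prop :=
  ContDiff ℝ ∞ χ ∧ HasCompactSupport χ ∧ tsupport χ ⊆ I

/-- The smooth functional calculus
`χ(H) = (2πi)⁻¹ ∫ (R(x + i0) - R(x - i0)) χ(x) dx`, the boundary values being taken in the sense of
distributions, i.e. as norm limits of the integrals against `χ`. -/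
def smoothCalc (H : E →ₗ.[ℂ] E) (χ : ℝ → ℂ) : E →L[ℂ] E :=
  limUnder (𝓝[>] (0 : ℝ)) fun μ : ℝ => (2 * (Real.pi : ℂ) * Complex.I)⁻¹ •
    ∫ x : ℝ, χ x •
      (resolventOp H ((x : ℂ) + μ * Complex.I) - resolventOp H ((x : ℂ) - μ * Complex.I))

/-- `H` admits a `C⁰`-functional calculus on `I`:
`I ⊆ β(H)` and `‖χ(H)‖ ≤ C sup |χ|` for all test functions on `I`. -/
def HasC0Calculus (H : E →ₗ.[ℂ] E) (I : Set ℝ) : Prop :=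
  I ⊆ polyGrowthSet H ∧ ∃ C : ℝ, ∀ χ : ℝ → ℂ, IsTestFunctionOn I χ →
    ∀ M : ℝ, (∀ x, ‖χ x‖ ≤ M) → ‖smoothCalc H χ‖ ≤ C * M

/-- Bounded Borel functions on `I`. -/
def IsBoundedBorel {I : Set ℝ} (φ : I → ℂ) : Prop :=
  Measurable φ ∧ ∃ M : ℝ, ∀ x, ‖φ x‖ ≤ M

/-- `F` is an algebra morphism from the bounded Borel functions on `I` to the bounded operators,
extending the smooth functional calculus, and such that bounded pointwise convergence of functions
implies weak convergence of operators. (The values of `F` on other functions are irrelevant; there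
is at most one such `F` on bounded Borel functions.) -/
structure IsBorelCalculus (H : E →ₗ.[ℂ] E) (I : Set ℝ) (F : (I → ℂ) → E →L[ℂ] E) : Prop where
  map_add : ∀ φ ψ, IsBoundedBorel φ → IsBoundedBorel ψ → F (φ + ψ) = F φ + F ψ
  map_smul : ∀ (c : ℂ) φ, IsBoundedBorel φ → F (c • φ) = c • F φ
  map_mul : ∀ φ ψ, IsBoundedBorel φ → IsBoundedBorel ψ → F (φ * ψ) = (F φ).comp (F ψ)
  map_test : ∀ χ : ℝ → ℂ, IsTestFunctionOn I χ → F (fun x => χ x) = smoothCalc H χ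
  tendsto_weak : ∀ (φ : ℕ → I → ℂ) (ψ : I → ℂ) (M : ℝ), (∀ n, Measurable (φ n)) →
    (∀ n x, ‖φ n x‖ ≤ M) → (∀ x, Tendsto (fun n => φ n x) atTop (𝓝 (ψ x))) →
    ∀ (u : E) (ℓ : E →L[ℂ] ℂ), Tendsto (fun n => ℓ (F (φ n) u)) atTop (𝓝 (ℓ (F ψ u)))

open Classical in
/-- The Borel functional calculus `φ ↦ φ(H)` on `I`. -/
def borelCalc (H : E →ₗ.[ℂ] E) (I : Set ℝ) : (I → ℂ) → E →L[ℂ] E :=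
  if h : ∃ F, IsBorelCalculus H I F then h.choose else 0

/-- The spectral projection `1_J(H)`, for a Borel set `J ⊆ I`. -/
def spectralProj (H : E →ₗ.[ℂ] E) (I J : Set ℝ) : E →L[ℂ] E :=
  borelCalc H I fun x => J.indicator (fun _ => (1 : ℂ)) x

/-- `S` is of class `C¹(A)`: `t ↦ exp (-itA) S exp (itA)` is strongly of class `C¹`. -/
def IsC1 (W : C0Group E) (S : E →L[ℂ] E) : Prop :=
  ∀ u, ContDiff ℝ 1 fun t : ℝ => W.toFun (-t) (S (W.toFun t u))

/-- `S' = [S, iA]`, the strong derivative at `t = 0` of `exp (-itA) S exp (itA)`. -/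
def commDeriv (W : C0Group E) (S : E →L[ℂ] E) (u : E) : E :=
  deriv (fun t : ℝ => W.toFun (-t) (S (W.toFun t u))) 0

/-- The commutator `H' = [H, iA]` as a sesquilinear form on the domain of `H`, determined by
`R' = - R H' R` with `R = (H - z)⁻¹` of class `C¹(A)`; that is,
`⟨u, H' v⟩ = - ⟨(H - z̄) u, R' (H - z) v⟩`. The form does not depend on the choice of `z`. -/
def commForm (k : KreinStructure E) (W : C0Group E) (H : E →ₗ.[ℂ] E) (z : ℂ)
    (u v : H.domain) : ℂ :=
  - k.form (H u - conj z • (u : E)) (commDeriv W (resolventOp H z) (H v - z • (v : E)))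

end

noncomputable section

set_option linter.unusedSectionVars false

/-! ### Stability properties of test functions -/

section TestFunctions

variable {V : Set ℝ} {χ ψ : ℝ → ℂ}

/-! On the range of a nonnegative spectral projection $1_J(H)$ the indefinite form is as good as a
scalar product: Cauchy–Schwarz for $\langle u|1_J(H)v\rangle$ and uniform boundedness give
$\|u\|^2\le C\langle u|u\rangle$ there (`exists_norm_sq_le_form`). Hence, if Borel sets $S_n\subset
J$ are such that each point lies in only finitely many of them, the weak convergence
$1_{S_n}(H)\to0$ is strong, and $1_{S_n}(H)K\to0$ in norm for compact $K$
(`eventually_norm_spectralProj_compact_le`). For $v$ in the range of such a projection the compact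
term is then absorbed into $a\langle v|v\rangle$ at the price of an arbitrarily small loss in $a$
(`mourre_estimate_of_small`).

The virial theorem `commForm_eigenvector` says $\langle u|H'u\rangle=0$ for eigenvectors. With
infinitely many eigenvalues $\lambda_n\in J$, the sets $S_n=\{\lambda_n\}$ would give $0\ge c\langle
u|u\rangle$ with $c>0$ for some eigenvector $u\neq0$. On a single eigenspace the estimate becomes
$a\langle u|u\rangle\le-\mathrm{Re}\langle u|Ku\rangle$, so $K$ is bounded below there and the
dimension is finite. If $\lambda$ is not an eigenvalue, $1_{\{\lambda\}}(H)=0$, and the absorption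
argument applies to shrinking compact neighbourhoods of $\lambda$ with $\lambda$ removed.

Most of the work is to show that the Borel calculus exists. Polynomial growth of the resolvent and
repeated integration by parts give the norm limit defining $\chi(H)$. Multiplicativity comes from
$\chi(H)R(z)=(\chi/(\cdot-z))(H)$ and convergence of Poisson integrals. For fixed $v,u$ the
functional $\chi\mapsto\langle v|\chi(H)u\rangle$ is bounded in sup norm. Its total variation is
represented by a finite measure $\mu$ (Riesz–Markov), and Hahn–Banach for the $L^1(\mu)$ seminorm
extends it to bounded Borel functions. Such extensions are determined by test functions, so every
algebraic identity passes from test functions to Borel functions. -/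

theorem IsTestFunctionOn.mono {V' : Set ℝ} (h : IsTestFunctionOn V χ) (hV : tsupport χ ⊆ V') :
    IsTestFunctionOn V' χ := ⟨h.1, h.2.1, hV⟩

theorem IsTestFunctionOn.zero : IsTestFunctionOn V (0 : ℝ → ℂ) :=
  ⟨contDiff_const, HasCompactSupport.zero, by simp [tsupport]⟩

theorem IsTestFunctionOn.add (h : IsTestFunctionOn V χ) (h' : IsTestFunctionOn V ψ) :
    IsTestFunctionOn V (χ + ψ) :=
  ⟨h.1.add h'.1, h.2.1.add h'.2.1, (tsupport_add _ _).trans (Set.union_subset h.2.2 h'.2.2)⟩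

theorem IsTestFunctionOn.mul_of_contDiffOn {m : ℝ → ℂ} (h : IsTestFunctionOn V χ)
    (hm : ∀ x ∈ tsupport χ, ContDiffAt ℝ ∞ m x) : IsTestFunctionOn V (fun x => χ x * m x) := by
  refine ⟨contDiff_iff_contDiffAt.2 fun x => ?_, h.2.1.mul_right,
    (tsupport_mul_subset_left).trans h.2.2⟩
  by_cases hx : x ∈ tsupport χ
  · exact h.1.contDiffAt.mul (hm x hx)
  · have : (fun x => χ x * m x) =ᶠ[𝓝 x] fun _ => 0 := by
      filter_upwards [notMem_tsupport_iff_eventuallyEq.1 hx] with y hy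
      simp [hy]
    exact contDiffAt_const.congr_of_eventuallyEq this

theorem IsTestFunctionOn.mul {m : ℝ → ℂ} (h : IsTestFunctionOn V χ)
    (hm : ContDiff ℝ ∞ m) : IsTestFunctionOn V (fun x => χ x * m x) :=
  h.mul_of_contDiffOn fun _ _ => hm.contDiffAt

theorem IsTestFunctionOn.smul (h : IsTestFunctionOn V χ) (c : ℂ) :
    IsTestFunctionOn V (c • χ) := by
  have := h.mul (m := fun _ => c) contDiff_const
  convert this using 1
  ext x; simp [mul_comm]

theorem IsTestFunctionOn.conj (h : IsTestFunctionOn V χ) :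
    IsTestFunctionOn V (fun x => conj (χ x)) := by
  refine ⟨Complex.conjCLE.contDiff.comp h.1, h.2.1.comp_left (g := conj) (map_zero _), ?_⟩
  exact (closure_mono (Function.support_comp_subset (map_zero _) χ)).trans h.2.2

theorem IsTestFunctionOn.deriv (h : IsTestFunctionOn V χ) : IsTestFunctionOn V (deriv χ) :=
  ⟨h.1.deriv' , h.2.1.deriv, tsupport_deriv_subset.trans h.2.2⟩

theorem IsTestFunctionOn.continuous (h : IsTestFunctionOn V χ) : Continuous χ := h.1.continuous

theorem IsTestFunctionOn.hasDerivAt (h : IsTestFunctionOn V χ) (x : ℝ) :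
    HasDerivAt χ (_root_.deriv χ x) x :=
  (h.1.differentiable (by simp)).differentiableAt.hasDerivAt

theorem IsTestFunctionOn.eq_zero (h : IsTestFunctionOn V χ) {x : ℝ} (hx : x ∉ V) : χ x = 0 :=
  image_eq_zero_of_notMem_tsupport fun h' => hx (h.2.2 h')

theorem IsTestFunctionOn.integrable (h : IsTestFunctionOn V χ) : Integrable χ :=
  h.continuous.integrable_of_hasCompactSupport h.2.1

variable {X : Type*} [NormedAddCommGroup X] [NormedSpace ℂ X]

theorem IsTestFunctionOn.continuous_smul (hV : IsOpen V) (h : IsTestFunctionOn V χ) {g : ℝ → X}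
    (hg : ContinuousOn g V) : Continuous fun x => χ x • g x := by
  refine continuous_iff_continuousAt.2 fun x => ?_
  by_cases hx : x ∈ V
  · exact h.continuous.continuousAt.smul (hg.continuousAt (hV.mem_nhds hx))
  · have : (fun x => χ x • g x) =ᶠ[𝓝 x] fun _ => 0 := by
      filter_upwards [notMem_tsupport_iff_eventuallyEq.1 fun h' => hx (h.2.2 h')] with y hy
      simp [hy]
    exact continuousAt_const.congr this.symm

theorem IsTestFunctionOn.integrable_smul (hV : IsOpen V) (h : IsTestFunctionOn V χ) {g : ℝ → X}
    (hg : ContinuousOn g V) : Integrable fun x => χ x • g x :=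
  (h.continuous_smul hV hg).integrable_of_hasCompactSupport h.2.1.smul_right

end TestFunctions

/-! ### Distributional boundary values of functions of polynomial growth -/

section BoundaryValues

variable {X : Type*} [NormedAddCommGroup X] [NormedSpace ℂ X]

/-- The function `g x s`, for `x ∈ V` and `0 < s < ν`, is holomorphic in `x + c⁻¹ s` and has at most
polynomial growth as `s → 0`. -/
structure HasPolyBoundaryGrowth (V : Set ℝ) (ν : ℝ) (c : ℂ) (g g' : ℝ → ℝ → X) : Prop where
  isOpen : IsOpen V
  pos : 0 < ν
  le_one : ν ≤ 1
  hasDerivAt_left : ∀ x ∈ V, ∀ s, 0 < s → s < ν → HasDerivAt (fun x => g x s) (g' x s) x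
  hasDerivAt_right : ∀ x ∈ V, ∀ s, 0 < s → s < ν → HasDerivAt (fun s => g x s) (c • g' x s) s
  continuousOn : ContinuousOn (Function.uncurry g') (V ×ˢ Set.Ioo 0 ν)
  growth : ∃ (C : ℝ) (N : ℕ), ∀ x ∈ V, ∀ s, 0 < s → s < ν → ‖g x s‖ ≤ C * s ^ (-(N : ℝ))

variable {V : Set ℝ} {ν : ℝ} {c : ℂ} {g g' : ℝ → ℝ → X}

theorem HasPolyBoundaryGrowth.continuousOn_left (hg : HasPolyBoundaryGrowth V ν c g g') {s : ℝ}
    (hs : 0 < s) (hs' : s < ν) : ContinuousOn (fun x => g x s) V := fun x hx =>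
  (hg.hasDerivAt_left x hx s hs hs').continuousAt.continuousWithinAt

theorem HasPolyBoundaryGrowth.continuousOn_left' (hg : HasPolyBoundaryGrowth V ν c g g') {s : ℝ}
    (hs : 0 < s) (hs' : s < ν) : ContinuousOn (fun x => g' x s) V :=
  hg.continuousOn.comp (f := fun x => (x, s)) (by fun_prop) fun _ hx => ⟨hx, hs, hs'⟩

/-- The Cauchy–Riemann relation $\partial_s g=c\,\partial_x g$ and an integration by parts in $x$
move the derivative in $s$ onto the test function. -/
theorem HasPolyBoundaryGrowth.hasDerivAt_integral [CompleteSpace X]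
    (hg : HasPolyBoundaryGrowth V ν c g g') {χ : ℝ → ℂ} (hχ : IsTestFunctionOn V χ) {s : ℝ}
    (hs : 0 < s) (hs' : s < ν) :
    HasDerivAt (fun s => ∫ x, χ x • g x s) (-c • ∫ x, deriv χ x • g x s) s := by
  have hIcc : Set.Icc (s / 2) ((s + ν) / 2) ⊆ Set.Ioo 0 ν := fun t ht =>
    ⟨by linarith [ht.1], by linarith [ht.2]⟩
  obtain ⟨B, hB⟩ := (hχ.2.1.prod (isCompact_Icc (a := s / 2) (b := (s + ν) / 2))).exists_bound_of_continuousOn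
    (hg.continuousOn.mono (Set.prod_mono hχ.2.2 hIcc))
  have hnhds : Set.Icc (s / 2) ((s + ν) / 2) ∈ 𝓝 s := Icc_mem_nhds (by linarith) (by linarith)
  have key := hasDerivAt_integral_of_dominated_loc_of_deriv_le (μ := volume) (x₀ := s)
    (F := fun s x => χ x • g x s) (F' := fun s x => χ x • c • g' x s)
    (bound := fun x => ‖χ x‖ * (‖c‖ * B)) hnhds ?_ ?_ ?_ ?_ ?_ ?_
  · have e : ∫ x, χ x • c • g' x s = -c • ∫ x, deriv χ x • g x s := by
      have h0 := integral_eq_zero_of_hasDerivAt_of_integrable (f := fun x => χ x • g x s)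
        (f' := fun x => χ x • g' x s + deriv χ x • g x s) (fun x => ?_)
        ((hχ.integrable_smul hg.isOpen (hg.continuousOn_left' hs hs')).add
          (hχ.deriv.integrable_smul hg.isOpen (hg.continuousOn_left hs hs')))
        (hχ.integrable_smul hg.isOpen (hg.continuousOn_left hs hs'))
      · rw [integral_add (hχ.integrable_smul hg.isOpen (hg.continuousOn_left' hs hs'))
          (hχ.deriv.integrable_smul hg.isOpen (hg.continuousOn_left hs hs'))] at h0
        simp_rw [smul_comm _ c]
        rw [integral_smul, eq_neg_of_add_eq_zero_left h0, smul_neg, neg_smul]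
      · by_cases hx : x ∈ V
        · exact (hχ.hasDerivAt x).smul (hg.hasDerivAt_left x hx s hs hs')
        · have hx' : x ∉ tsupport χ := fun h => hx (hχ.2.2 h)
          have hx'' : x ∉ tsupport (deriv χ) := fun h => hx (hχ.deriv.2.2 h)
          rw [image_eq_zero_of_notMem_tsupport hx', image_eq_zero_of_notMem_tsupport hx'']
          have : (fun x => χ x • g x s) =ᶠ[𝓝 x] fun _ => 0 := by
            filter_upwards [notMem_tsupport_iff_eventuallyEq.1 hx'] with y hy
            simp [hy]
          simpa using (hasDerivAt_const x (0 : X)).congr_of_eventuallyEq this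
    rw [← e]
    exact key.2
  · filter_upwards [hnhds] with t ht
    exact (hχ.continuous_smul hg.isOpen (hg.continuousOn_left (hIcc ht).1
      (hIcc ht).2)).aestronglyMeasurable
  · exact hχ.integrable_smul hg.isOpen (hg.continuousOn_left hs hs')
  · exact (hχ.continuous_smul hg.isOpen
      ((hg.continuousOn_left' hs hs').const_smul c)).aestronglyMeasurable
  · refine .of_forall fun x t ht => ?_
    rw [norm_smul, norm_smul]
    by_cases hx : x ∈ tsupport χ
    · have := hB (x, t) ⟨hx, ht⟩
      exact mul_le_mul_of_nonneg_left (mul_le_mul_of_nonneg_left this (norm_nonneg _))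
        (norm_nonneg _)
    · simp [image_eq_zero_of_notMem_tsupport hx]
  · exact hχ.integrable.norm.mul_const _
  · refine .of_forall fun x t ht => ?_
    by_cases hx : x ∈ V
    · exact (hg.hasDerivAt_right x hx t (hIcc ht).1 (hIcc ht).2).const_smul (χ x)
    · simpa [hχ.eq_zero hx] using hasDerivAt_const t (0 : X)

/-- A bound `‖G'‖ ≤ B s ^ (-p - 1)` of the derivative controls the increments of `G`. -/
theorem norm_sub_le_of_norm_deriv_le_rpow {G G' : ℝ → X} {ν B p : ℝ} (hp : p ≠ 0)
    (hG : ∀ s, 0 < s → s < ν → HasDerivAt G (G' s) s)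
    (hB : ∀ s, 0 < s → s < ν → ‖G' s‖ ≤ B * s ^ (-p - 1)) {s t : ℝ} (hs : 0 < s) (hst : s ≤ t)
    (ht : t < ν) : ‖G t - G s‖ ≤ B / p * (s ^ (-p) - t ^ (-p)) := by
  have hpow : ∀ r, 0 < r → HasDerivAt (fun r : ℝ => B / p * (s ^ (-p) - r ^ (-p)))
      (B * r ^ (-p - 1)) r := fun r hr => by
    have := ((Real.hasDerivAt_rpow_const (p := -p) (Or.inl hr.ne')).const_sub
      (s ^ (-p))).const_mul (B / p)
    refine this.congr_deriv ?_
    rw [neg_mul, neg_neg, ← mul_assoc, div_mul_cancel₀ _ hp]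
  have := image_norm_le_of_norm_deriv_right_le_deriv_boundary' (a := s) (b := t)
    (f := fun r => G r - G s) (f' := G') (B := fun r : ℝ => B / p * (s ^ (-p) - r ^ (-p)))
    (B' := fun r => B * r ^ (-p - 1)) ?_ ?_ ?_ ?_ ?_ ?_
  · exact this ⟨hst, le_rfl⟩
  · exact fun r hr => ((hG r (hs.trans_le hr.1) (hr.2.trans_lt ht)).sub_const
      _).continuousAt.continuousWithinAt
  · exact fun r hr => ((hG r (hs.trans_le hr.1) (hr.2.trans ht)).sub_const _).hasDerivWithinAt
  · simp
  · exact fun r hr => (hpow r (hs.trans_le hr.1)).continuousAt.continuousWithinAt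
  · exact fun r hr => (hpow r (hs.trans_le hr.1)).hasDerivWithinAt
  · exact fun r hr => hB r (hs.trans_le hr.1) (hr.2.trans ht)

theorem HasPolyBoundaryGrowth.exists_norm_integral_le
    (hg : HasPolyBoundaryGrowth V ν c g g') : ∃ N : ℕ, ∀ χ : ℝ → ℂ, IsTestFunctionOn V χ →
      ∃ C, 0 ≤ C ∧ ∀ s, 0 < s → s < ν → ‖∫ x, χ x • g x s‖ ≤ C * s ^ (-(N : ℝ)) := by
  obtain ⟨C, N, hC⟩ := hg.growth
  refine ⟨N, fun χ hχ => ⟨(∫ x, ‖χ x‖) * |C|, by positivity, fun s hs hs' => ?_⟩⟩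
  rw [mul_assoc, ← integral_mul_const]
  refine norm_integral_le_of_norm_le (hχ.integrable.norm.mul_const _) (.of_forall fun x => ?_)
  rw [norm_smul]
  by_cases hx : x ∈ V
  · exact mul_le_mul_of_nonneg_left ((hC x hx s hs hs').trans
      (mul_le_mul_of_nonneg_right (le_abs_self C) (by positivity))) (norm_nonneg _)
  · simp [hχ.eq_zero hx]

/-- The $s$-derivative is an integral of the same type against $\chi'$, so integrating its bound in
$s$ lowers the order of blow-up by one. Half-integer exponents keep logarithms out of the induction,
which stops at an integrable singularity. -/
theorem HasPolyBoundaryGrowth.norm_integral_le [CompleteSpace X]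
    (hg : HasPolyBoundaryGrowth V ν c g g') (N : ℕ)
    (h : ∀ χ : ℝ → ℂ, IsTestFunctionOn V χ → ∃ C, 0 ≤ C ∧ ∀ s, 0 < s → s < ν →
      ‖∫ x, χ x • g x s‖ ≤ C * s ^ (-(N + 1 / 2 : ℝ))) :
    ∀ χ : ℝ → ℂ, IsTestFunctionOn V χ → ∃ C, 0 ≤ C ∧ ∀ s, 0 < s → s < ν →
      ‖∫ x, χ x • g x s‖ ≤ C * s ^ (-(1 / 2 : ℝ)) := by
  induction N with
  | zero => simpa using h
  | succ N ih =>
    refine ih fun χ hχ => ?_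
    obtain ⟨C₁, hC₁, h₁⟩ := h _ hχ.deriv
    obtain ⟨C₀, hC₀, h₀⟩ := h _ hχ
    set p : ℝ := N + 1 / 2 with hp
    have hp0 : 0 < p := by positivity
    set G := fun s => ∫ x, χ x • g x s with hG
    have hν := hg.pos
    refine ⟨‖G (ν / 2)‖ + ‖c‖ * C₁ / p + C₀ * (ν / 2) ^ (-(1 : ℝ)), by positivity,
      fun s hs hs' => ?_⟩
    have hs1 : 1 ≤ s ^ (-p) :=
      Real.one_le_rpow_of_pos_of_le_one_of_nonpos hs (hs'.le.trans hg.le_one) (by linarith)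
    have hspos : 0 < s ^ (-p) := by positivity
    -- Below $\nu/2$ the bound is integrated from $\nu/2$; above it, the old bound suffices since
    -- the extra factor $s^{-1}$ is at most $(\nu/2)^{-1}$.
    rcases le_total s (ν / 2) with hle | hle
    · have := norm_sub_le_of_norm_deriv_le_rpow (G := G) (ν := ν) (B := ‖c‖ * C₁) hp0.ne'
        (fun t ht ht' => hg.hasDerivAt_integral hχ ht ht') (fun t ht ht' => by
          rw [norm_smul, norm_neg, mul_assoc]
          refine mul_le_mul_of_nonneg_left ((h₁ t ht ht').trans_eq ?_) (norm_nonneg _)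
          congr 2
          push_cast
          rw [hp]
          ring) hs hle (by linarith)
      have h2 : ‖G s‖ ≤ ‖G (ν / 2)‖ + ‖G (ν / 2) - G s‖ := by
        simpa [norm_sub_rev] using norm_le_norm_add_norm_sub' (G s) (G (ν / 2))
      have h3 : ‖c‖ * C₁ / p * (s ^ (-p) - (ν / 2) ^ (-p)) ≤ ‖c‖ * C₁ / p * s ^ (-p) :=
        mul_le_mul_of_nonneg_left (by linarith [Real.rpow_nonneg (by linarith : 0 ≤ ν / 2) (-p)])
          (by positivity)
      have h4 : ‖G (ν / 2)‖ ≤ ‖G (ν / 2)‖ * s ^ (-p) := le_mul_of_one_le_right (norm_nonneg _) hs1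
      have h5 : 0 ≤ C₀ * (ν / 2) ^ (-(1 : ℝ)) * s ^ (-p) := by positivity
      calc ‖G s‖ ≤ ‖G (ν / 2)‖ * s ^ (-p) + ‖c‖ * C₁ / p * s ^ (-p) + 
            C₀ * (ν / 2) ^ (-(1 : ℝ)) * s ^ (-p) := by linarith
        _ = _ := by ring
    · have e : s ^ (-(((N + 1 : ℕ) : ℝ) + 1 / 2)) = s ^ (-(1 : ℝ)) * s ^ (-p) := by
        rw [← Real.rpow_add hs]
        congr 1
        push_cast
        rw [hp]
        ring
      have h6 : s ^ (-(1 : ℝ)) ≤ (ν / 2) ^ (-(1 : ℝ)) :=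
        Real.rpow_le_rpow_of_nonpos (by linarith) hle (by norm_num)
      calc ‖G s‖ ≤ C₀ * (s ^ (-(1 : ℝ)) * s ^ (-p)) := by rw [← e]; exact h₀ s hs hs'
        _ ≤ C₀ * ((ν / 2) ^ (-(1 : ℝ)) * s ^ (-p)) := by gcongr
        _ = C₀ * (ν / 2) ^ (-(1 : ℝ)) * s ^ (-p) := by ring
        _ ≤ _ := mul_le_mul_of_nonneg_right (le_add_of_nonneg_left (by positivity)) hspos.le

/-- The bound $s^{-1/2}$, applied to $\chi'$, makes the $s$-derivative of the integral integrable at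
$0$; the increments are then controlled by $s^{1/2}+t^{1/2}$ and the Cauchy criterion applies. -/
theorem HasPolyBoundaryGrowth.exists_tendsto [CompleteSpace X]
    (hg : HasPolyBoundaryGrowth V ν c g g') {χ : ℝ → ℂ} (hχ : IsTestFunctionOn V χ) :
    ∃ L, Tendsto (fun s => ∫ x, χ x • g x s) (𝓝[>] 0) (𝓝 L) := by
  obtain ⟨N, hN⟩ := hg.exists_norm_integral_le
  obtain ⟨C, hC, h⟩ := hg.norm_integral_le N (fun χ hχ => by
    obtain ⟨C, hC, h⟩ := hN χ hχ
    refine ⟨C, hC, fun s hs hs' => (h s hs hs').trans (mul_le_mul_of_nonneg_left ?_ hC)⟩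
    exact Real.rpow_le_rpow_of_exponent_ge hs (hs'.le.trans hg.le_one) (by linarith)) _ hχ.deriv
  set G := fun s => ∫ x, χ x • g x s with hG
  have key : ∀ s t, 0 < s → s ≤ t → t < ν →
      ‖G t - G s‖ ≤ ‖c‖ * C / (-(1 / 2)) * (s ^ (-(-(1 / 2 : ℝ))) - t ^ (-(-(1 / 2 : ℝ)))) :=
    fun s t hs hst ht => norm_sub_le_of_norm_deriv_le_rpow (G := G) (ν := ν) (B := ‖c‖ * C)
      (by norm_num) (fun t ht ht' => hg.hasDerivAt_integral hχ ht ht') (fun t ht ht' => by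
          rw [norm_smul, norm_neg, mul_assoc]
          refine mul_le_mul_of_nonneg_left ((h t ht ht').trans_eq ?_) (norm_nonneg _)
          norm_num) hs hst ht
  have key' : ∀ s t, 0 < s → 0 < t → s < ν → t < ν →
      dist (G s) (G t) ≤ ‖c‖ * C * 2 * (s ^ (1 / 2 : ℝ) + t ^ (1 / 2 : ℝ)) := by
    intro s t hs ht hs' ht'
    rw [dist_eq_norm]
    have a1 : 0 ≤ s ^ (1 / 2 : ℝ) := by positivity
    have a2 : 0 ≤ t ^ (1 / 2 : ℝ) := by positivity
    have a3 : 0 ≤ ‖c‖ * C * 2 := by positivity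
    rcases le_total s t with hst | hst
    · have := key s t hs hst ht'
      rw [norm_sub_rev]
      norm_num at this ⊢
      nlinarith
    · have := key t s ht hst hs'
      norm_num at this ⊢
      nlinarith
  have hlim : Tendsto (fun p : ℝ × ℝ => ‖c‖ * C * 2 * (p.1 ^ (1 / 2 : ℝ) + p.2 ^ (1 / 2 : ℝ)))
      (𝓝[>] 0 ×ˢ 𝓝[>] 0) (𝓝 0) := by
    have h0 : Tendsto (fun s : ℝ => s ^ (1 / 2 : ℝ)) (𝓝[>] 0) (𝓝 0) := by
      have := (Real.continuousAt_rpow_const (0 : ℝ) (1 / 2) (Or.inr (by norm_num))).tendsto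
      rw [Real.zero_rpow (by norm_num)] at this
      exact this.mono_left nhdsWithin_le_nhds
    simpa using ((h0.comp tendsto_fst).add (h0.comp tendsto_snd)).const_mul (‖c‖ * C * 2)
  have hcau : Cauchy (map G (𝓝[>] (0 : ℝ))) := by
    rw [cauchy_map_iff]
    refine ⟨inferInstance, ?_⟩
    rw [tendsto_uniformity_iff_dist_tendsto_zero]
    refine squeeze_zero' (.of_forall fun _ => dist_nonneg) ?_ hlim
    have hm : ∀ᶠ s in 𝓝[>] (0 : ℝ), 0 < s ∧ s < ν := Ioo_mem_nhdsGT hg.pos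
    filter_upwards [hm.prod_mk hm] with p hp
    exact key' _ _ hp.1.1 hp.2.1 hp.1.2 hp.2.2
  exact cauchy_map_iff_exists_tendsto.1 hcau

theorem contDiff_inv_ofReal_sub {z : ℂ} (hz : z.im ≠ 0) :
    ContDiff ℝ ∞ fun x : ℝ => ((x : ℂ) - z)⁻¹ := by
  refine (Complex.ofRealCLM.contDiff.sub contDiff_const).inv fun x hx => hz ?_
  simpa using (congrArg Complex.im hx)

/-- The boundary value is not affected if `1 / (x - z)` is replaced by `1 / (x + d s - z)`. -/
theorem HasPolyBoundaryGrowth.tendsto_integral_inv [CompleteSpace X]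
    (hg : HasPolyBoundaryGrowth V ν c g g') {χ : ℝ → ℂ} (hχ : IsTestFunctionOn V χ) {z d : ℂ}
    (hz : z.im ≠ 0) {L : X}
    (hL : Tendsto (fun s => ∫ x, (χ x * ((x : ℂ) - z)⁻¹) • g x s) (𝓝[>] 0) (𝓝 L)) :
    Tendsto (fun s : ℝ => ∫ x, (χ x * ((x : ℂ) + s * d - z)⁻¹) • g x s) (𝓝[>] 0) (𝓝 L) := by
  set G : (ℝ → ℂ) → ℝ → X := fun χ s => ∫ x, (χ x * ((x : ℂ) - z)⁻¹) • g x s with hG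
  set P : (ℝ → ℂ) → ℝ → X := fun χ s => ∫ x, (χ x * ((x : ℂ) + s * d - z)⁻¹) • g x s with hP
  have hw := contDiff_inv_ofReal_sub hz
  have hxz : ∀ x : ℝ, (x : ℂ) - z ≠ 0 := fun x hx => hz (by simpa using congrArg Complex.im hx)
  have hzpos : 0 < |z.im| := abs_pos.2 hz
  have hsmall : ∀ᶠ s in 𝓝[>] (0 : ℝ), 0 < s ∧ s < ν ∧ s < 1 ∧
      ∀ x : ℝ, |z.im| / 2 ≤ ‖(x : ℂ) + s * d - z‖ := by
    have h1 : ∀ᶠ s in 𝓝[>] (0 : ℝ), 0 < s ∧ s < |z.im| / 2 / (|d.im| + 1) :=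
      Ioo_mem_nhdsGT (by positivity)
    have h2 : ∀ᶠ s in 𝓝[>] (0 : ℝ), 0 < s ∧ s < ν := Ioo_mem_nhdsGT hg.pos
    have h3 : ∀ᶠ s in 𝓝[>] (0 : ℝ), 0 < s ∧ s < 1 := Ioo_mem_nhdsGT one_pos
    filter_upwards [h1, h2, h3] with s h1 h2 h3
    refine ⟨h1.1, h2.2, h3.2, fun x => ?_⟩
    have hs : s * (|d.im| + 1) < |z.im| / 2 := (lt_div_iff₀ (by positivity)).1 h1.2
    have h4 : |z.im| - s * |d.im| ≤ ‖(x : ℂ) + s * d - z‖ := by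
      refine le_trans ?_ (Complex.abs_im_le_norm _)
      have : ((x : ℂ) + s * d - z).im = s * d.im - z.im := by simp
      rw [this, abs_sub_comm]
      refine le_trans (le_of_eq ?_) (abs_sub_abs_le_abs_sub _ _)
      rw [abs_mul, abs_of_pos h1.1]
    nlinarith [h1.1]
  have hint : ∀ {s : ℝ}, (0 < s ∧ s < ν ∧ s < 1 ∧ ∀ x : ℝ, |z.im| / 2 ≤ ‖(x : ℂ) + s * d - z‖) →
      ∀ {ψ}, IsTestFunctionOn V ψ →
      Integrable fun x => (ψ x * ((x : ℂ) + s * d - z)⁻¹) • g x s := by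
    intro s hs ψ hψ
    refine (hψ.mul ((((Complex.ofRealCLM.contDiff.add contDiff_const).sub
      contDiff_const).inv ?_))).integrable_smul hg.isOpen (hg.continuousOn_left hs.1 hs.2.1)
    intro x hx
    have := hs.2.2.2 x
    have hx' : (x : ℂ) + s * d - z = 0 := hx
    rw [hx', norm_zero] at this
    linarith
  -- This is $\frac1{x+sd-z}=\frac1{x-z}-\frac{sd}{(x-z)(x+sd-z)}$ under the integral; the
  -- correction is again of the form `P`, with an extra factor $s$.
  have hrec : ∀ ψ, IsTestFunctionOn V ψ → ∀ᶠ s in 𝓝[>] (0 : ℝ),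
      P ψ s = G ψ s - (s * d) • P (fun x => ψ x * ((x : ℂ) - z)⁻¹) s := by
    intro ψ hψ
    filter_upwards [hsmall] with s hs
    simp only [hP, hG]
    have hi : Integrable fun x : ℝ => ((s : ℂ) * d) •
        (ψ x * ((x : ℂ) - z)⁻¹ * ((x : ℂ) + s * d - z)⁻¹) • g x s :=
      (hint hs (hψ.mul hw)).smul ((s : ℂ) * d)
    rw [← integral_smul, ← integral_sub ((hψ.mul hw).integrable_smul hg.isOpen
      (hg.continuousOn_left hs.1 hs.2.1)) hi]
    congr 1
    ext x
    have hx : (x : ℂ) + s * d - z ≠ 0 := fun h => by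
      have := hs.2.2.2 x
      rw [h, norm_zero] at this
      linarith
    rw [smul_smul, ← sub_smul]
    congr 1
    have := hxz x
    field_simp
    ring
  have hO : ∀ ψ, IsTestFunctionOn V ψ → G ψ =O[𝓝[>] 0] fun _ => (1 : ℝ) := by
    intro ψ hψ
    obtain ⟨L, hL⟩ := hg.exists_tendsto (hψ.mul hw)
    exact hL.isBigO_one ℝ
  -- Each use of the identity gains a power of $s$, so a blow-up of any polynomial order is brought
  -- down to boundedness.
  have hind : ∀ N : ℕ, (∀ ψ, IsTestFunctionOn V ψ → P ψ =O[𝓝[>] 0] fun s => (s ^ N)⁻¹) →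
      ∀ ψ, IsTestFunctionOn V ψ → P ψ =O[𝓝[>] 0] fun s => (1 : ℝ) := by
    intro N
    induction N with
    | zero => intro h; simpa using h
    | succ N ih =>
      intro h
      refine ih fun ψ hψ => ?_
      refine (Asymptotics.IsBigO.sub ?_ ?_).congr' ((hrec ψ hψ).mono fun s hs => hs.symm) .rfl
      · refine (hO ψ hψ).trans (Asymptotics.IsBigO.of_bound 1 ?_)
        filter_upwards [hsmall] with s hs
        rw [norm_one, one_mul, norm_inv, norm_pow, Real.norm_of_nonneg hs.1.le]
        exact (one_le_inv₀ (pow_pos hs.1 N)).2 (pow_le_one₀ hs.1.le hs.2.2.1.le)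
      · have h1 : (fun s : ℝ => (s : ℂ) * d) =O[𝓝[>] 0] fun s => s :=
          Asymptotics.IsBigO.of_bound ‖d‖ (.of_forall fun s => by simp [mul_comm])
        refine (h1.smul (h _ (hψ.mul hw))).congr' .rfl ?_
        filter_upwards [hsmall] with s hs
        have := hs.1.ne'
        simp only [smul_eq_mul]
        field_simp
        ring
  have hfin : ∀ ψ, IsTestFunctionOn V ψ → P ψ =O[𝓝[>] 0] fun s => (1 : ℝ) := by
    obtain ⟨C, N, hC⟩ := hg.growth
    refine hind N fun ψ hψ => ?_
    refine Asymptotics.IsBigO.of_bound ((∫ x, ‖ψ x‖) * ((|z.im| / 2)⁻¹ * |C|)) ?_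
    filter_upwards [hsmall] with s hs
    rw [mul_assoc, ← integral_mul_const]
    refine norm_integral_le_of_norm_le (hψ.integrable.norm.mul_const _) (.of_forall fun x => ?_)
    by_cases hx : x ∈ V
    · rw [norm_smul, norm_mul, norm_inv, mul_assoc, mul_assoc]
      refine mul_le_mul_of_nonneg_left ?_ (norm_nonneg _)
      refine mul_le_mul (inv_anti₀ (by positivity) (hs.2.2.2 x)) ?_ (norm_nonneg _) (by positivity)
      refine (hC x hx s hs.1 hs.2.1).trans ?_
      rw [Real.rpow_neg hs.1.le, Real.rpow_natCast, Real.norm_of_nonneg (by have := hs.1; positivity)]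
      exact mul_le_mul_of_nonneg_right (le_abs_self C) (by have := hs.1; positivity)
    · simp [hψ.eq_zero hx]
  have hlim : Tendsto (fun s : ℝ => (s * d) • P (fun x => χ x * ((x : ℂ) - z)⁻¹) s)
      (𝓝[>] 0) (𝓝 0) := by
    have h1 : (fun s : ℝ => (s : ℂ) * d) =O[𝓝[>] 0] fun s => s :=
      Asymptotics.IsBigO.of_bound ‖d‖ (.of_forall fun s => by simp [mul_comm])
    refine (h1.smul (hfin _ (hχ.mul hw))).trans_tendsto ?_
    simp only [smul_eq_mul, mul_one]
    exact tendsto_id.mono_left nhdsWithin_le_nhds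
  have := hL.sub hlim
  rw [sub_zero] at this
  exact this.congr' ((hrec χ hχ).mono fun s hs => hs.symm)

end BoundaryValues

/-! ### Resolvent identities and strips of polynomial growth -/

section Resolvent

variable {E : Type*} [NormedAddCommGroup E] [NormedSpace ℂ E] {H : E →ₗ.[ℂ] E}

theorem isResolventAt_resolventOp {z : ℂ} (hz : z ∈ resolventSetOp H) :
    IsResolventAt H z (resolventOp H z) := by
  have h : ∃ R, IsResolventAt H z R := hz
  rw [resolventOp, dif_pos h]
  exact h.choose_spec

theorem resolventOp_mem {z : ℂ} (hz : z ∈ resolventSetOp H) (u : E) :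
    resolventOp H z u ∈ H.domain :=
  ((isResolventAt_resolventOp hz).1 u).1

theorem apply_resolventOp {z : ℂ} (hz : z ∈ resolventSetOp H) (u : E) :
    H ⟨resolventOp H z u, resolventOp_mem hz u⟩ = u + z • resolventOp H z u :=
  sub_eq_iff_eq_add.1 ((isResolventAt_resolventOp hz).1 u).2

theorem resolventOp_apply_sub {z : ℂ} (hz : z ∈ resolventSetOp H) (v : H.domain) :
    resolventOp H z (H v - z • (v : E)) = v :=
  (isResolventAt_resolventOp hz).2 v

theorem resolventOp_sub {z w : ℂ} (hz : z ∈ resolventSetOp H) (hw : w ∈ resolventSetOp H) :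
    resolventOp H z - resolventOp H w = (z - w) • (resolventOp H z * resolventOp H w) := by
  ext u
  have h1 := resolventOp_apply_sub hz ⟨resolventOp H w u, resolventOp_mem hw u⟩
  rw [apply_resolventOp hw] at h1
  simp only [map_sub, map_add, map_smul] at h1
  simp only [sub_apply, smul_apply, mul_apply_eq_comp, sub_smul]
  linear_combination (norm := module) h1

theorem resolventOp_commute {z w : ℂ} (hz : z ∈ resolventSetOp H) (hw : w ∈ resolventSetOp H) :
    resolventOp H z * resolventOp H w = resolventOp H w * resolventOp H z := by
  rcases eq_or_ne z w with rfl | hne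
  · rfl
  · have h1 := resolventOp_sub hz hw
    have h2 := resolventOp_sub hw hz
    rw [← neg_sub, h2, ← neg_smul, neg_sub] at h1
    exact (smul_right_injective _ (sub_ne_zero.2 hne) h1).symm

theorem resolventOp_mul {z w : ℂ} (hz : z ∈ resolventSetOp H) (hw : w ∈ resolventSetOp H)
    (hne : z - w ≠ 0) :
    resolventOp H z * resolventOp H w = (z - w)⁻¹ • (resolventOp H z - resolventOp H w) := by
  rw [resolventOp_sub hz hw, smul_smul, inv_mul_cancel₀ hne, one_smul]

/-- The local bound turns the resolvent identity into continuity at $z$; the slope at $z$ equals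
$R(w)R(z)$, which then tends to $R(z)^2$. -/
theorem hasDerivAt_resolventOp {z : ℂ} {B : ℝ} (hz : z ∈ resolventSetOp H)
    (h : ∀ᶠ w in 𝓝 z, w ∈ resolventSetOp H ∧ ‖resolventOp H w‖ ≤ B) :
    HasDerivAt (resolventOp H) (resolventOp H z * resolventOp H z) z := by
  have hc : Tendsto (resolventOp H) (𝓝 z) (𝓝 (resolventOp H z)) := by
    rw [tendsto_iff_norm_sub_tendsto_zero]
    refine squeeze_zero' (.of_forall fun _ => norm_nonneg _)
      (g := fun w => ‖w - z‖ * (B * ‖resolventOp H z‖)) ?_ ?_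
    · filter_upwards [h] with w hw
      rw [resolventOp_sub hw.1 hz, norm_smul]
      refine mul_le_mul_of_nonneg_left ((norm_mul_le _ _).trans ?_) (norm_nonneg _)
      exact mul_le_mul_of_nonneg_right hw.2 (norm_nonneg _)
    · have : Tendsto (fun w : ℂ => ‖w - z‖) (𝓝 z) (𝓝 0) := by
        rw [← tendsto_iff_norm_sub_tendsto_zero]
        exact tendsto_id
      simpa using this.mul_const (B * ‖resolventOp H z‖)
  rw [hasDerivAt_iff_tendsto_slope]
  refine ((hc.mul_const (resolventOp H z)).mono_left nhdsWithin_le_nhds).congr' ?_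
  filter_upwards [nhdsWithin_le_nhds h, self_mem_nhdsWithin] with w hw hne
  rw [slope_def_module, resolventOp_mul hw.1 hz (sub_ne_zero.2 hne)]

/-- A strip around the real set `V` where the resolvent has at most polynomial growth. -/
structure HasResolventStrip (H : E →ₗ.[ℂ] E) (V : Set ℝ) (ν : ℝ) : Prop where
  isOpen : IsOpen V
  pos : 0 < ν
  le_one : ν ≤ 1
  mem : ∀ z : ℂ, z.re ∈ V → 0 < |z.im| → |z.im| < ν → z ∈ resolventSetOp H
  growth : ∃ (C : ℝ) (N : ℕ), 0 ≤ C ∧ ∀ z : ℂ, z.re ∈ V → 0 < |z.im| → |z.im| < ν →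
    ‖resolventOp H z‖ ≤ C * |z.im| ^ (-(N : ℝ))

/-- Finitely many local strips cover the compact set. Their union works with the smallest height and
the largest exponent, the latter giving the weaker bound because heights are at most $1$. -/
theorem exists_hasResolventStrip {K : Set ℝ} (hK : IsCompact K) (h : K ⊆ polyGrowthSet H) :
    ∃ V ν, K ⊆ V ∧ HasResolventStrip H V ν := by
  suffices ∃ V ν, K ∩ polyGrowthSet H ⊆ V ∧ HasResolventStrip H V ν by
    rwa [Set.inter_eq_left.2 h] at this
  refine hK.induction_on (p := fun s => ∃ V ν, s ∩ polyGrowthSet H ⊆ V ∧ HasResolventStrip H V ν)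
    ?_ ?_ ?_ ?_
  · exact ⟨∅, 1, by simp, isOpen_empty, one_pos, le_rfl, by simp, 0, 0, le_rfl, by simp⟩
  · rintro s t hst ⟨V, ν, ht, hV⟩
    exact ⟨V, ν, (Set.inter_subset_inter_left _ hst).trans ht, hV⟩
  · rintro s t ⟨V, ν, hs, hV⟩ ⟨V', ν', ht, hV'⟩
    refine ⟨V ∪ V', min ν ν', ?_, hV.isOpen.union hV'.isOpen, lt_min hV.pos hV'.pos,
      (min_le_left _ _).trans hV.le_one, ?_, ?_⟩
    · rw [Set.union_inter_distrib_right]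
      exact Set.union_subset_union hs ht
    · rintro z (hz | hz) h0 h1
      · exact hV.mem z hz h0 (lt_min_iff.1 h1).1
      · exact hV'.mem z hz h0 (lt_min_iff.1 h1).2
    · obtain ⟨C, N, hC, h⟩ := hV.growth
      obtain ⟨C', N', hC', h'⟩ := hV'.growth
      refine ⟨C + C', max N N', by positivity, ?_⟩
      have hpow : ∀ {M : ℕ}, M ≤ max N N' → ∀ z : ℂ, 0 < |z.im| → |z.im| < min ν ν' →
          |z.im| ^ (-(M : ℝ)) ≤ |z.im| ^ (-((max N N' : ℕ) : ℝ)) := fun hM z h0 h1 =>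
        Real.rpow_le_rpow_of_exponent_ge h0 (((lt_min_iff.1 h1).1.le).trans hV.le_one)
          (neg_le_neg (by exact_mod_cast hM))
      rintro z (hz | hz) h0 h1
      · refine (h z hz h0 (lt_min_iff.1 h1).1).trans ?_
        exact mul_le_mul (by linarith) (hpow (le_max_left _ _) z h0 h1) (by positivity)
          (by positivity)
      · refine (h' z hz h0 (lt_min_iff.1 h1).2).trans ?_
        exact mul_le_mul (by linarith) (hpow (le_max_right _ _) z h0 h1) (by positivity)
          (by positivity)
  · intro x hx
    obtain ⟨U, hU, hxU, ν, n, C, hν, hC, hR⟩ := h hx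
    refine ⟨U, mem_nhdsWithin_of_mem_nhds (hU.mem_nhds hxU), U, min ν 1, Set.inter_subset_left,
      hU, lt_min hν one_pos, min_le_right _ _,
      fun z hz h0 h1 => (hR z hz h0 (lt_min_iff.1 h1).1.le).1, C, n, hC.le, fun z hz h0 h1 => ?_⟩
    refine (hR z hz h0 (lt_min_iff.1 h1).1.le).2.trans (mul_le_mul_of_nonneg_left ?_ hC.le)
    rw [← Real.rpow_intCast]
    refine Real.rpow_le_rpow_of_exponent_ge h0 (lt_min_iff.1 h1).2.le ?_
    push_cast
    linarith

/-- The values $c=\pm i$ correspond to approaching the real axis from above and from below. -/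
theorem HasResolventStrip.hasPolyBoundaryGrowth {V : Set ℝ} {ν : ℝ}
    (h : HasResolventStrip H V ν) {c : ℂ} (hc : c = Complex.I ∨ c = -Complex.I) :
    HasPolyBoundaryGrowth V ν c (fun x s => resolventOp H ((x : ℂ) + s * c))
      (fun x s => resolventOp H ((x : ℂ) + s * c) * resolventOp H ((x : ℂ) + s * c)) := by
  have hre : ∀ x s : ℝ, ((x : ℂ) + s * c).re = x := by
    intro x s; rcases hc with rfl | rfl <;> simp
  have him : ∀ x s : ℝ, 0 < s → |((x : ℂ) + s * c).im| = s := by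
    intro x s hs; rcases hc with rfl | rfl <;> simp [abs_of_pos hs]
  obtain ⟨C, N, hC, hN⟩ := h.growth
  have hd : ∀ x ∈ V, ∀ s, 0 < s → s < ν → HasDerivAt (resolventOp H)
      (resolventOp H ((x : ℂ) + s * c) * resolventOp H ((x : ℂ) + s * c)) ((x : ℂ) + s * c) := by
    intro x hx s hs hs'
    have hm : ∀ᶠ w in 𝓝 ((x : ℂ) + s * c), w.re ∈ V ∧ s / 2 < |w.im| ∧ |w.im| < ν := by
      refine (Complex.continuous_re.continuousAt.eventually_mem ?_).and
        ((Complex.continuous_im.abs.continuousAt.eventually_const_lt ?_).and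
        (Complex.continuous_im.abs.continuousAt.eventually_lt_const ?_))
      · rw [hre]; exact h.isOpen.mem_nhds hx
      · simp only [him _ _ hs]; linarith
      · simpa only [him _ _ hs] using hs'
    refine hasDerivAt_resolventOp (B := C * (s / 2) ^ (-(N : ℝ))) (h.mem _ (by rwa [hre])
      (by rwa [him _ _ hs]) (by rwa [him _ _ hs])) ?_
    filter_upwards [hm] with w hw
    have hw0 : 0 < |w.im| := by linarith [hw.2.1]
    refine ⟨h.mem w hw.1 hw0 hw.2.2, (hN w hw.1 hw0 hw.2.2).trans ?_⟩
    exact mul_le_mul_of_nonneg_left (Real.rpow_le_rpow_of_nonpos (by linarith) hw.2.1.le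
      (by simp)) hC
  refine ⟨h.isOpen, h.pos, h.le_one, fun x hx s hs hs' => ?_, fun x hx s hs hs' => ?_, ?_,
    C, N, fun x hx s hs hs' => ?_⟩
  · have h1 : HasDerivAt (fun x : ℝ => (x : ℂ) + s * c) 1 x :=
      (Complex.ofRealCLM.hasDerivAt (x := x)).add_const _
    have := (hd x hx s hs hs').scomp x h1
    rw [one_smul] at this
    exact this
  · have h1 : HasDerivAt (fun s : ℝ => (x : ℂ) + s * c) c s := by
      simpa using ((Complex.ofRealCLM.hasDerivAt (x := s)).mul_const c).const_add (x : ℂ)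
    exact (hd x hx s hs hs').scomp s h1
  · have : ContinuousOn (fun p : ℝ × ℝ => resolventOp H ((p.1 : ℂ) + p.2 * c))
        (V ×ˢ Set.Ioo 0 ν) := by
      intro p hp
      refine ((hd p.1 hp.1 p.2 hp.2.1 hp.2.2).continuousAt.comp (f := fun p : ℝ × ℝ =>
        (p.1 : ℂ) + p.2 * c) (x := p) ?_).continuousWithinAt
      fun_prop
    exact this.mul this
  · have := hN ((x : ℂ) + s * c) (by rwa [hre]) (by rwa [him _ _ hs]) (by rwa [him _ _ hs])
    rwa [him _ _ hs] at this

end Resolvent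

/-! ### The smooth functional calculus -/

section SmoothCalculus

variable {E : Type*} [NormedAddCommGroup E] [NormedSpace ℂ E] [CompleteSpace E] {H : E →ₗ.[ℂ] E}

/-- The approximations of `χ(H)` at height `μ`. -/
def smoothCalcApprox (H : E →ₗ.[ℂ] E) (χ : ℝ → ℂ) (μ : ℝ) : E →L[ℂ] E :=
  (2 * (Real.pi : ℂ) * Complex.I)⁻¹ •
    ∫ x : ℝ, χ x •
      (resolventOp H ((x : ℂ) + μ * Complex.I) - resolventOp H ((x : ℂ) - μ * Complex.I))

theorem exists_strip_of_isTestFunctionOn {χ : ℝ → ℂ}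
    (hχ : IsTestFunctionOn (polyGrowthSet H) χ) :
    ∃ V ν, HasResolventStrip H V ν ∧ IsTestFunctionOn V χ := by
  obtain ⟨V, ν, hV, h⟩ := exists_hasResolventStrip hχ.2.1 hχ.2.2
  exact ⟨V, ν, h, hχ.mono hV⟩

section Strip

variable {V : Set ℝ} {ν : ℝ} {χ : ℝ → ℂ}

theorem HasResolventStrip.integrable (h : HasResolventStrip H V ν) (hχ : IsTestFunctionOn V χ)
    {μ : ℝ} (hμ : 0 < μ) (hμ' : μ < ν) {c : ℂ} (hc : c = Complex.I ∨ c = -Complex.I) :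
    Integrable fun x : ℝ => χ x • resolventOp H ((x : ℂ) + μ * c) :=
  hχ.integrable_smul h.isOpen ((h.hasPolyBoundaryGrowth hc).continuousOn_left hμ hμ')

theorem HasResolventStrip.smoothCalcApprox_eq (h : HasResolventStrip H V ν)
    (hχ : IsTestFunctionOn V χ) {μ : ℝ} (hμ : 0 < μ) (hμ' : μ < ν) :
    smoothCalcApprox H χ μ = (2 * (Real.pi : ℂ) * Complex.I)⁻¹ •
      ((∫ x : ℝ, χ x • resolventOp H ((x : ℂ) + μ * Complex.I)) -
        ∫ x : ℝ, χ x • resolventOp H ((x : ℂ) + μ * -Complex.I)) := by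
  rw [smoothCalcApprox, ← integral_sub (h.integrable hχ hμ hμ' (.inl rfl))
    (h.integrable hχ hμ hμ' (.inr rfl))]
  simp only [smul_sub, mul_neg, ← sub_eq_add_neg]

theorem HasResolventStrip.integrable_sub (h : HasResolventStrip H V ν) (hχ : IsTestFunctionOn V χ)
    {μ : ℝ} (hμ : 0 < μ) (hμ' : μ < ν) :
    Integrable fun x : ℝ => χ x •
      (resolventOp H ((x : ℂ) + μ * Complex.I) - resolventOp H ((x : ℂ) - μ * Complex.I)) := by
  have := (h.integrable hχ hμ hμ' (.inl rfl)).sub (h.integrable hχ hμ hμ' (.inr rfl))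
  refine this.congr (.of_forall fun x => ?_)
  simp only [Pi.sub_apply, smul_sub, mul_neg, ← sub_eq_add_neg]

theorem HasResolventStrip.eventually (h : HasResolventStrip H V ν) :
    ∀ᶠ μ in 𝓝[>] (0 : ℝ), 0 < μ ∧ μ < ν := Ioo_mem_nhdsGT h.pos

theorem HasResolventStrip.mem_add (h : HasResolventStrip H V ν) {x : ℝ} (hx : x ∈ V) {μ : ℝ}
    (hμ : 0 < μ) (hμ' : μ < ν) {c : ℂ} (hc : c = Complex.I ∨ c = -Complex.I) :
    (x : ℂ) + μ * c ∈ resolventSetOp H := by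
  rcases hc with rfl | rfl <;>
  exact h.mem _ (by simpa) (by simpa [abs_of_pos hμ]) (by simpa [abs_of_pos hμ])

theorem HasResolventStrip.exists_tendsto (h : HasResolventStrip H V ν)
    (hχ : IsTestFunctionOn V χ) :
    ∃ L, Tendsto (smoothCalcApprox H χ) (𝓝[>] 0) (𝓝 L) := by
  obtain ⟨L₁, h₁⟩ := (h.hasPolyBoundaryGrowth (.inl rfl)).exists_tendsto hχ
  obtain ⟨L₂, h₂⟩ := (h.hasPolyBoundaryGrowth (.inr rfl)).exists_tendsto hχ
  refine ⟨_, ((h₁.sub h₂).const_smul (2 * (Real.pi : ℂ) * Complex.I)⁻¹).congr' ?_⟩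
  filter_upwards [h.eventually] with μ hμ
  exact (h.smoothCalcApprox_eq hχ hμ.1 hμ.2).symm

end Strip

variable {χ ψ : ℝ → ℂ}

theorem tendsto_smoothCalc (hχ : IsTestFunctionOn (polyGrowthSet H) χ) :
    Tendsto (smoothCalcApprox H χ) (𝓝[>] 0) (𝓝 (smoothCalc H χ)) := by
  obtain ⟨V, ν, h, hχ'⟩ := exists_strip_of_isTestFunctionOn hχ
  exact tendsto_nhds_limUnder (h.exists_tendsto hχ')

theorem smoothCalc_add (hχ : IsTestFunctionOn (polyGrowthSet H) χ)
    (hψ : IsTestFunctionOn (polyGrowthSet H) ψ) :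
    smoothCalc H (χ + ψ) = smoothCalc H χ + smoothCalc H ψ := by
  refine tendsto_nhds_unique (tendsto_smoothCalc (hχ.add hψ))
    (((tendsto_smoothCalc hχ).add (tendsto_smoothCalc hψ)).congr' ?_)
  obtain ⟨V, ν, h, hχ'⟩ := exists_strip_of_isTestFunctionOn hχ
  obtain ⟨V', ν', h', hψ'⟩ := exists_strip_of_isTestFunctionOn hψ
  filter_upwards [h.eventually, h'.eventually] with μ hμ hμ'
  rw [smoothCalcApprox, smoothCalcApprox, smoothCalcApprox, ← smul_add,
    ← integral_add (h.integrable_sub hχ' hμ.1 hμ.2) (h'.integrable_sub hψ' hμ'.1 hμ'.2)]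
  simp [add_smul]

theorem smoothCalc_smul (hχ : IsTestFunctionOn (polyGrowthSet H) χ) (c : ℂ) :
    smoothCalc H (c • χ) = c • smoothCalc H χ := by
  refine tendsto_nhds_unique (tendsto_smoothCalc (hχ.smul c))
    (((tendsto_smoothCalc hχ).const_smul c).congr fun μ => ?_)
  rw [smoothCalcApprox, smoothCalcApprox, smul_comm, ← integral_smul]
  simp only [Pi.smul_apply, smul_assoc]

theorem resolventOp_mul_smoothCalc (hχ : IsTestFunctionOn (polyGrowthSet H) χ) {z : ℂ}
    (hz : z ∈ resolventSetOp H) :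
    resolventOp H z * smoothCalc H χ = smoothCalc H χ * resolventOp H z := by
  refine tendsto_nhds_unique ((tendsto_smoothCalc hχ).const_mul (resolventOp H z))
    (((tendsto_smoothCalc hχ).mul_const (resolventOp H z)).congr' ?_)
  obtain ⟨V, ν, h, hχ'⟩ := exists_strip_of_isTestFunctionOn hχ
  filter_upwards [h.eventually] with μ hμ
  rw [smoothCalcApprox, mul_smul_comm, smul_mul_assoc,
    ← integral_mul_const_of_integrable (h.integrable_sub hχ' hμ.1 hμ.2),
    ← integral_const_mul_of_integrable (h.integrable_sub hχ' hμ.1 hμ.2)]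
  congr 2
  ext1 x
  by_cases hx : x ∈ V
  · have h1 := h.mem_add hx hμ.1 hμ.2 (.inl rfl)
    have h2 := h.mem_add hx hμ.1 hμ.2 (.inr rfl)
    rw [mul_neg, ← sub_eq_add_neg] at h2
    rw [mul_smul_comm, smul_mul_assoc, mul_sub, sub_mul, resolventOp_commute hz h1,
      resolventOp_commute hz h2]
  · simp [hχ'.eq_zero hx]

/-- Allows `tendsto_integral_inv` to be used for scalar integrals $\int\chi(x)(x+\mu c-z)^{-1}dx$ as
well. -/
theorem hasPolyBoundaryGrowth_one {V : Set ℝ} {ν : ℝ} (h : HasResolventStrip H V ν) (c : ℂ) :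
    HasPolyBoundaryGrowth V ν c (fun _ _ => (1 : ℂ)) (fun _ _ => 0) where
  isOpen := h.isOpen
  pos := h.pos
  le_one := h.le_one
  hasDerivAt_left _ _ _ _ _ := hasDerivAt_const _ _
  hasDerivAt_right _ _ s _ _ := by simpa using hasDerivAt_const s (1 : ℂ)
  continuousOn := continuousOn_const
  growth := ⟨1, 0, by simp⟩

/-- By the resolvent identity $R(w)R(z)=(R(w)-R(z))/(w-z)$ with $w=x\pm i\mu$. In the limit the
denominator may be replaced by $x-z$, and the multiples of $R(z)$ coming from the two sides of the
axis coincide and cancel. -/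
theorem smoothCalc_mul_resolventOp (hχ : IsTestFunctionOn (polyGrowthSet H) χ) {z : ℂ}
    (hz : z ∈ resolventSetOp H) (hz' : z.im ≠ 0) :
    smoothCalc H χ * resolventOp H z = smoothCalc H fun x => χ x * ((x : ℂ) - z)⁻¹ := by
  obtain ⟨V, ν, h, hχ'⟩ := exists_strip_of_isTestFunctionOn hχ
  have hw := contDiff_inv_ofReal_sub hz'
  have key : ∀ c : ℂ, c = Complex.I ∨ c = -Complex.I → ∃ L,
      Tendsto (fun μ : ℝ => ∫ x : ℝ, (χ x * ((x : ℂ) - z)⁻¹) • resolventOp H ((x : ℂ) + μ * c))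
        (𝓝[>] 0) (𝓝 L) ∧
      Tendsto (fun μ : ℝ => (∫ x : ℝ, χ x • resolventOp H ((x : ℂ) + μ * c)) * resolventOp H z)
        (𝓝[>] 0) (𝓝 (L - (∫ x : ℝ, χ x * ((x : ℂ) - z)⁻¹) • resolventOp H z)) := by
    intro c hc
    obtain ⟨L, hL⟩ := (h.hasPolyBoundaryGrowth hc).exists_tendsto (hχ'.mul hw)
    refine ⟨L, hL, ?_⟩
    have h1 := (h.hasPolyBoundaryGrowth hc).tendsto_integral_inv hχ' (d := c) hz' hL
    have h2 := (hasPolyBoundaryGrowth_one h c).tendsto_integral_inv hχ' (d := c) hz'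
      tendsto_const_nhds
    simp only [smul_eq_mul, mul_one] at h2
    refine (h1.sub (h2.smul_const (resolventOp H z))).congr' ?_
    have hsm : ∀ᶠ μ in 𝓝[>] (0 : ℝ), 0 < μ ∧ μ < |z.im| := Ioo_mem_nhdsGT (abs_pos.2 hz')
    filter_upwards [h.eventually, hsm] with μ hμ hμ2
    have hne : ∀ x : ℝ, (x : ℂ) + μ * c - z ≠ 0 := by
      intro x hx
      have := congrArg Complex.im hx
      rcases hc with rfl | rfl
      · simp at this
        have : z.im = μ := by linarith
        rw [this, abs_of_pos hμ.1] at hμ2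
        exact lt_irrefl _ hμ2.2
      · simp at this
        have : z.im = -μ := by linarith
        rw [this, abs_neg, abs_of_pos hμ.1] at hμ2
        exact lt_irrefl _ hμ2.2
    have ht : ContDiff ℝ ∞ fun x : ℝ => ((x : ℂ) + μ * c - z)⁻¹ :=
      ((Complex.ofRealCLM.contDiff.add contDiff_const).sub contDiff_const).inv hne
    rw [← integral_mul_const_of_integrable (h.integrable hχ' hμ.1 hμ.2 hc),
      ← integral_smul_const (fun x : ℝ => χ x * ((x : ℂ) + μ * c - z)⁻¹) (resolventOp H z),
      ← integral_sub (h.integrable (hχ'.mul ht) hμ.1 hμ.2 hc) ((hχ'.mul ht).integrable.smul_const _)]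
    congr 1
    ext1 x
    by_cases hx : x ∈ V
    · rw [smul_mul_assoc, resolventOp_mul (h.mem_add hx hμ.1 hμ.2 hc) hz (hne x), ← smul_sub,
        smul_smul]
    · simp [hχ'.eq_zero hx]
  obtain ⟨L₁, h₁, h₁'⟩ := key _ (.inl rfl)
  obtain ⟨L₂, h₂, h₂'⟩ := key _ (.inr rfl)
  have e1 := (tendsto_smoothCalc hχ).mul_const (resolventOp H z)
  have e2 := tendsto_smoothCalc (hχ.mul hw)
  have e1' := (h₁'.sub h₂').const_smul (2 * (Real.pi : ℂ) * Complex.I)⁻¹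
  have e2' := (h₁.sub h₂).const_smul (2 * (Real.pi : ℂ) * Complex.I)⁻¹
  rw [sub_sub_sub_cancel_right] at e1'
  rw [tendsto_nhds_unique e1 (e1'.congr' ?_), tendsto_nhds_unique e2 (e2'.congr' ?_)]
  · filter_upwards [h.eventually] with μ hμ
    exact (h.smoothCalcApprox_eq (hχ'.mul hw) hμ.1 hμ.2).symm
  · filter_upwards [h.eventually] with μ hμ
    rw [h.smoothCalcApprox_eq hχ' hμ.1 hμ.2, ← sub_mul, smul_mul_assoc]

end SmoothCalculus

/-! ### Uniform convergence of Poisson integrals -/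

section Poisson

/-- The Poisson integral of `ψ`. -/
def poissonApprox (ψ : ℝ → ℂ) (μ x : ℝ) : ℂ :=
  (2 * (Real.pi : ℂ) * Complex.I)⁻¹ * ∫ y : ℝ, ψ y *
    (((x : ℂ) - (y + μ * Complex.I))⁻¹ - ((x : ℂ) - (y - μ * Complex.I))⁻¹)

/-- Substituting $y=x+\mu s$ removes $\mu$ from the kernel, which becomes $\pi^{-1}(1+s^2)^{-1}$ of
total mass one. -/
theorem poissonApprox_eq (ψ : ℝ → ℂ) {μ : ℝ} (hμ : 0 < μ) (x : ℝ) :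
    poissonApprox ψ μ x = (Real.pi : ℂ)⁻¹ * ∫ s : ℝ, ψ (x + μ * s) * (((1 + s ^ 2)⁻¹ : ℝ) : ℂ) := by
  set f : ℝ → ℂ := fun y => ψ y *
    (((x : ℂ) - (y + μ * Complex.I))⁻¹ - ((x : ℂ) - (y - μ * Complex.I))⁻¹) with hf
  have h1 : ∫ y, f y = μ * ∫ s, f (x + μ * s) := by
    rw [← integral_add_left_eq_self f x, Measure.integral_comp_mul_left (fun y => f (x + y)) μ,
      Complex.real_smul, abs_inv, abs_of_pos hμ, ← mul_assoc, ← Complex.ofReal_mul,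
      mul_inv_cancel₀ hμ.ne', Complex.ofReal_one, one_mul]
  have h2 : ∀ s, f (x + μ * s) =
      (2 * Complex.I / μ) * (ψ (x + μ * s) * (((1 + s ^ 2)⁻¹ : ℝ) : ℂ)) := by
    intro s
    have hμ' : (μ : ℂ) ≠ 0 := by exact_mod_cast hμ.ne'
    have e1 : (s : ℂ) + Complex.I ≠ 0 := fun h => by simpa using congrArg Complex.im h
    have e2 : (s : ℂ) - Complex.I ≠ 0 := fun h => by simpa using congrArg Complex.im h
    have e3 : (1 : ℂ) + (s : ℂ) ^ 2 = (s + Complex.I) * (s - Complex.I) := by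
      ring_nf
      rw [Complex.I_sq]
      ring
    have e4 : (x : ℂ) - (((x + μ * s : ℝ) : ℂ) + μ * Complex.I) = -(μ * (s + Complex.I)) := by
      push_cast; ring
    have e5 : (x : ℂ) - (((x + μ * s : ℝ) : ℂ) - μ * Complex.I) = -(μ * (s - Complex.I)) := by
      push_cast; ring
    simp only [hf]
    rw [e4, e5]
    push_cast
    rw [e3]
    field_simp
    ring
  rw [poissonApprox, h1]
  simp_rw [h2]
  rw [integral_const_mul, ← mul_assoc, ← mul_assoc]
  have hμ' : (μ : ℂ) ≠ 0 := by exact_mod_cast hμ.ne'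
  have hπ : (Real.pi : ℂ) ≠ 0 := by exact_mod_cast Real.pi_ne_zero
  congr 1
  have := Complex.I_ne_zero
  field_simp

theorem eventually_norm_poissonApprox_sub_le {V : Set ℝ} {ψ : ℝ → ℂ} (hψ : IsTestFunctionOn V ψ)
    {ε : ℝ} (hε : 0 < ε) :
    ∀ᶠ μ in 𝓝[>] (0 : ℝ), ∀ x, ‖poissonApprox ψ μ x - ψ x‖ ≤ ε := by
  obtain ⟨A, hA⟩ := hψ.1.lipschitzWith_of_hasCompactSupport hψ.2.1 (by simp)
  obtain ⟨M, hM⟩ := hψ.2.1.exists_bound_of_continuous hψ.continuous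
  have hM0 : 0 ≤ M := (norm_nonneg _).trans (hM 0)
  -- A majorant of the integrand that does not depend on $x$. The Lipschitz bound makes it vanish as
  -- $\mu\to0$; the bound $2M$ is needed for domination, since $|s|/(1+s^2)$ is not integrable.
  set b : ℝ → ℝ → ℝ := fun μ s => min (A * |μ * s|) (2 * M) * (1 + s ^ 2)⁻¹ with hb
  have hb2 : ∀ μ s, b μ s ≤ 2 * M * (1 + s ^ 2)⁻¹ := fun μ s =>
    mul_le_mul_of_nonneg_right (min_le_right _ _) (by positivity)
  have hb0 : ∀ μ s, 0 ≤ b μ s := fun μ s => by simp only [hb]; positivity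
  have hbm : ∀ μ, Continuous (b μ) := fun μ => by
    simp only [hb]
    exact (by fun_prop : Continuous fun s : ℝ => min (A * |μ * s|) (2 * M)).mul
      ((by fun_prop : Continuous fun s : ℝ => 1 + s ^ 2).inv₀ fun s => by positivity)
  have hdom : Integrable fun s : ℝ => 2 * M * (1 + s ^ 2)⁻¹ := integrable_inv_one_add_sq.const_mul _
  have hbi : ∀ μ, Integrable (b μ) := fun μ => hdom.mono' (hbm μ).aestronglyMeasurable
    (.of_forall fun s => by rw [Real.norm_of_nonneg (hb0 μ s)]; exact hb2 μ s)
  have hlim : Tendsto (fun μ => ∫ s, b μ s) (𝓝[>] 0) (𝓝 0) := by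
    have := tendsto_integral_filter_of_dominated_convergence (μ := volume) (F := b)
      (f := fun _ => (0 : ℝ)) (l := 𝓝[>] (0 : ℝ)) _ (.of_forall fun μ => (hbm μ).aestronglyMeasurable)
      (.of_forall fun μ => .of_forall fun s => by
        rw [Real.norm_of_nonneg (hb0 μ s)]; exact hb2 μ s) hdom (.of_forall fun s => ?_)
    · simpa using this
    · have hc : Continuous fun μ => b μ s := by simp only [hb]; fun_prop
      have := hc.tendsto 0
      have h0 : b 0 s = 0 := by simp [hb, hM0]
      rw [h0] at this
      exact this.mono_left nhdsWithin_le_nhds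
  filter_upwards [hlim.eventually_lt_const (by positivity : 0 < Real.pi * ε), self_mem_nhdsWithin]
    with μ hμε hμ x
  have hμ : 0 < μ := hμ
  have hπ : (Real.pi : ℂ) ≠ 0 := by exact_mod_cast Real.pi_ne_zero
  have e1 : ψ x = (Real.pi : ℂ)⁻¹ * ∫ s : ℝ, ψ x * (((1 + s ^ 2)⁻¹ : ℝ) : ℂ) := by
    rw [integral_const_mul, integral_complex_ofReal, integral_univ_inv_one_add_sq]
    field_simp
  have hwi : Integrable fun s : ℝ => (((1 + s ^ 2)⁻¹ : ℝ) : ℂ) := integrable_inv_one_add_sq.ofReal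
  have i1 : Integrable fun s : ℝ => ψ (x + μ * s) * (((1 + s ^ 2)⁻¹ : ℝ) : ℂ) :=
    hwi.bdd_mul (c := M) (hψ.continuous.comp (by fun_prop)).aestronglyMeasurable
      (.of_forall fun s => hM _)
  rw [poissonApprox_eq ψ hμ, e1, ← mul_sub, ← integral_sub i1 (hwi.const_mul _), norm_mul, norm_inv,
    Complex.norm_of_nonneg Real.pi_pos.le]
  have h3 : ‖∫ s : ℝ, ψ (x + μ * s) * (((1 + s ^ 2)⁻¹ : ℝ) : ℂ) -
      ψ x * (((1 + s ^ 2)⁻¹ : ℝ) : ℂ)‖ ≤ ∫ s, b μ s := by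
    refine norm_integral_le_of_norm_le (hbi μ) (.of_forall fun s => ?_)
    rw [← sub_mul, norm_mul, Complex.norm_of_nonneg (by positivity)]
    refine mul_le_mul_of_nonneg_right (le_min ?_ ?_) (by positivity)
    · have := hA.dist_le_mul (x + μ * s) x
      rwa [dist_eq_norm, dist_eq_norm, add_sub_cancel_left, Real.norm_eq_abs] at this
    · refine (norm_sub_le _ _).trans ?_
      linarith [hM (x + μ * s), hM x]
  rw [inv_mul_le_iff₀ Real.pi_pos]
  linarith

end Poisson

/-! ### Action of the smooth calculus on eigenvectors -/

section Eigenvectors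

variable {E : Type*} [NormedAddCommGroup E] [NormedSpace ℂ E] [CompleteSpace E] {H : E →ₗ.[ℂ] E}
  {χ ψ : ℝ → ℂ}

theorem resolventOp_apply_eigenvector {u : H.domain} {l w : ℂ} (hu : H u = l • (u : E))
    (hw : w ∈ resolventSetOp H) (hne : l - w ≠ 0) :
    resolventOp H w u = (l - w)⁻¹ • (u : E) := by
  have := resolventOp_apply_sub hw u
  rw [hu, ← sub_smul, map_smul] at this
  rw [← this, smul_smul, inv_mul_cancel₀ hne, one_smul, this]

/-- On an eigenvector $R(w)u=(\lambda-w)^{-1}u$, so the approximations of $\chi(H)u$ are the Poisson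
integrals of $\chi$ at $\lambda$ times $u$. -/
theorem smoothCalc_apply_eigenvector (hχ : IsTestFunctionOn (polyGrowthSet H) χ) {u : H.domain}
    {l : ℝ} (hu : H u = (l : ℂ) • (u : E)) : smoothCalc H χ u = χ l • (u : E) := by
  obtain ⟨V, ν, h, hχ'⟩ := exists_strip_of_isTestFunctionOn hχ
  have h1 : Tendsto (fun μ => smoothCalcApprox H χ μ u) (𝓝[>] 0) (𝓝 (smoothCalc H χ u)) :=
    ((ContinuousLinearMap.apply ℂ E (u : E)).continuous.tendsto _).comp (tendsto_smoothCalc hχ)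
  have h2 : Tendsto (fun μ => poissonApprox χ μ l) (𝓝[>] 0) (𝓝 (χ l)) := by
    rw [Metric.tendsto_nhds]
    intro ε hε
    filter_upwards [eventually_norm_poissonApprox_sub_le hχ (half_pos hε)] with μ hμ
    rw [dist_eq_norm]
    linarith [hμ l]
  refine tendsto_nhds_unique h1 ((h2.smul_const (u : E)).congr' ?_)
  filter_upwards [h.eventually] with μ hμ
  have hre : ∀ x : ℝ, (l : ℂ) - (x + μ * Complex.I) ≠ 0 := fun x hx => by
    have := congrArg Complex.im hx
    simp at this
    exact hμ.1.ne' this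
  have hre' : ∀ x : ℝ, (l : ℂ) - (x - μ * Complex.I) ≠ 0 := fun x hx => by
    have := congrArg Complex.im hx
    simp at this
    exact hμ.1.ne' this
  have e1 : ∀ x : ℝ, (χ x • (resolventOp H ((x : ℂ) + μ * Complex.I) -
      resolventOp H ((x : ℂ) - μ * Complex.I))) (u : E) = (χ x *
      (((l : ℂ) - (x + μ * Complex.I))⁻¹ - ((l : ℂ) - (x - μ * Complex.I))⁻¹)) • (u : E) := by
    intro x
    by_cases hx : x ∈ V
    · have m1 := h.mem_add hx hμ.1 hμ.2 (.inl rfl)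
      have m2 := h.mem_add hx hμ.1 hμ.2 (.inr rfl)
      rw [mul_neg, ← sub_eq_add_neg] at m2
      rw [smul_apply, sub_apply, resolventOp_apply_eigenvector hu m1 (hre x),
        resolventOp_apply_eigenvector hu m2 (hre' x), ← sub_smul, smul_smul]
    · simp [hχ'.eq_zero hx]
  rw [smoothCalcApprox, smul_apply, ContinuousLinearMap.integral_apply
    (h.integrable_sub hχ' hμ.1 hμ.2)]
  simp_rw [e1]
  rw [integral_smul_const (fun x : ℝ => χ x *
      (((l : ℂ) - (x + μ * Complex.I))⁻¹ - ((l : ℂ) - (x - μ * Complex.I))⁻¹)) (u : E), smul_smul]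
  rfl

end Eigenvectors

/-! ### Adjoints in the smooth calculus -/

section Adjoint

variable {E : Type*} [NormedAddCommGroup E] [NormedSpace ℂ E] [CompleteSpace E]
  {k : KreinStructure E} {H : E →ₗ.[ℂ] E} {χ : ℝ → ℂ}

theorem KreinStructure.IsSelfAdjointOp.form_apply (hH : k.IsSelfAdjointOp H) (u v : H.domain) :
    k.form (H u) (v : E) = k.form (u : E) (H v) :=
  (hH.2 u (H u)).2 ⟨u.2, rfl⟩ v

theorem KreinStructure.IsSelfAdjointOp.form_resolventOp (hH : k.IsSelfAdjointOp H) {z : ℂ}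
    (hz : z ∈ resolventSetOp H) (hz' : conj z ∈ resolventSetOp H) (u v : E) :
    k.form u (resolventOp H z v) = k.form (resolventOp H (conj z) u) v := by
  have h := hH.form_apply ⟨_, resolventOp_mem hz' u⟩ ⟨_, resolventOp_mem hz v⟩
  rw [apply_resolventOp hz, apply_resolventOp hz'] at h
  simpa using h

/-- Taking adjoints swaps $R(x+i\mu)$ and $R(x-i\mu)$; the resulting sign is cancelled by the one
from conjugating $(2\pi i)^{-1}$. -/
theorem KreinStructure.IsSelfAdjointOp.form_smoothCalc (hH : k.IsSelfAdjointOp H)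
    (hχ : IsTestFunctionOn (polyGrowthSet H) χ) (u v : E) :
    k.form u (smoothCalc H χ v) = k.form (smoothCalc H (fun x => conj (χ x)) u) v := by
  obtain ⟨V, ν, h, hχ'⟩ := exists_strip_of_isTestFunctionOn hχ
  have h1 : ∀ {χ : ℝ → ℂ} (_ : IsTestFunctionOn (polyGrowthSet H) χ) (u v : E),
      Tendsto (fun μ => k.form u (smoothCalcApprox H χ μ v)) (𝓝[>] 0)
      (𝓝 (k.form u (smoothCalc H χ v))) := fun hχ u v =>
    (((k.form u).continuous.comp (ContinuousLinearMap.apply ℂ E v).continuous).tendsto _).comp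
      (tendsto_smoothCalc hχ)
  rw [k.hermitian (smoothCalc H (fun x => conj (χ x)) u) v]
  refine tendsto_nhds_unique (h1 hχ u v)
    (((Complex.continuous_conj.tendsto _).comp (h1 hχ.conj v u)).congr' ?_)
  filter_upwards [h.eventually] with μ hμ
  have e1 : ∀ {χ : ℝ → ℂ} (_ : IsTestFunctionOn V χ) (u v : E),
      k.form u (smoothCalcApprox H χ μ v) = (2 * (Real.pi : ℂ) * Complex.I)⁻¹ *
        ∫ x : ℝ, χ x * (k.form u (resolventOp H ((x : ℂ) + μ * Complex.I) v) -
          k.form u (resolventOp H ((x : ℂ) - μ * Complex.I) v)) := by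
    intro χ hχ u v
    rw [smoothCalcApprox, smul_apply, ContinuousLinearMap.integral_apply
      (h.integrable_sub hχ hμ.1 hμ.2), map_smul, smul_eq_mul,
      ← ContinuousLinearMap.integral_comp_comm (k.form u)
        ((h.integrable_sub hχ hμ.1 hμ.2).apply_continuousLinearMap v)]
    congr 2
    ext1 x
    rw [smul_apply, sub_apply, map_smul, map_sub, smul_eq_mul]
  simp only [Function.comp_apply]
  rw [e1 hχ', e1 hχ'.conj, map_mul, ← integral_conj]
  have e2 : conj ((2 * (Real.pi : ℂ) * Complex.I)⁻¹) = -(2 * (Real.pi : ℂ) * Complex.I)⁻¹ := by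
    have : conj (2 : ℂ) = 2 := map_ofNat _ 2
    rw [map_inv₀]
    simp [this]
  rw [e2, neg_mul, ← mul_neg, ← integral_neg]
  congr 2
  ext1 x
  by_cases hx : x ∈ V
  · have m1 := h.mem_add hx hμ.1 hμ.2 (.inl rfl)
    have m2 := h.mem_add hx hμ.1 hμ.2 (.inr rfl)
    rw [mul_neg, ← sub_eq_add_neg] at m2
    have c1 : conj ((x : ℂ) + μ * Complex.I) = (x : ℂ) - μ * Complex.I := by
      simp [sub_eq_add_neg]
    have c2 : conj ((x : ℂ) - μ * Complex.I) = (x : ℂ) + μ * Complex.I := by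
      simp
    rw [map_mul, map_sub, ← k.hermitian, ← k.hermitian, Complex.conj_conj,
      hH.form_resolventOp m1 (by rwa [c1]), hH.form_resolventOp m2 (by rwa [c2]), c1, c2]
    ring
  · simp [hχ'.eq_zero hx]

end Adjoint

/-! ### Extension to the uniform closure and multiplicativity -/

section ClosureOfTestFunctions

open BoundedContinuousFunction

/-- The test functions on `I`, as a subspace of the bounded continuous functions. -/
def testSubmodule (I : Set ℝ) : Submodule ℂ (ℝ →ᵇ ℂ) where
  carrier := {f | IsTestFunctionOn I f}
  zero_mem' := IsTestFunctionOn.zero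
  add_mem' h h' := h.add h'
  smul_mem' c _ h := h.smul c

/-- The uniform closure of the test functions on `I`. -/
abbrev testClosure (I : Set ℝ) : Submodule ℂ (ℝ →ᵇ ℂ) := (testSubmodule I).topologicalClosure

variable {I : Set ℝ} {χ ψ : ℝ → ℂ}

theorem IsTestFunctionOn.exists_bound (h : IsTestFunctionOn I χ) : ∃ M, ∀ x, ‖χ x‖ ≤ M :=
  h.2.1.exists_bound_of_continuous h.continuous

/-- A test function as an element of `testClosure I`. -/
def IsTestFunctionOn.toClosure (h : IsTestFunctionOn I χ) : testClosure I :=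
  ⟨BoundedContinuousFunction.ofNormedAddCommGroup χ h.continuous _ h.exists_bound.choose_spec,
    Submodule.le_topologicalClosure _ (show IsTestFunctionOn I χ from h)⟩

@[simp]
theorem IsTestFunctionOn.toClosure_apply (h : IsTestFunctionOn I χ) (x : ℝ) :
    (h.toClosure : ℝ →ᵇ ℂ) x = χ x := rfl

/-- By Weierstrass, $h$ is uniformly close to a polynomial on an interval containing the support of
a test function, and polynomial multiples of test functions are test functions. This ideal property
is what permits splitting functions in the total variation argument. -/
theorem mul_mem_testClosure {g : ℝ →ᵇ ℂ} (hg : g ∈ testClosure I) (h : ℝ →ᵇ ℂ) :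
    g * h ∈ testClosure I := by
  have hmaps : Set.MapsTo (fun g : ℝ →ᵇ ℂ => g * h) (testSubmodule I)
      (closure (testSubmodule I : Set (ℝ →ᵇ ℂ))) := by
    intro χ hχ
    have hχ : IsTestFunctionOn I χ := hχ
    refine Metric.mem_closure_iff.2 fun ε hε => ?_
    obtain ⟨M, hM⟩ := hχ.exists_bound
    obtain ⟨r, hr⟩ := hχ.2.1.isBounded.subset_closedBall 0
    have hr' : ∀ x, χ x ≠ 0 → x ∈ Set.Icc (-r) r := fun x hx => by
      have := hr (subset_tsupport χ hx)
      simpa [Real.closedBall_eq_Icc] using this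
    have hM0 : 0 ≤ M := (norm_nonneg _).trans (hM 0)
    set δ := ε / (4 * (M + 1)) with hδ
    have hδ0 : 0 < δ := by positivity
    obtain ⟨p, hp⟩ := exists_polynomial_near_of_continuousOn (-r) r (fun x => (h x).re)
      (by fun_prop) δ hδ0
    obtain ⟨q, hq⟩ := exists_polynomial_near_of_continuousOn (-r) r (fun x => (h x).im)
      (by fun_prop) δ hδ0
    have hm : ContDiff ℝ ∞ fun x : ℝ => ((p.eval x : ℝ) : ℂ) + ((q.eval x : ℝ) : ℂ) * Complex.I :=
      (Complex.ofRealCLM.contDiff.comp (by simpa using p.contDiff_aeval (𝕜 := ℝ) ∞)).add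
        ((Complex.ofRealCLM.contDiff.comp (by simpa using q.contDiff_aeval (𝕜 := ℝ) ∞)).mul
          contDiff_const)
    refine ⟨((hχ.mul hm).toClosure : ℝ →ᵇ ℂ), hχ.mul hm, ?_⟩
    refine lt_of_le_of_lt ((BoundedContinuousFunction.dist_le (half_pos hε).le).2 fun x => ?_)
      (half_lt_self hε)
    rw [IsTestFunctionOn.toClosure_apply, BoundedContinuousFunction.mul_apply, dist_eq_norm,
      ← mul_sub, norm_mul]
    by_cases hx : χ x = 0
    · simpa [hx] using (half_pos hε).le
    · have h1 := hp x (hr' x hx)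
      have h2 := hq x (hr' x hx)
      have h3 : ‖h x - (((p.eval x : ℝ) : ℂ) + ((q.eval x : ℝ) : ℂ) * Complex.I)‖ ≤ δ + δ := by
        refine (Complex.norm_le_abs_re_add_abs_im _).trans (add_le_add ?_ ?_)
        · simpa [abs_sub_comm] using h1.le
        · simpa [abs_sub_comm] using h2.le
      calc _ ≤ M * (δ + δ) := mul_le_mul (hM x) h3 (norm_nonneg _) hM0
        _ ≤ (M + 1) * (δ + δ) := by nlinarith
        _ = ε / 2 := by rw [hδ]; field_simp; ring
  have := hmaps.closure (continuous_mul_const h)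
  rw [closure_closure] at this
  exact this hg

variable {E : Type*} [NormedAddCommGroup E] [NormedSpace ℂ E] [CompleteSpace E] {H : E →ₗ.[ℂ] E}

theorem HasC0Calculus.isTest (h : HasC0Calculus H I) (hχ : IsTestFunctionOn I χ) :
    IsTestFunctionOn (polyGrowthSet H) χ := hχ.mono (hχ.2.2.trans h.1)

/-- The $C^0$ bound is continuity on a dense subspace. The complete domain makes it possible to
interchange the calculus with integrals and uniform limits of functions. -/
theorem HasC0Calculus.exists_extension (h : HasC0Calculus H I) :
    ∃ T : testClosure I →L[ℂ] (E →L[ℂ] E), ∀ (χ : ℝ → ℂ) (hχ : IsTestFunctionOn I χ),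
      T hχ.toClosure = smoothCalc H χ := by
  obtain ⟨C, hC⟩ := h.2
  let f : testSubmodule I →ₗ[ℂ] (E →L[ℂ] E) :=
    { toFun := fun g => smoothCalc H g.1
      map_add' := fun g g' => smoothCalc_add (h.isTest g.2) (h.isTest g'.2)
      map_smul' := fun c g => smoothCalc_smul (h.isTest g.2) c }
  let e : testSubmodule I →ₗ[ℂ] testClosure I :=
    Submodule.inclusion (Submodule.le_topologicalClosure _)
  have hd : DenseRange e := by
    intro g
    rw [closure_subtype]
    refine closure_mono ?_ g.2
    intro χ hχ
    exact ⟨e ⟨χ, hχ⟩, ⟨_, rfl⟩, rfl⟩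
  refine ⟨f.extendOfNorm e, fun χ hχ => ?_⟩
  exact LinearMap.extendOfNorm_eq (f := f) (e := e) hd
    ⟨C, fun g => hC _ g.2 _ fun x => BoundedContinuousFunction.norm_coe_le_norm g.1 x⟩
    ⟨hχ.toClosure.1, hχ⟩

theorem inv_sub_inv_norm_le {x : ℂ} {w w' : ℂ} {μ : ℝ} (hμ : 0 < μ) (h : μ ≤ ‖x - w‖)
    (h' : μ ≤ ‖x - w'‖) : ‖(x - w)⁻¹ - (x - w')⁻¹‖ ≤ ‖w - w'‖ * (μ⁻¹ * μ⁻¹) := by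
  have n1 : x - w ≠ 0 := norm_pos_iff.1 (hμ.trans_le h)
  have n2 : x - w' ≠ 0 := norm_pos_iff.1 (hμ.trans_le h')
  rw [inv_sub_inv n1 n2, sub_sub_sub_cancel_left, norm_div, norm_mul, div_eq_mul_inv, mul_inv]
  gcongr

/-- Multiplying the approximations of $\psi(H)$ by $\chi(H)$ under the integral gives the operator
of $\chi$ times the Poisson integral of $\psi$. This product converges uniformly to $\chi\psi$, and
the extended calculus is continuous. -/
theorem HasC0Calculus.smoothCalc_mul (h : HasC0Calculus H I) (hχ : IsTestFunctionOn I χ)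
    (hψ : IsTestFunctionOn I ψ) :
    smoothCalc H χ * smoothCalc H ψ = smoothCalc H fun x => χ x * ψ x := by
  obtain ⟨T, hT⟩ := h.exists_extension
  obtain ⟨M, hM⟩ := hχ.exists_bound
  have hM0 : 0 ≤ M := (norm_nonneg _).trans (hM 0)
  obtain ⟨V, ν, hV, hψ'⟩ := exists_strip_of_isTestFunctionOn (h.isTest hψ)
  -- the functions `χ / (· - w)`
  have hw : ∀ w : ℂ, w.im ≠ 0 → IsTestFunctionOn I fun x => χ x * ((x : ℂ) - w)⁻¹ :=
    fun w hw => hχ.mul (contDiff_inv_ofReal_sub hw)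
  have key : ∀ μ, 0 < μ → μ < ν → ∃ Q : testClosure I,
      (∀ x, (Q : ℝ →ᵇ ℂ) x = χ x * poissonApprox ψ μ x) ∧
      smoothCalc H χ * smoothCalcApprox H ψ μ = T Q := by
    intro μ hμ hμ'
    have him : ∀ y : ℝ, ((y : ℂ) + μ * Complex.I).im ≠ 0 := fun y => by simpa using hμ.ne'
    have him' : ∀ y : ℝ, ((y : ℂ) - μ * Complex.I).im ≠ 0 := fun y => by simpa using hμ.ne'
    -- The function $\chi$ times the kernel with pole at $y\pm i\mu$, viewed as a curve in the
    -- closure; its Bochner integral against $\psi$ is $\chi$ times the Poisson integral, up to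
    -- $2\pi i$.
    set q : ℝ → testClosure I := fun y =>
      (hw _ (him y)).toClosure - (hw _ (him' y)).toClosure with hq
    have hqc : Continuous q := by
      have hcont : ∀ (c : ℂ) (hc : ∀ y : ℝ, ((y : ℂ) + c).im ≠ 0), |c.im| = μ →
          Continuous fun y : ℝ => (hw _ (hc y)).toClosure := by
        intro c hc hcμ
        have hK : 0 ≤ M * (μ⁻¹ * μ⁻¹) := by positivity
        refine (LipschitzWith.of_dist_le_mul (K := (M * (μ⁻¹ * μ⁻¹)).toNNReal)
          fun y y' => ?_).continuous
        rw [Subtype.dist_eq, Real.coe_toNNReal _ hK]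
        refine (BoundedContinuousFunction.dist_le (by positivity)).2 fun x => ?_
        simp only [IsTestFunctionOn.toClosure_apply]
        have hb : ∀ y : ℝ, μ ≤ ‖(x : ℂ) - (y + c)‖ := fun y => by
          rw [← hcμ]
          simpa using Complex.abs_im_le_norm ((x : ℂ) - (y + c))
        rw [dist_eq_norm, ← mul_sub, norm_mul, mul_assoc, mul_comm (μ⁻¹ * μ⁻¹)]
        refine mul_le_mul (hM x) ((inv_sub_inv_norm_le hμ (hb y) (hb y')).trans_eq ?_)
          (norm_nonneg _) hM0
        rw [add_sub_add_right_eq_sub, ← Complex.ofReal_sub, Complex.norm_real, ← dist_eq_norm]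
      refine (hcont (μ * Complex.I) him (by simp [abs_of_pos hμ])).sub ?_
      have := hcont (-(μ * Complex.I)) (fun y => by simpa using hμ.ne') (by simp [abs_of_pos hμ])
      simpa only [← sub_eq_add_neg] using this
    have hqi : Integrable fun y => ψ y • q y :=
      (hψ.continuous.smul hqc).integrable_of_hasCompactSupport hψ.2.1.smul_right
    have : CompleteSpace (testClosure I) := (testSubmodule I).isClosed_topologicalClosure.completeSpace_coe
    refine ⟨(2 * (Real.pi : ℂ) * Complex.I)⁻¹ • ∫ y, ψ y • q y, fun x => ?_, ?_⟩
    · set ev : testClosure I →L[ℂ] ℂ :=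
        (BoundedContinuousFunction.evalCLM ℂ x).comp (testClosure I).subtypeL with hev
      have e1 : ev (∫ y, ψ y • q y) = ∫ y, ev (ψ y • q y) :=
        (ev.integral_comp_comm hqi).symm
      change ev ((2 * (Real.pi : ℂ) * Complex.I)⁻¹ • ∫ y, ψ y • q y) = _
      rw [map_smul, e1, poissonApprox, smul_eq_mul, mul_left_comm,
        ← integral_const_mul (χ x)]
      congr 1
      refine integral_congr_ae (.of_forall fun y => ?_)
      change ψ y * (χ x * _ - χ x * _) = _
      ring
    · rw [map_smul, ← ContinuousLinearMap.integral_comp_comm T hqi, smoothCalcApprox, mul_smul_comm,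
        ← integral_const_mul_of_integrable (hV.integrable_sub hψ' hμ hμ')]
      congr 2
      ext1 y
      by_cases hy : y ∈ V
      · have m1 := hV.mem_add hy hμ hμ' (.inl rfl)
        have m2 := hV.mem_add hy hμ hμ' (.inr rfl)
        rw [mul_neg, ← sub_eq_add_neg] at m2
        rw [mul_smul_comm, mul_sub, smoothCalc_mul_resolventOp (h.isTest hχ) m1 (him y),
          smoothCalc_mul_resolventOp (h.isTest hχ) m2 (him' y), map_smul, hq, map_sub, hT, hT]
      · simp [hψ'.eq_zero hy]
  choose! Q hQ hQ' using key
  have hlim : Tendsto Q (𝓝[>] 0) (𝓝 (hχ.mul hψ.1).toClosure) := by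
    rw [Metric.tendsto_nhds]
    intro ε hε
    have hε' : 0 < ε / (2 * (M + 1)) := by positivity
    filter_upwards [eventually_norm_poissonApprox_sub_le hψ hε', hV.eventually] with μ hμ hμ'
    rw [Subtype.dist_eq]
    refine lt_of_le_of_lt ((BoundedContinuousFunction.dist_le (half_pos hε).le).2 fun x => ?_)
      (half_lt_self hε)
    rw [hQ μ hμ'.1 hμ'.2, IsTestFunctionOn.toClosure_apply, dist_eq_norm, ← mul_sub, norm_mul]
    calc _ ≤ M * (ε / (2 * (M + 1))) := mul_le_mul (hM x) (hμ x) (norm_nonneg _) hM0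
      _ ≤ (M + 1) * (ε / (2 * (M + 1))) := by nlinarith
      _ = ε / 2 := by field_simp
  rw [← hT _ (hχ.mul hψ.1)]
  refine tendsto_nhds_unique ((tendsto_smoothCalc (h.isTest hψ)).const_mul (smoothCalc H χ))
    (((T.continuous.tendsto _).comp hlim).congr' ?_)
  filter_upwards [hV.eventually] with μ hμ
  exact (hQ' μ hμ.1 hμ.2).symm

end ClosureOfTestFunctions

/-! ### Functionals continuous under bounded pointwise convergence -/

section BorelFunctionals

variable {I : Set ℝ}

theorem IsBoundedBorel.add {φ ψ : I → ℂ} (hφ : IsBoundedBorel φ) (hψ : IsBoundedBorel ψ) :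
    IsBoundedBorel (φ + ψ) := by
  obtain ⟨M, hM⟩ := hφ.2
  obtain ⟨N, hN⟩ := hψ.2
  exact ⟨hφ.1.add hψ.1, M + N, fun x => (norm_add_le _ _).trans (add_le_add (hM x) (hN x))⟩

theorem IsBoundedBorel.mul {φ ψ : I → ℂ} (hφ : IsBoundedBorel φ) (hψ : IsBoundedBorel ψ) :
    IsBoundedBorel (φ * ψ) := by
  obtain ⟨M, hM⟩ := hφ.2
  obtain ⟨N, hN⟩ := hψ.2
  exact ⟨hφ.1.mul hψ.1, M * N, fun x => by
    rw [Pi.mul_apply, norm_mul]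
    exact mul_le_mul (hM x) (hN x) (norm_nonneg _) ((norm_nonneg _).trans (hM x))⟩

theorem IsBoundedBorel.smul {φ : I → ℂ} (hφ : IsBoundedBorel φ) (c : ℂ) :
    IsBoundedBorel (c • φ) := by
  obtain ⟨M, hM⟩ := hφ.2
  exact ⟨hφ.1.const_smul c, ‖c‖ * M, fun x => by
    rw [Pi.smul_apply, norm_smul]
    exact mul_le_mul_of_nonneg_left (hM x) (norm_nonneg _)⟩

theorem IsBoundedBorel.conj {φ : I → ℂ} (hφ : IsBoundedBorel φ) :
    IsBoundedBorel (fun x => conj (φ x)) := by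
  obtain ⟨M, hM⟩ := hφ.2
  exact ⟨Complex.continuous_conj.measurable.comp hφ.1, M, fun x => by simpa using hM x⟩

theorem isBoundedBorel_indicator {S : Set I} (hS : MeasurableSet S) (c : ℂ) :
    IsBoundedBorel (S.indicator fun _ => c) :=
  ⟨measurable_const.indicator hS, ‖c‖, fun x => by
    by_cases hx : x ∈ S <;> simp [hx]⟩

theorem IsTestFunctionOn.isBoundedBorel {χ : ℝ → ℂ} (hχ : IsTestFunctionOn I χ) :
    IsBoundedBorel (fun x : I => χ x) := by
  obtain ⟨M, hM⟩ := hχ.exists_bound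
  exact ⟨hχ.continuous.measurable.comp measurable_subtype_coe, M, fun x => hM x⟩

/-- Linear functionals on the bounded Borel functions that are continuous with respect to bounded
pointwise convergence of sequences. -/
structure IsBorelFunctional (c : (I → ℂ) → ℂ) : Prop where
  map_add : ∀ φ ψ, IsBoundedBorel φ → IsBoundedBorel ψ → c (φ + ψ) = c φ + c ψ
  map_smul : ∀ (a : ℂ) φ, IsBoundedBorel φ → c (a • φ) = a * c φ
  tendsto : ∀ (φ : ℕ → I → ℂ) (ψ : I → ℂ) (M : ℝ), (∀ n, Measurable (φ n)) →
    (∀ n x, ‖φ n x‖ ≤ M) → (∀ x, Tendsto (fun n => φ n x) atTop (𝓝 (ψ x))) →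
    Tendsto (fun n => c (φ n)) atTop (𝓝 (c ψ))

theorem IsBorelFunctional.add {c c' : (I → ℂ) → ℂ} (h : IsBorelFunctional c)
    (h' : IsBorelFunctional c') : IsBorelFunctional fun φ => c φ + c' φ where
  map_add φ ψ hφ hψ := by rw [h.map_add φ ψ hφ hψ, h'.map_add φ ψ hφ hψ]; ring
  map_smul a φ hφ := by rw [h.map_smul a φ hφ, h'.map_smul a φ hφ]; ring
  tendsto φ ψ M h1 h2 h3 := (h.tendsto φ ψ M h1 h2 h3).add (h'.tendsto φ ψ M h1 h2 h3)

theorem IsBorelFunctional.const_mul {c : (I → ℂ) → ℂ} (h : IsBorelFunctional c) (b : ℂ) :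
    IsBorelFunctional fun φ => b * c φ where
  map_add φ ψ hφ hψ := by rw [h.map_add φ ψ hφ hψ]; ring
  map_smul a φ hφ := by rw [h.map_smul a φ hφ]; ring
  tendsto φ ψ M h1 h2 h3 := (h.tendsto φ ψ M h1 h2 h3).const_mul b

theorem IsBorelFunctional.conj {c : (I → ℂ) → ℂ} (h : IsBorelFunctional c) :
    IsBorelFunctional fun φ => conj (c fun x => conj (φ x)) where
  map_add φ ψ hφ hψ := by
    rw [← _root_.map_add, ← h.map_add _ _ hφ.conj hψ.conj]
    congr 2
    ext x
    simp
  map_smul a φ hφ := by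
    have := h.map_smul (starRingEnd ℂ a) _ hφ.conj
    rw [← Complex.conj_conj a, ← _root_.map_mul, Complex.conj_conj, ← this]
    congr 2
    ext x
    simp
  tendsto φ ψ M h1 h2 h3 := (Complex.continuous_conj.tendsto _).comp
    (h.tendsto _ _ M (fun n => Complex.continuous_conj.measurable.comp (h1 n))
      (fun n x => by simpa using h2 n x) fun x => (Complex.continuous_conj.tendsto _).comp (h3 x))

theorem IsBorelFunctional.mul_left {c : (I → ℂ) → ℂ} (h : IsBorelFunctional c) {η : I → ℂ}
    (hη : IsBoundedBorel η) : IsBorelFunctional fun φ => c (η * φ) where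
  map_add φ ψ hφ hψ := by rw [mul_add, h.map_add _ _ (hη.mul hφ) (hη.mul hψ)]
  map_smul a φ hφ := by rw [mul_smul_comm, h.map_smul _ _ (hη.mul hφ)]
  tendsto φ ψ M h1 h2 h3 := by
    obtain ⟨N, hN⟩ := hη.2
    refine h.tendsto _ _ (N * M) (fun n => hη.1.mul (h1 n)) (fun n x => ?_)
      fun x => (h3 x).const_mul (η x)
    rw [Pi.mul_apply, norm_mul]
    exact mul_le_mul (hN x) (h2 n x) (norm_nonneg _) ((norm_nonneg _).trans (hN x))

/-- The indicator function of an open subset of `I` is a bounded pointwise limit of test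
functions. -/
theorem exists_tendsto_indicator {G : Set ℝ} (hG : IsOpen G) (hGI : G ⊆ I) :
    ∃ χ : ℕ → ℝ → ℂ, (∀ n, IsTestFunctionOn I (χ n)) ∧ (∀ n x, ‖χ n x‖ ≤ 1) ∧
      ∀ x, Tendsto (fun n => χ n x) atTop (𝓝 (G.indicator (fun _ => (1 : ℂ)) x)) := by
  obtain ⟨f, hfG, hf, hf01⟩ := hG.exists_contDiff_support_eq (n := ⊤)
  have hf0 : ∀ x, 0 ≤ f x := fun x => (hf01 ⟨x, rfl⟩).1
  let ρ : ℕ → ContDiffBump (0 : ℝ) := fun n => ⟨n + 1, n + 2, by positivity, by linarith⟩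
  -- The first factor vanishes where $nf\le1$, so the closed support lies in $\{nf\ge1\}\subset G$;
  -- the bump makes it compact. At a point of $G$ both factors are eventually $1$.
  let r : ℕ → ℝ → ℝ := fun n x => Real.smoothTransition (n * f x - 1) * ρ n x
  have hr0 : ∀ n x, 0 ≤ r n x := fun n x =>
    mul_nonneg (Real.smoothTransition.nonneg _) (ρ n).nonneg
  have hr1 : ∀ n x, r n x ≤ 1 := fun n x =>
    mul_le_one₀ (Real.smoothTransition.le_one _) (ρ n).nonneg (ρ n).le_one
  refine ⟨fun n x => r n x, fun n => ⟨?_, ?_, ?_⟩, fun n x => ?_, fun x => ?_⟩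
  · refine Complex.ofRealCLM.contDiff.comp (ContDiff.mul ?_ (ρ n).contDiff)
    exact Real.smoothTransition.contDiff.comp ((contDiff_const.mul hf).sub contDiff_const)
  · have : HasCompactSupport (r n) := (ρ n).hasCompactSupport.mul_left
    exact this.comp_left (g := Complex.ofReal) Complex.ofReal_zero
  · have hcl : IsClosed {x | 1 ≤ n * f x} := isClosed_le continuous_const
      (continuous_const.mul hf.continuous)
    refine (closure_minimal (fun x hx => ?_) hcl).trans fun x (hx : 1 ≤ n * f x) => hGI ?_
    · by_contra hlt
      have hlt : n * f x < 1 := not_le.1 hlt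
      exact hx (by simp [r, Real.smoothTransition.zero_of_nonpos (x := n * f x - 1) (by linarith)])
    · rw [← hfG, Function.mem_support]
      rintro h0
      rw [h0, mul_zero] at hx
      linarith
  · rw [Complex.norm_of_nonneg (hr0 n x)]
    exact hr1 n x
  · by_cases hx : x ∈ G
    · rw [Set.indicator_of_mem hx]
      have hfx : 0 < f x := (hf0 x).lt_of_ne' (by rw [← hfG] at hx; exact hx)
      refine tendsto_const_nhds.congr' ?_
      obtain ⟨N, hN⟩ := exists_nat_gt (2 / f x)
      obtain ⟨N', hN'⟩ := exists_nat_gt |x|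
      filter_upwards [eventually_ge_atTop N, eventually_ge_atTop N'] with n hn hn'
      have hn : (N : ℝ) ≤ n := by exact_mod_cast hn
      have hn' : (N' : ℝ) ≤ n := by exact_mod_cast hn'
      have h1 : 2 ≤ n * f x := by
        have := (div_lt_iff₀ hfx).1 hN
        nlinarith
      have h2 : ρ n x = 1 := (ρ n).one_of_mem_closedBall (by
        rw [mem_closedBall_zero_iff, Real.norm_eq_abs]
        change |x| ≤ n + 1
        linarith)
      simp [r, h2, Real.smoothTransition.one_of_one_le (x := n * f x - 1) (by linarith)]
    · rw [Set.indicator_of_notMem hx]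
      refine tendsto_const_nhds.congr fun n => ?_
      have hfx : f x = 0 := by rw [← hfG] at hx; simpa using hx
      simp [r, hfx, Real.smoothTransition.zero_of_nonpos]

/-- A Dynkin argument: open sets form a $\pi$-system on which the value is a limit of values on test
functions, while complements and disjoint unions follow from linearity and bounded convergence. -/
theorem IsBorelFunctional.indicator_eq_zero {c : (I → ℂ) → ℂ} (h : IsBorelFunctional c)
    (hI : IsOpen I) (hc : ∀ χ : ℝ → ℂ, IsTestFunctionOn I χ → c (fun x => χ x) = 0) (S : Set I)
    (hS : MeasurableSet S) : c (S.indicator fun _ => 1) = 0 := by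
  have hopen : ∀ U : Set I, IsOpen U → c (U.indicator fun _ => 1) = 0 := by
    intro U hU
    obtain ⟨χ, hχ, hχ1, hlim⟩ := exists_tendsto_indicator (hI.isOpenMap_subtype_val U hU)
      (Subtype.coe_image_subset I U)
    refine tendsto_nhds_unique (h.tendsto (fun n x => χ n x) _ 1 (fun n => (hχ n).isBoundedBorel.1)
      (fun n x => hχ1 n x) fun x => ?_) (by simp [hc _ (hχ _)])
    convert hlim x using 2
    by_cases hx : x ∈ U <;> simp [hx]
  have h0 : c 0 = 0 := by simpa using h.map_smul 0 0 ⟨measurable_const, 0, by simp⟩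
  refine MeasurableSpace.induction_on_inter (C := fun S _ => c (S.indicator fun _ => 1) = 0)
    (s := {s : Set I | IsOpen s}) (BorelSpace.measurable_eq (α := I)) isPiSystem_isOpen ?_ ?_ ?_ ?_ S hS
  · have e : ((∅ : Set I).indicator fun _ => (1 : ℂ)) = 0 := by ext; simp
    rw [e, h0]
  · exact hopen
  · intro t ht hct
    have e : (tᶜ.indicator fun _ => (1 : ℂ)) =
        (Set.univ : Set I).indicator (fun _ => 1) + (-1 : ℂ) • t.indicator fun _ => 1 := by
      ext x
      by_cases hx : x ∈ t <;> simp [hx]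
    rw [e, h.map_add _ _ (isBoundedBorel_indicator .univ 1) ((isBoundedBorel_indicator ht 1).smul _),
      h.map_smul _ _ (isBoundedBorel_indicator ht 1), hct, hopen _ isOpen_univ]
    simp
  · intro f hd hf hcf
    have hsum : ∀ n : ℕ, c (∑ i ∈ Finset.range n, (f i).indicator fun _ => 1) = 0 ∧
        IsBoundedBorel (∑ i ∈ Finset.range n, (f i).indicator fun _ => (1 : ℂ)) := by
      intro n
      induction n with
      | zero => exact ⟨by simpa using h0, by simpa using ⟨measurable_const, 0, by simp⟩⟩
      | succ n ih =>
        rw [Finset.sum_range_succ]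
        refine ⟨?_, ih.2.add (isBoundedBorel_indicator (hf n) 1)⟩
        rw [h.map_add _ _ ih.2 (isBoundedBorel_indicator (hf n) 1), ih.1, hcf n, add_zero]
    have e : ∀ n, (∑ i ∈ Finset.range n, (f i).indicator fun _ => (1 : ℂ)) =
        (⋃ i ∈ Finset.range n, f i).indicator fun _ => 1 := by
      intro n
      rw [Finset.indicator_biUnion _ _ fun i _ j _ hij => hd hij]
      ext x
      simp
    refine tendsto_nhds_unique (h.tendsto (fun n => (⋃ i ∈ Finset.range n, f i).indicator fun _ => 1)
      _ 1 (fun n => ?_) (fun n x => ?_) fun x => ?_) ?_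
    · rw [← e]; exact (hsum n).2.1
    · by_cases hx : x ∈ ⋃ i ∈ Finset.range n, f i <;> simp only [hx, Set.indicator_of_mem,
        Set.indicator_of_notMem, not_false_eq_true, norm_one, norm_zero, le_refl, zero_le_one]
    · by_cases hx : x ∈ ⋃ i, f i
      · rw [Set.indicator_of_mem hx]
        obtain ⟨i, hi⟩ := Set.mem_iUnion.1 hx
        refine tendsto_const_nhds.congr' ?_
        filter_upwards [eventually_gt_atTop i] with n hn
        rw [Set.indicator_of_mem]
        exact Set.mem_biUnion (Finset.mem_coe.2 (Finset.mem_range.2 hn)) hi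
      · rw [Set.indicator_of_notMem hx]
        refine tendsto_const_nhds.congr fun n => ?_
        rw [Set.indicator_of_notMem]
        exact fun hx' => hx (Set.iUnion₂_subset_iUnion _ _ hx')
    · refine tendsto_const_nhds.congr fun n => ?_
      rw [← e, (hsum n).1]

/-- A Borel functional is determined by its values on test functions. -/
theorem IsBorelFunctional.eq_zero {c : (I → ℂ) → ℂ} (h : IsBorelFunctional c)
    (hI : IsOpen I) (hc : ∀ χ : ℝ → ℂ, IsTestFunctionOn I χ → c (fun x => χ x) = 0) {φ : I → ℂ}
    (hφ : IsBoundedBorel φ) : c φ = 0 := by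
  have hind := h.indicator_eq_zero hI hc
  have hsimple : ∀ f : SimpleFunc I ℂ, c f = 0 := by
    intro f
    have hb : ∀ f : SimpleFunc I ℂ, IsBoundedBorel (f : I → ℂ) := fun f =>
      ⟨f.measurable, f.exists_forall_norm_le⟩
    induction f using SimpleFunc.induction with
    | @const a s hs =>
      have e : (SimpleFunc.piecewise _ hs (SimpleFunc.const I a) (SimpleFunc.const I 0) : I → ℂ) =
          a • Set.indicator s fun _ => 1 := by
        ext x
        rw [SimpleFunc.coe_piecewise, SimpleFunc.coe_const, SimpleFunc.coe_const]
        simp [Set.piecewise, Set.indicator]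
      rw [e, h.map_smul _ _ (isBoundedBorel_indicator hs 1), hind _ hs, mul_zero]
    | add _ hf hg =>
      rw [SimpleFunc.coe_add, h.map_add _ _ (hb _) (hb _), hf, hg, add_zero]
  obtain ⟨M, hM⟩ := hφ.2
  have hM0 : ∀ x, ‖φ x‖ ≤ max M 0 := fun x => (hM x).trans (le_max_left _ _)
  have hsm := hφ.1.stronglyMeasurable
  refine tendsto_nhds_unique (h.tendsto (fun n => hsm.approxBounded (max M 0) n) φ (max M 0)
    (fun n => SimpleFunc.measurable _) (fun n x => hsm.norm_approxBounded_le (le_max_right _ _) n x)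
    fun x => hsm.tendsto_approxBounded_of_norm_le (hM0 x)) ?_
  simp [hsimple]

/-- The device by which identities of the Borel calculus are reduced to test functions: both sides
only have to be Borel functionals of the same variable function. -/
theorem IsBorelFunctional.ext {c c' : (I → ℂ) → ℂ} (h : IsBorelFunctional c)
    (h' : IsBorelFunctional c') (hI : IsOpen I)
    (hc : ∀ χ : ℝ → ℂ, IsTestFunctionOn I χ → c (fun x => χ x) = c' (fun x => χ x)) {φ : I → ℂ}
    (hφ : IsBoundedBorel φ) : c φ = c' φ := by
  have := (h.add (h'.const_mul (-1))).eq_zero hI (fun χ hχ => by rw [hc χ hχ]; ring) hφ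
  linear_combination this

end BorelFunctionals

/-! ### Total variation and a dominating finite measure -/

section TotalVariation

open scoped NNReal CompactlySupported BoundedContinuousFunction

variable {I : Set ℝ} (Λ : testClosure I →L[ℂ] ℂ)

/-- The total variation of the functional `Λ`, evaluated at `f`. -/
def totalVariation (f : ℝ → ℝ≥0) : ℝ≥0 :=
  sSup {r | ∃ g : testClosure I, (∀ x, ‖(g : ℝ →ᵇ ℂ) x‖₊ ≤ f x) ∧ r = ‖Λ g‖₊}

variable {Λ}

theorem nnnorm_le_of_le {g : testClosure I} {f : ℝ → ℝ≥0} {M : ℝ≥0} (hM : ∀ x, f x ≤ M)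
    (hg : ∀ x, ‖(g : ℝ →ᵇ ℂ) x‖₊ ≤ f x) : ‖Λ g‖₊ ≤ ‖Λ‖₊ * M := by
  refine (Λ.le_opNNNorm g).trans (mul_le_mul_right ?_ _)
  have : ‖(g : ℝ →ᵇ ℂ)‖ ≤ M := (BoundedContinuousFunction.norm_le M.2).2 fun x => by
    exact_mod_cast (hg x).trans (hM x)
  exact_mod_cast this

theorem le_totalVariation {g : testClosure I} {f : ℝ → ℝ≥0} {M : ℝ≥0} (hM : ∀ x, f x ≤ M)
    (hg : ∀ x, ‖(g : ℝ →ᵇ ℂ) x‖₊ ≤ f x) : ‖Λ g‖₊ ≤ totalVariation Λ f :=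
  le_csSup ⟨‖Λ‖₊ * M, by rintro _ ⟨g, hg, rfl⟩; exact nnnorm_le_of_le hM hg⟩ ⟨g, hg, rfl⟩

theorem totalVariation_le {f : ℝ → ℝ≥0} {b : ℝ≥0}
    (h : ∀ g : testClosure I, (∀ x, ‖(g : ℝ →ᵇ ℂ) x‖₊ ≤ f x) → ‖Λ g‖₊ ≤ b) :
    totalVariation Λ f ≤ b :=
  csSup_le ⟨‖Λ 0‖₊, 0, by simp, rfl⟩ (by rintro _ ⟨g, hg, rfl⟩; exact h g hg)

theorem exists_norm_le_one_mul_eq (z : ℂ) : ∃ θ : ℂ, ‖θ‖ ≤ 1 ∧ θ * z = ‖z‖ := by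
  rcases eq_or_ne z 0 with rfl | hz
  · exact ⟨0, by simp, by simp⟩
  · refine ⟨conj z / ‖z‖, ?_, ?_⟩
    · rw [norm_div, RCLike.norm_conj, Complex.norm_real, norm_norm, div_self (norm_ne_zero_iff.2 hz)]
    · have : (‖z‖ : ℂ) ≠ 0 := by exact_mod_cast norm_ne_zero_iff.2 hz
      rw [div_mul_eq_mul_div, mul_comm, Complex.mul_conj, Complex.normSq_eq_norm_sq]
      field_simp
      push_cast
      ring

/-- For $\le$, a competitor $g$ is cut into pieces $gf_i/(f_1+f_2+\delta)$, which stay in the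
closure by the ideal property; $\delta>0$ avoids division by zero and leaves a remainder of norm at
most $\delta$. For $\ge$, two competitors are rotated so that their values under $\Lambda$ add
without cancellation. -/
theorem totalVariation_add {f₁ f₂ : ℝ → ℝ≥0} (h₁ : Continuous f₁) (h₂ : Continuous f₂) {M : ℝ≥0}
    (hM₁ : ∀ x, f₁ x ≤ M) (hM₂ : ∀ x, f₂ x ≤ M) :
    totalVariation Λ (fun x => f₁ x + f₂ x) = totalVariation Λ f₁ + totalVariation Λ f₂ := by
  have hM : ∀ x, f₁ x + f₂ x ≤ M + M := fun x => add_le_add (hM₁ x) (hM₂ x)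
  refine le_antisymm (totalVariation_le fun g hg => ?_) ?_
  · refine le_of_forall_pos_le_add fun ε hε => ?_
    -- Chosen so that the remainder contributes at most $\|\Lambda\|\delta\le\varepsilon$.
    set δ : ℝ≥0 := ε / (‖Λ‖₊ + 1) with hδ
    have hδ0 : 0 < δ := by positivity
    have hden : ∀ x, 0 < f₁ x + f₂ x + δ := fun x => by positivity
    have hq : ∀ f : ℝ → ℝ≥0, Continuous f → (∀ x, f x ≤ f₁ x + f₂ x) → ∃ h : ℝ →ᵇ ℂ,
        ∀ x, h x = ((f x / (f₁ x + f₂ x + δ) : ℝ≥0) : ℝ) := by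
      intro f hf hle
      have hc : Continuous fun x => f x / (f₁ x + f₂ x + δ) :=
        hf.div₀ (by fun_prop) fun x => (hden x).ne'
      refine ⟨BoundedContinuousFunction.ofNormedAddCommGroup
        (fun x => (((f x / (f₁ x + f₂ x + δ) : ℝ≥0) : ℝ) : ℂ))
        (Complex.continuous_ofReal.comp (NNReal.continuous_coe.comp hc)) 1 fun x => ?_, fun x => rfl⟩
      rw [Complex.norm_of_nonneg (NNReal.coe_nonneg _)]
      have : f x / (f₁ x + f₂ x + δ) ≤ 1 :=
        div_le_one_of_le₀ ((hle x).trans le_self_add) zero_le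
      exact_mod_cast this
    obtain ⟨q₁, hq₁⟩ := hq f₁ h₁ fun x => le_self_add
    obtain ⟨q₂, hq₂⟩ := hq f₂ h₂ fun x => le_add_self
    set g₁ : testClosure I := ⟨(g : ℝ →ᵇ ℂ) * q₁, mul_mem_testClosure g.2 q₁⟩ with hg₁
    set g₂ : testClosure I := ⟨(g : ℝ →ᵇ ℂ) * q₂, mul_mem_testClosure g.2 q₂⟩ with hg₂
    have hb : ∀ (f : ℝ → ℝ≥0) (q : ℝ →ᵇ ℂ), (∀ x, q x = ((f x / (f₁ x + f₂ x + δ) : ℝ≥0) : ℝ)) →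
        ∀ x, ‖((g : ℝ →ᵇ ℂ) * q) x‖₊ ≤ f x := by
      intro f q hq x
      have e : ‖q x‖₊ = f x / (f₁ x + f₂ x + δ) := by
        rw [hq x]
        ext
        rw [coe_nnnorm, Complex.norm_of_nonneg (NNReal.coe_nonneg _)]
      rw [BoundedContinuousFunction.mul_apply, nnnorm_mul, e, mul_div_left_comm]
      refine mul_le_of_le_one_right zero_le (div_le_one_of_le₀ ((hg x).trans le_self_add)
        zero_le)
    have hr : ‖g - g₁ - g₂‖₊ ≤ δ := by
      have : ‖((g - g₁ - g₂ : testClosure I) : ℝ →ᵇ ℂ)‖ ≤ δ := by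
        refine (BoundedContinuousFunction.norm_le δ.2).2 fun x => ?_
        have hx : ((f₁ x : ℝ) : ℂ) + (f₂ x : ℝ) + (δ : ℝ) ≠ 0 := by
          have := (hden x).ne'
          exact_mod_cast this
        have e : ((g - g₁ - g₂ : testClosure I) : ℝ →ᵇ ℂ) x =
            (g : ℝ →ᵇ ℂ) x * ((δ / (f₁ x + f₂ x + δ) : ℝ≥0) : ℝ) := by
          change (g : ℝ →ᵇ ℂ) x - (g : ℝ →ᵇ ℂ) x * q₁ x - (g : ℝ →ᵇ ℂ) x * q₂ x = _
          rw [hq₁, hq₂]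
          push_cast
          field_simp
          ring
        rw [e, norm_mul, Complex.norm_of_nonneg (NNReal.coe_nonneg _)]
        have : ‖(g : ℝ →ᵇ ℂ) x‖₊ * (δ / (f₁ x + f₂ x + δ)) ≤ δ := by
          rw [mul_div_left_comm]
          exact mul_le_of_le_one_right zero_le (div_le_one_of_le₀
            ((hg x).trans le_self_add) zero_le)
        exact_mod_cast this
      exact_mod_cast this
    have hsplit : g = (g - g₁ - g₂) + g₁ + g₂ := by abel
    calc ‖Λ g‖₊ = ‖Λ (g - g₁ - g₂) + Λ g₁ + Λ g₂‖₊ := by rw [← map_add, ← map_add, ← hsplit]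
      _ ≤ ‖Λ (g - g₁ - g₂)‖₊ + ‖Λ g₁‖₊ + ‖Λ g₂‖₊ :=
        (nnnorm_add_le _ _).trans (add_le_add (nnnorm_add_le _ _) le_rfl)
      _ ≤ ε + totalVariation Λ f₁ + totalVariation Λ f₂ := by
        refine add_le_add (add_le_add ?_ (le_totalVariation hM₁ (hb f₁ q₁ hq₁)))
          (le_totalVariation hM₂ (hb f₂ q₂ hq₂))
        refine (Λ.le_opNNNorm _).trans ((mul_le_mul le_self_add hr zero_le zero_le).trans_eq
          (b := (‖Λ‖₊ + 1) * δ) ?_)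
        rw [hδ, mul_div_cancel₀ _ (by positivity)]
      _ = totalVariation Λ f₁ + totalVariation Λ f₂ + ε := by ring
  · have key : ∀ g₁ g₂ : testClosure I, (∀ x, ‖(g₁ : ℝ →ᵇ ℂ) x‖₊ ≤ f₁ x) →
        (∀ x, ‖(g₂ : ℝ →ᵇ ℂ) x‖₊ ≤ f₂ x) →
        ‖Λ g₁‖₊ + ‖Λ g₂‖₊ ≤ totalVariation Λ fun x => f₁ x + f₂ x := by
      intro g₁ g₂ hg₁ hg₂
      obtain ⟨θ₁, n₁, e₁⟩ := exists_norm_le_one_mul_eq (Λ g₁)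
      obtain ⟨θ₂, n₂, e₂⟩ := exists_norm_le_one_mul_eq (Λ g₂)
      have : ‖Λ (θ₁ • g₁ + θ₂ • g₂)‖₊ = ‖Λ g₁‖₊ + ‖Λ g₂‖₊ := by
        rw [map_add, map_smul, map_smul, smul_eq_mul, smul_eq_mul, e₁, e₂, ← Complex.ofReal_add]
        ext
        rw [coe_nnnorm, Complex.norm_of_nonneg (by positivity)]
        rfl
      rw [← this]
      refine le_totalVariation hM fun x => ?_
      have hle : ∀ {θ : ℂ} {f : ℝ → ℝ≥0} {g : testClosure I}, ‖θ‖ ≤ 1 →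
          (∀ x, ‖(g : ℝ →ᵇ ℂ) x‖₊ ≤ f x) → ‖θ * (g : ℝ →ᵇ ℂ) x‖₊ ≤ f x := by
        intro θ f g hθ hg
        rw [nnnorm_mul]
        exact (mul_le_of_le_one_left zero_le (by exact_mod_cast hθ)).trans (hg x)
      exact (nnnorm_add_le _ _).trans (add_le_add (hle n₁ hg₁) (hle n₂ hg₂))
    have key' : ∀ g₂ : testClosure I, (∀ x, ‖(g₂ : ℝ →ᵇ ℂ) x‖₊ ≤ f₂ x) →
        totalVariation Λ f₁ + ‖Λ g₂‖₊ ≤ totalVariation Λ fun x => f₁ x + f₂ x := fun g₂ hg₂ =>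
      add_le_of_le_tsub_right_of_le ((by simpa using key 0 g₂ (by simp) hg₂))
        (totalVariation_le fun g₁ hg₁ => le_tsub_of_add_le_right (key g₁ g₂ hg₁ hg₂))
    have h0 := key' 0 (by simp)
    rw [map_zero, nnnorm_zero, add_zero] at h0
    exact add_le_of_le_tsub_left_of_le h0
      (totalVariation_le fun g₂ hg₂ => le_tsub_of_add_le_left (key' g₂ hg₂))

theorem totalVariation_smul_le (c : ℝ≥0) {f : ℝ → ℝ≥0} {M : ℝ≥0} (hM : ∀ x, f x ≤ M) :
    c * totalVariation Λ f ≤ totalVariation Λ (fun x => c * f x) := by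
  rcases eq_or_ne c 0 with rfl | hc
  · simp
  rw [← le_div_iff₀' (by positivity)]
  refine totalVariation_le fun g hg => ?_
  rw [le_div_iff₀' (by positivity)]
  have : ‖Λ ((c : ℂ) • g)‖₊ = c * ‖Λ g‖₊ := by
    rw [map_smul, nnnorm_smul]
    congr 1
    ext
    simp
  rw [← this]
  refine le_totalVariation (M := c * M) (fun x => mul_le_mul_right (hM x) c) fun x => ?_
  change ‖(c : ℂ) * (g : ℝ →ᵇ ℂ) x‖₊ ≤ _
  rw [nnnorm_mul]
  refine mul_le_mul (le_of_eq ?_) (hg x) zero_le zero_le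
  ext
  simp

theorem totalVariation_smul (c : ℝ≥0) {f : ℝ → ℝ≥0} {M : ℝ≥0} (hM : ∀ x, f x ≤ M) :
    totalVariation Λ (fun x => c * f x) = c * totalVariation Λ f := by
  refine le_antisymm ?_ (totalVariation_smul_le c hM)
  rcases eq_or_ne c 0 with rfl | hc
  · rw [zero_mul]
    refine totalVariation_le fun g hg => ?_
    have : g = 0 := by
      ext x
      simpa using hg x
    simp [this]
  · have := totalVariation_smul_le (Λ := Λ) c⁻¹ (f := fun x => c * f x) (M := c * M)
      fun x => mul_le_mul_right (hM x) c
    simp only [inv_mul_cancel_left₀ hc] at this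
    rwa [inv_mul_le_iff₀ (by positivity)] at this

variable (Λ) in
/-- The total variation of a functional is a positive functional. -/
def totalVariationLinear : C_c(ℝ, ℝ≥0) →ₗ[ℝ≥0] ℝ≥0 where
  toFun f := totalVariation Λ f
  map_add' f f' := by
    obtain ⟨M, hM⟩ := f.hasCompactSupport.isCompact_range f.continuous |>.bddAbove
    obtain ⟨M', hM'⟩ := f'.hasCompactSupport.isCompact_range f'.continuous |>.bddAbove
    exact totalVariation_add f.continuous f'.continuous (M := max M M')
      (fun x => (hM ⟨x, rfl⟩).trans (le_max_left _ _)) fun x => (hM' ⟨x, rfl⟩).trans (le_max_right _ _)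
  map_smul' c f := by
    obtain ⟨M, hM⟩ := f.hasCompactSupport.isCompact_range f.continuous |>.bddAbove
    exact totalVariation_smul c fun x => hM ⟨x, rfl⟩

variable (Λ) in
-- The measure is the Riesz–Markov measure of the total variation. Testing with bumps bounded by $1$
-- bounds the mass of every ball by $\|\Lambda\|$.
theorem exists_dominating_measure : ∃ μ : Measure ℝ, μ Set.univ ≤ ‖Λ‖₊ ∧
    ∀ (χ : ℝ → ℂ) (hχ : IsTestFunctionOn I χ), ‖Λ hχ.toClosure‖ ≤ ∫ x, ‖χ x‖ ∂μ := by
  refine ⟨NNRealRMK.rieszMeasure (totalVariationLinear Λ), ?_, fun χ hχ => ?_⟩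
  · have hball : ∀ n : ℕ, NNRealRMK.rieszMeasure (totalVariationLinear Λ)
        (Metric.closedBall 0 n) ≤ ‖Λ‖₊ := by
      intro n
      let ρ : ContDiffBump (0 : ℝ) := ⟨n + 1, n + 2, by positivity, by linarith⟩
      let f : C_c(ℝ, ℝ≥0) :=
        { toFun := fun x => (ρ x).toNNReal
          continuous_toFun := continuous_real_toNNReal.comp ρ.continuous
          hasCompactSupport' := ρ.hasCompactSupport.comp_left Real.toNNReal_zero }
      have hf : ∀ x, f x ≤ 1 := fun x => Real.toNNReal_le_one.2 ρ.le_one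
      calc NNRealRMK.rieszMeasure (totalVariationLinear Λ) (Metric.closedBall 0 n)
          = ∫⁻ x in Metric.closedBall (0 : ℝ) n, 1
              ∂(NNRealRMK.rieszMeasure (totalVariationLinear Λ)) := (setLIntegral_one _).symm
        _ ≤ ∫⁻ x in Metric.closedBall (0 : ℝ) n, f x
              ∂(NNRealRMK.rieszMeasure (totalVariationLinear Λ)) := by
          refine setLIntegral_mono' measurableSet_closedBall fun x hx => ?_
          have : ρ x = 1 := ρ.one_of_mem_closedBall
            (Metric.closedBall_subset_closedBall (by change (n : ℝ) ≤ n + 1; linarith) hx)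
          change (1 : ENNReal) ≤ ((ρ x).toNNReal : ℝ≥0)
          simp [this]
        _ ≤ ∫⁻ x, f x ∂(NNRealRMK.rieszMeasure (totalVariationLinear Λ)) :=
          setLIntegral_le_lintegral _ _
        _ = (totalVariationLinear Λ f : ℝ≥0) := NNRealRMK.lintegral_rieszMeasure _ f
        _ ≤ ‖Λ‖₊ := by
          refine ENNReal.coe_le_coe.2 (totalVariation_le fun g hg => ?_)
          simpa using nnnorm_le_of_le (Λ := Λ) hf hg
    have hU : (⋃ n : ℕ, Metric.closedBall (0 : ℝ) n) = Set.univ := Metric.iUnion_closedBall_nat 0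
    rw [← hU, Monotone.measure_iUnion]
    · exact iSup_le hball
    · exact fun m n hmn => Metric.closedBall_subset_closedBall (by exact_mod_cast hmn)
  · let f : C_c(ℝ, ℝ≥0) :=
      { toFun := fun x => ‖χ x‖₊
        continuous_toFun := hχ.continuous.nnnorm
        hasCompactSupport' := hχ.2.1.comp_left nnnorm_zero }
    obtain ⟨M, hM⟩ := f.hasCompactSupport.isCompact_range f.continuous |>.bddAbove
    have h1 : ‖Λ hχ.toClosure‖₊ ≤ totalVariationLinear Λ f :=
      le_totalVariation (fun x => hM ⟨x, rfl⟩) fun x => le_rfl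
    have h2 := NNRealRMK.integral_rieszMeasure (totalVariationLinear Λ) f
    have h3 : ∫ x, (f x : ℝ) ∂NNRealRMK.rieszMeasure (totalVariationLinear Λ) =
      ∫ x, ‖χ x‖ ∂NNRealRMK.rieszMeasure (totalVariationLinear Λ) := rfl
    rw [← h3, h2]
    exact_mod_cast h1

end TotalVariation

/-! ### Extension of functionals to bounded Borel functions -/

section BorelExtension

open scoped BoundedContinuousFunction

variable {I : Set ℝ}

/-- The space of bounded Borel functions on `I`. -/
def borelSubmodule (I : Set ℝ) : Submodule ℂ (I → ℂ) where
  carrier := {φ | IsBoundedBorel φ}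
  zero_mem' := ⟨measurable_const, 0, by simp⟩
  add_mem' h h' := h.add h'
  smul_mem' c _ h := h.smul c

theorem IsBoundedBorel.integrable {φ : I → ℂ} (hφ : IsBoundedBorel φ) (μ : Measure I)
    [IsFiniteMeasure μ] : Integrable φ μ := by
  obtain ⟨M, hM⟩ := hφ.2
  exact Integrable.of_bound hφ.1.aestronglyMeasurable M (.of_forall hM)

/-- The `L¹` seminorm on the bounded Borel functions. -/
def borelSeminorm (μ : Measure I) [IsFiniteMeasure μ] : Seminorm ℂ (borelSubmodule I) :=
  Seminorm.of (fun φ => ∫ x, ‖φ.1 x‖ ∂μ)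
    (fun φ ψ => by
      rw [← integral_add (IsBoundedBorel.integrable φ.2 μ).norm
        (IsBoundedBorel.integrable ψ.2 μ).norm]
      exact integral_mono (IsBoundedBorel.integrable (φ + ψ).2 μ).norm
        ((IsBoundedBorel.integrable φ.2 μ).norm.add (IsBoundedBorel.integrable ψ.2 μ).norm)
        fun x => norm_add_le _ _)
    (fun a φ => by
      rw [← integral_const_mul]
      simp)

/-- The restriction of test functions to `I`. -/
def restrictTest (I : Set ℝ) : testSubmodule I →ₗ[ℂ] borelSubmodule I where
  toFun g := ⟨fun x => g.1 x, IsTestFunctionOn.isBoundedBorel g.2⟩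
  map_add' _ _ := rfl
  map_smul' _ _ := rfl

theorem restrictTest_injective : Function.Injective (restrictTest I) := by
  intro g g' h
  ext x
  by_cases hx : x ∈ I
  · exact congrFun (congrArg Subtype.val h) ⟨x, hx⟩
  · have h1 : g.1 x = 0 := IsTestFunctionOn.eq_zero (V := I) g.2 hx
    have h2 : g'.1 x = 0 := IsTestFunctionOn.eq_zero (V := I) g'.2 hx
    rw [h1, h2]

/-- Hahn–Banach with the $L^1(\mu)$ seminorm of the dominating measure extends $\Lambda$. Domination
by this seminorm yields continuity under bounded pointwise convergence, through dominated
convergence, and the norm bound, through the total mass. -/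
theorem exists_isBorelFunctional (hI : IsOpen I) (Λ : testClosure I →L[ℂ] ℂ) :
    ∃ c : (I → ℂ) → ℂ, IsBorelFunctional c ∧
      (∀ (χ : ℝ → ℂ) (hχ : IsTestFunctionOn I χ), c (fun x => χ x) = Λ hχ.toClosure) ∧
      ∀ (φ : I → ℂ) (M : ℝ), IsBoundedBorel φ → (∀ x, ‖φ x‖ ≤ M) → 0 ≤ M → ‖c φ‖ ≤ ‖Λ‖ * M := by
  obtain ⟨μ₀, hμ₀, hΛ⟩ := exists_dominating_measure Λ
  set μ : Measure I := μ₀.comap Subtype.val with hμ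
  have hμu : μ Set.univ ≤ ‖Λ‖₊ := by
    rw [hμ, comap_subtype_coe_apply hI.measurableSet]
    exact (measure_mono (Set.subset_univ _)).trans hμ₀
  have : IsFiniteMeasure μ := ⟨hμu.trans_lt ENNReal.coe_lt_top⟩
  let e := LinearEquiv.ofInjective (restrictTest I) restrictTest_injective
  let f : Module.Dual ℂ (LinearMap.range (restrictTest I)) :=
    (Λ.toLinearMap.comp (Submodule.inclusion (Submodule.le_topologicalClosure _))).comp
      e.symm.toLinearMap
  have hf : ∀ g : testSubmodule I, f (e g) =
      Λ (IsTestFunctionOn.toClosure (I := I) (χ := g.1) g.2) := fun g => by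
    simp only [f, LinearMap.comp_apply, LinearEquiv.coe_coe, LinearEquiv.symm_apply_apply]
    rfl
  obtain ⟨G, hG, hGle⟩ := Module.Dual.exists_extension_of_le_seminorm
    (LinearMap.range (restrictTest I)) f (p := borelSeminorm μ) (fun φ => by
      obtain ⟨g, rfl⟩ := e.surjective φ
      rw [hf]
      refine (hΛ _ _).trans_eq ?_
      change _ = ∫ x : I, ‖g.1 x‖ ∂μ
      rw [hμ, integral_subtype_comap hI.measurableSet (fun x => ‖g.1 x‖),
        setIntegral_eq_integral_of_forall_compl_eq_zero]
      intro x hx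
      rw [IsTestFunctionOn.eq_zero (V := I) g.2 hx, norm_zero])
  classical
  -- The value $0$ off the bounded Borel functions is a dummy.
  let c : (I → ℂ) → ℂ := fun φ => if h : IsBoundedBorel φ then G ⟨φ, h⟩ else 0
  have hc : ∀ {φ} (h : IsBoundedBorel φ), c φ = G ⟨φ, h⟩ := fun h => dif_pos h
  refine ⟨c, ⟨fun φ ψ hφ hψ => ?_, fun a φ hφ => ?_, ?_⟩, fun χ hχ => ?_, ?_⟩
  · rw [hc hφ, hc hψ, hc (hφ.add hψ), ← map_add]
    rfl
  · rw [hc hφ, hc (hφ.smul a), ← smul_eq_mul, ← map_smul]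
    rfl
  · intro φ ψ M hm hM hlim
    have hb : ∀ n, IsBoundedBorel (φ n) := fun n => ⟨hm n, M, hM n⟩
    have hψM : ∀ x, ‖ψ x‖ ≤ M := fun x => le_of_tendsto (hlim x).norm (.of_forall fun n => hM n x)
    have hψm : Measurable ψ := measurable_of_tendsto_metrizable hm (tendsto_pi_nhds.2 hlim)
    have hψ : IsBoundedBorel ψ := ⟨hψm, M, hψM⟩
    rw [tendsto_iff_norm_sub_tendsto_zero]
    refine squeeze_zero (fun n => norm_nonneg _) (g := fun n => ∫ x, ‖φ n x - ψ x‖ ∂μ)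
      (fun n => ?_) ?_
    · rw [hc (hb n), hc hψ, ← map_sub]
      exact hGle _
    · have := tendsto_integral_of_dominated_convergence (μ := μ) (F := fun n x => ‖φ n x - ψ x‖)
        (f := fun _ => 0) (fun _ => M + M) (fun n => ((hm n).sub hψm).norm.aestronglyMeasurable)
        (integrable_const _) (fun n => .of_forall fun x => by
          rw [norm_norm]
          exact (norm_sub_le _ _).trans (add_le_add (hM n x) (hψM x)))
        (.of_forall fun x => by
          have := ((hlim x).sub_const (ψ x)).norm
          simpa using this)
      simpa using this
  · rw [hc hχ.isBoundedBorel]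
    have := hG (e ⟨hχ.toClosure.1, hχ⟩)
    rw [hf] at this
    exact this
  · intro φ M hφ hM hM0
    rw [hc hφ]
    refine (hGle _).trans ?_
    calc ∫ x, ‖φ x‖ ∂μ ≤ ∫ x, M ∂μ := integral_mono (hφ.integrable μ).norm (integrable_const _) hM
      _ = (μ Set.univ).toReal * M := by rw [integral_const]; rfl
      _ ≤ ‖Λ‖ * M := mul_le_mul_of_nonneg_right
        (by simpa using ENNReal.toReal_mono ENNReal.coe_ne_top hμu) hM0

end BorelExtension

/-! ### Nondegeneracy and operators from sesquilinear forms -/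

section KreinRepresentation

variable {E : Type*} [NormedAddCommGroup E] [NormedSpace ℂ E] (k : KreinStructure E)

/-- Nondegeneracy is the uniqueness of the representing vector, transported to the second variable
by hermitian symmetry. -/
theorem KreinStructure.ext_form {w w' : E} (h : ∀ v, k.form v w = k.form v w') : w = w' := by
  obtain ⟨u, -, hu⟩ := k.represents (k.form w)
  have : k.form w = k.form w' := by
    ext v
    rw [k.hermitian, h v, ← k.hermitian]
  rw [hu w rfl, hu w' this]

/-- Each $B(\cdot,u)$ is represented by a vector; linearity follows from nondegeneracy and
boundedness from the closed graph theorem. -/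
theorem KreinStructure.exists_operator [CompleteSpace E] (B : E → E → ℂ)
    (hadd : ∀ v v' u, B (v + v') u = B v u + B v' u)
    (hsmul : ∀ (a : ℂ) v u, B (a • v) u = conj a * B v u)
    (hadd' : ∀ v u u', B v (u + u') = B v u + B v u')
    (hsmul' : ∀ (a : ℂ) v u, B v (a • u) = a * B v u)
    (C : ℝ) (hC : ∀ v u, ‖B v u‖ ≤ C * ‖v‖ * ‖u‖) :
    ∃ S : E →L[ℂ] E, ∀ v u, k.form v (S u) = B v u := by
  have hex : ∀ u, ∃ w, ∀ v, k.form v w = B v u := by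
    intro u
    let φ : E →ₗ[ℂ] ℂ :=
      { toFun := fun v => conj (B v u)
        map_add' := fun v v' => by rw [hadd, map_add]
        map_smul' := fun a v => by rw [hsmul, map_mul, Complex.conj_conj]; rfl }
    obtain ⟨w, hw, -⟩ := k.represents (φ.mkContinuous (C * ‖u‖) fun v => by
      change ‖conj (B v u)‖ ≤ _
      rw [RCLike.norm_conj]
      linarith [hC v u])
    refine ⟨w, fun v => ?_⟩
    rw [k.hermitian, ← hw]
    exact Complex.conj_conj _
  choose S hS using hex
  let S' : E →ₗ[ℂ] E :=
    { toFun := S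
      map_add' := fun u u' => k.ext_form fun v => by rw [map_add, hS, hS, hS, hadd']
      map_smul' := fun a u => k.ext_form fun v => by
        rw [map_smul, hS, hS, hsmul']; rfl }
  refine ⟨ContinuousLinearMap.ofSeqClosedGraph (g := S') fun u x y hu hy => ?_, fun v u => hS u v⟩
  refine k.ext_form fun v => ?_
  have h1 : Tendsto (fun n => k.form v (S' (u n))) atTop (𝓝 (k.form v y)) :=
    ((k.form v).continuous.tendsto y).comp hy
  let b : E →ₗ[ℂ] ℂ :=
    { toFun := fun u => B v u
      map_add' := hadd' v
      map_smul' := fun a u => hsmul' a v u }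
  have hb : Continuous b := (b.mkContinuous (C * ‖v‖) fun u => hC v u).continuous
  have h2 : Tendsto (fun n => k.form v (S' (u n))) atTop (𝓝 (B v x)) :=
    ((hb.tendsto x).comp hu).congr fun n => (hS (u n) v).symm
  rw [tendsto_nhds_unique h1 h2]
  exact (hS x v).symm

end KreinRepresentation

/-! ### Existence of the Borel calculus -/

section BorelCalculus

variable {E : Type*} [NormedAddCommGroup E] [NormedSpace ℂ E] [CompleteSpace E] {H : E →ₗ.[ℂ] E}
  {I : Set ℝ}

/-- The extensions of $\chi\mapsto\langle v|\chi(H)u\rangle$ are chosen separately for each pair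
$(v,u)$, but are determined by test functions, hence sesquilinear in $(v,u)$. They therefore define
operators. -/
theorem HasC0Calculus.exists_isBorelCalculus (k : KreinStructure E) (hI : IsOpen I)
    (h : HasC0Calculus H I) : ∃ F, IsBorelCalculus H I F := by
  obtain ⟨T, hT⟩ := h.exists_extension
  let Λ : E → E → (testClosure I →L[ℂ] ℂ) := fun v u =>
    (k.form v).comp ((ContinuousLinearMap.apply ℂ E u).comp T)
  have hΛ : ∀ v u, ‖Λ v u‖ ≤ ‖k.form‖ * ‖T‖ * ‖v‖ * ‖u‖ := by
    intro v u
    refine ContinuousLinearMap.opNorm_le_bound _ (by positivity) fun g => ?_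
    change ‖k.form v (T g u)‖ ≤ _
    calc ‖k.form v (T g u)‖ ≤ ‖k.form‖ * ‖v‖ * (‖T‖ * ‖g‖ * ‖u‖) :=
          (k.form.le_opNorm₂ v _).trans (mul_le_mul_of_nonneg_left (T.le_opNorm₂ g u) (by positivity))
      _ = _ := by ring
  choose c hc hcχ hcb using fun v u => exists_isBorelFunctional hI (Λ v u)
  have hcχ' : ∀ v u χ (_ : IsTestFunctionOn I χ), c v u (fun x => χ x) =
      k.form v (smoothCalc H χ u) := by
    intro v u χ hχ
    rw [hcχ v u χ hχ, ← hT χ hχ]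
    rfl
  have hF : ∀ φ : I → ℂ, ∃ S : E →L[ℂ] E, IsBoundedBorel φ →
      ∀ v u, k.form v (S u) = c v u φ := by
    intro φ
    by_cases hφ : IsBoundedBorel φ
    · obtain ⟨M, hM⟩ := hφ.2
      have hM0 : ∀ x, ‖φ x‖ ≤ max M 0 := fun x => (hM x).trans (le_max_left _ _)
      obtain ⟨S, hS⟩ := k.exists_operator (fun v u => c v u φ)
        (fun v v' u => (hc _ _).ext ((hc v u).add (hc v' u)) hI
          (fun χ hχ => by simp [hcχ' _ _ _ hχ]) hφ)
        (fun a v u => (hc _ _).ext ((hc v u).const_mul (conj a)) hI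
          (fun χ hχ => by simp [hcχ' _ _ _ hχ]) hφ)
        (fun v u u' => (hc _ _).ext ((hc v u).add (hc v u')) hI
          (fun χ hχ => by simp [hcχ' _ _ _ hχ]) hφ)
        (fun a v u => (hc _ _).ext ((hc v u).const_mul a) hI
          (fun χ hχ => by simp [hcχ' _ _ _ hχ]) hφ)
        (‖k.form‖ * ‖T‖ * max M 0) (fun v u => (hcb v u φ _ hφ hM0 (le_max_right _ _)).trans (by
          calc ‖Λ v u‖ * max M 0 ≤ (‖k.form‖ * ‖T‖ * ‖v‖ * ‖u‖) * max M 0 :=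
                mul_le_mul_of_nonneg_right (hΛ v u) (le_max_right _ _)
            _ = _ := by ring))
      exact ⟨S, fun _ => hS⟩
    · exact ⟨0, fun h => absurd h hφ⟩
  choose F hF using hF
  have htest : ∀ χ, IsTestFunctionOn I χ → F (fun x => χ x) = smoothCalc H χ := fun χ hχ => by
    ext u
    exact k.ext_form fun v => by rw [hF _ hχ.isBoundedBorel, hcχ' _ _ _ hχ]
  -- Multiplicativity is extended one factor at a time. With $\chi$ a fixed test function, $\langle
  -- v|\chi(H)\,\cdot\rangle=\langle v'|\cdot\rangle$ for some $v'$, so both sides are Borel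
  -- functionals of $\psi$.
  have hmul₁ : ∀ χ (_ : IsTestFunctionOn I χ) ψ (_ : IsBoundedBorel ψ) (v u : E),
      c v u ((fun x : I => χ x) * ψ) = k.form v (smoothCalc H χ (F ψ u)) := by
    intro χ hχ ψ hψ v u
    obtain ⟨v', hv', -⟩ := k.represents ((k.form v).comp (smoothCalc H χ))
    have e : ∀ w, k.form v (smoothCalc H χ w) = k.form v' w := fun w => by rw [← hv']; rfl
    rw [e, hF _ hψ]
    refine ((hc v u).mul_left hχ.isBoundedBorel).ext (hc v' u) hI (fun η hη => ?_) hψ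
    rw [hcχ' _ _ _ hη, ← e]
    have := hcχ' v u _ (hχ.mul hη.1)
    rw [← h.smoothCalc_mul hχ hη] at this
    exact this
  refine ⟨F, fun φ ψ hφ hψ => ?_, fun a φ hφ => ?_, fun φ ψ hφ hψ => ?_, htest, ?_⟩
  · ext u
    refine k.ext_form fun v => ?_
    rw [hF _ (hφ.add hψ), add_apply, map_add, hF _ hφ, hF _ hψ, (hc v u).map_add _ _ hφ hψ]
  · ext u
    refine k.ext_form fun v => ?_
    rw [hF _ (hφ.smul a), smul_apply, map_smul, hF _ hφ, (hc v u).map_smul _ _ hφ]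
    rfl
  · ext u
    refine k.ext_form fun v => ?_
    rw [hF _ (hφ.mul hψ), ContinuousLinearMap.comp_apply, hF _ hφ, mul_comm]
    refine ((hc v u).mul_left hψ).ext (hc v (F ψ u)) hI (fun χ hχ => ?_) hφ
    rw [mul_comm, hmul₁ χ hχ ψ hψ, hcχ' _ _ _ hχ]
  · intro φ ψ M hm hM hlim u ℓ
    obtain ⟨v, rfl, -⟩ := k.represents ℓ
    have hψ : IsBoundedBorel ψ := ⟨measurable_of_tendsto_metrizable hm (tendsto_pi_nhds.2 hlim), M,
      fun x => le_of_tendsto (hlim x).norm (.of_forall fun n => hM n x)⟩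
    rw [hF _ hψ]
    exact ((hc v u).tendsto φ ψ M hm hM hlim).congr fun n => (hF _ ⟨hm n, M, hM n⟩ v u).symm

/-- Rules out the default value $0$ in the definition of `borelCalc`. -/
theorem HasC0Calculus.isBorelCalculus_borelCalc (k : KreinStructure E) (hI : IsOpen I)
    (h : HasC0Calculus H I) : IsBorelCalculus H I (borelCalc H I) := by
  have hex := h.exists_isBorelCalculus k hI
  rw [borelCalc, dif_pos hex]
  exact hex.choose_spec

theorem IsBorelCalculus.isBorelFunctional {F : (I → ℂ) → E →L[ℂ] E} (hF : IsBorelCalculus H I F)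
    (ℓ : E →L[ℂ] ℂ) (u : E) : IsBorelFunctional fun φ => ℓ (F φ u) where
  map_add φ ψ hφ hψ := by rw [hF.map_add φ ψ hφ hψ, add_apply, _root_.map_add]
  map_smul a φ hφ := by rw [hF.map_smul a φ hφ, smul_apply, _root_.map_smul, smul_eq_mul]
  tendsto φ ψ M h1 h2 h3 := hF.tendsto_weak φ ψ M h1 h2 h3 u ℓ

end BorelCalculus

/-! ### Adjoints, resolvents and eigenvectors in the Borel calculus -/

section CalculusProperties

variable {E : Type*} [NormedAddCommGroup E] [NormedSpace ℂ E] [CompleteSpace E] {H : E →ₗ.[ℂ] E}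
  {I : Set ℝ} {F : (I → ℂ) → E →L[ℂ] E} {k : KreinStructure E}

theorem isBoundedBorel_inv_sub {z : ℂ} (hz : z.im ≠ 0) :
    IsBoundedBorel fun x : I => ((x : ℂ) - z)⁻¹ := by
  refine ⟨((contDiff_inv_ofReal_sub hz).continuous.comp continuous_subtype_val).measurable,
    |z.im|⁻¹, fun x => ?_⟩
  rw [norm_inv]
  refine inv_anti₀ (abs_pos.2 hz) ?_
  simpa using Complex.abs_im_le_norm ((x : ℂ) - z)

theorem mem_eigenspaceOp {z : ℂ} {u : E} :
    u ∈ eigenspaceOp H z ↔ ∃ h : u ∈ H.domain, H ⟨u, h⟩ = z • u := by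
  simp only [eigenspaceOp, Submodule.mem_map, LinearMap.mem_ker, LinearMap.sub_apply,
    LinearMap.smul_apply, Submodule.subtype_apply, sub_eq_zero]
  constructor
  · rintro ⟨y, hy, rfl⟩
    exact ⟨y.2, hy⟩
  · rintro ⟨h, hu⟩
    exact ⟨⟨u, h⟩, hu, rfl⟩

theorem IsBorelCalculus.form_apply (hF : IsBorelCalculus H I F) (hI : IsOpen I)
    (hcalc : HasC0Calculus H I) (hH : k.IsSelfAdjointOp H) {φ : I → ℂ} (hφ : IsBoundedBorel φ)
    (u v : E) : k.form u (F φ v) = k.form (F (fun x => conj (φ x)) u) v := by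
  rw [k.hermitian (F (fun x => conj (φ x)) u) v]
  refine (hF.isBorelFunctional (k.form u) v).ext (hF.isBorelFunctional (k.form v) u).conj hI
    (fun χ hχ => ?_) hφ
  have := hF.map_test _ hχ.conj
  rw [hF.map_test χ hχ, hH.form_smoothCalc (hcalc.isTest hχ), this, k.hermitian]

theorem IsBorelCalculus.apply_resolventOp (hF : IsBorelCalculus H I F) (hI : IsOpen I)
    (hcalc : HasC0Calculus H I) (k : KreinStructure E) {z : ℂ} (hz : z ∈ resolventSetOp H)
    (hz' : z.im ≠ 0) {φ : I → ℂ} (hφ : IsBoundedBorel φ) (u : E) :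
    F φ (resolventOp H z u) = F ((fun x : I => ((x : ℂ) - z)⁻¹) * φ) u := by
  refine k.ext_form fun v => ?_
  refine (hF.isBorelFunctional (k.form v) _).ext
    ((hF.isBorelFunctional (k.form v) u).mul_left (isBoundedBorel_inv_sub hz')) hI
    (fun χ hχ => ?_) hφ
  have h1 := hF.map_test _ (hχ.mul (contDiff_inv_ofReal_sub hz'))
  have h2 : ((fun x : I => ((x : ℂ) - z)⁻¹) * fun x : I => χ x) =
      fun x : I => χ x * ((x : ℂ) - z)⁻¹ := by
    ext x; exact mul_comm _ _
  rw [h2, h1, hF.map_test χ hχ, ← smoothCalc_mul_resolventOp (hcalc.isTest hχ) hz hz']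
  rfl

theorem IsBorelCalculus.resolventOp_apply (hF : IsBorelCalculus H I F) (hI : IsOpen I)
    (hcalc : HasC0Calculus H I) (k : KreinStructure E) {z : ℂ} (hz : z ∈ resolventSetOp H)
    {φ : I → ℂ} (hφ : IsBoundedBorel φ) (u : E) :
    resolventOp H z (F φ u) = F φ (resolventOp H z u) := by
  refine k.ext_form fun v => ?_
  refine (hF.isBorelFunctional ((k.form v).comp (resolventOp H z)) u).ext
    (hF.isBorelFunctional (k.form v) _) hI (fun χ hχ => ?_) hφ
  have := congrArg (fun S : E →L[ℂ] E => k.form v (S u))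
    (resolventOp_mul_smoothCalc (hcalc.isTest hχ) hz)
  rw [hF.map_test χ hχ]
  exact this

theorem IsBorelCalculus.apply_eigenvector (hF : IsBorelCalculus H I F) (hI : IsOpen I)
    (hcalc : HasC0Calculus H I) (k : KreinStructure E) {l : ℝ} (hl : l ∈ I) {u : E}
    (hu : u ∈ eigenspaceOp H (l : ℂ)) {φ : I → ℂ} (hφ : IsBoundedBorel φ) :
    F φ u = φ ⟨l, hl⟩ • u := by
  obtain ⟨hd, hu⟩ := mem_eigenspaceOp.1 hu
  refine k.ext_form fun v => ?_
  rw [_root_.map_smul, smul_eq_mul]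
  have hc : IsBorelFunctional fun φ : I → ℂ => φ ⟨l, hl⟩ * k.form v u :=
    ⟨fun φ ψ _ _ => by rw [Pi.add_apply]; ring, fun a φ _ => by rw [Pi.smul_apply, smul_eq_mul]; ring,
      fun φ ψ M _ _ h => (h _).mul_const _⟩
  refine (hF.isBorelFunctional (k.form v) u).ext hc hI (fun χ hχ => ?_) hφ
  rw [hF.map_test χ hχ]
  have := smoothCalc_apply_eigenvector (hcalc.isTest hχ) hu
  rw [this, _root_.map_smul, smul_eq_mul]

/-- A nonreal point is needed for $1/(x-z)$ to be bounded on $I$; a resolvent point given in advance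
may be real. -/
theorem HasC0Calculus.exists_mem_resolventSetOp (hcalc : HasC0Calculus H I) {l : ℝ} (hl : l ∈ I) :
    ∃ z ∈ resolventSetOp H, z.im ≠ 0 := by
  obtain ⟨U, -, hlU, ν, n, C, hν, -, h⟩ := hcalc.1 hl
  exact ⟨⟨l, ν⟩, (h ⟨l, ν⟩ hlU (by simpa using hν.ne') (by simp [abs_of_pos hν])).1, hν.ne'⟩

end CalculusProperties

/-! ### Spectral projections and positivity -/

section SpectralProjections

variable {E : Type*} [NormedAddCommGroup E] [NormedSpace ℂ E] [CompleteSpace E] {H : E →ₗ.[ℂ] E}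
  {I J S T : Set ℝ} {k : KreinStructure E}

theorem isBoundedBorel_indicator_coe (I : Set ℝ) (hS : MeasurableSet S) :
    IsBoundedBorel fun x : I => S.indicator (fun _ => (1 : ℂ)) (x : ℝ) :=
  ⟨(measurable_const.indicator hS).comp measurable_subtype_coe, 1, fun x => by
    by_cases hx : (x : ℝ) ∈ S <;> simp [hx]⟩

theorem spectralProj_apply_apply (hF : IsBorelCalculus H I (borelCalc H I)) (hS : MeasurableSet S)
    (hT : MeasurableSet T) (u : E) :
    spectralProj H I S (spectralProj H I T u) = spectralProj H I (S ∩ T) u := by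
  have := hF.map_mul _ _ (isBoundedBorel_indicator_coe I hS) (isBoundedBorel_indicator_coe I hT)
  have e : ((fun x : I => S.indicator (fun _ => (1 : ℂ)) (x : ℝ)) *
      fun x : I => T.indicator (fun _ => (1 : ℂ)) (x : ℝ)) =
      fun x : I => (S ∩ T).indicator (fun _ => (1 : ℂ)) (x : ℝ) := by
    ext x
    by_cases hx : (x : ℝ) ∈ S <;> by_cases hx' : (x : ℝ) ∈ T <;> simp [hx, hx']
  rw [e] at this
  rw [spectralProj, spectralProj, spectralProj, this]
  rfl

theorem spectralProj_apply_of_subset (hF : IsBorelCalculus H I (borelCalc H I))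
    (hS : MeasurableSet S) (hT : MeasurableSet T) (h : S ⊆ T) {u : E}
    (hu : spectralProj H I S u = u) : spectralProj H I T u = u := by
  rw [← hu, spectralProj_apply_apply hF hT hS, Set.inter_eq_right.2 h]

theorem spectralProj_apply_self (hF : IsBorelCalculus H I (borelCalc H I))
    (hS : MeasurableSet S) (u : E) :
    spectralProj H I S (spectralProj H I S u) = spectralProj H I S u := by
  rw [spectralProj_apply_apply hF hS hS, Set.inter_self]

theorem spectralProj_eq_add (hF : IsBorelCalculus H I (borelCalc H I)) (hS : MeasurableSet S)
    {l : ℝ} (hl : l ∈ S) :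
    spectralProj H I S = spectralProj H I (S \ {l}) + spectralProj H I {l} := by
  rw [spectralProj, spectralProj, spectralProj, ← hF.map_add _ _
    (isBoundedBorel_indicator_coe I (hS.diff (measurableSet_singleton l)))
    (isBoundedBorel_indicator_coe I (measurableSet_singleton l))]
  congr 1
  ext x
  by_cases hx : (x : ℝ) = l
  · simp [hx, hl]
  · by_cases hx' : (x : ℝ) ∈ S <;> simp [hx, hx']

theorem form_spectralProj (hF : IsBorelCalculus H I (borelCalc H I)) (hI : IsOpen I)
    (hcalc : HasC0Calculus H I) (hH : k.IsSelfAdjointOp H) (hS : MeasurableSet S) (u v : E) :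
    k.form u (spectralProj H I S v) = k.form (spectralProj H I S u) v := by
  rw [spectralProj, hF.form_apply hI hcalc hH (isBoundedBorel_indicator_coe I hS)]
  congr 4
  ext x
  by_cases hx : (x : ℝ) ∈ S <;> simp [hx]

/-- Since $S$ is bounded, $\varphi=(x-z)1_S$ is a bounded Borel function and
$1_S(H)=R(z)\varphi(H)$. -/
theorem spectralProj_mem_domain (hF : IsBorelCalculus H I (borelCalc H I)) (hI : IsOpen I)
    (hcalc : HasC0Calculus H I) (k : KreinStructure E) (hne : I.Nonempty) (hS : MeasurableSet S)
    (hb : Bornology.IsBounded S) (u : E) : spectralProj H I S u ∈ H.domain := by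
  obtain ⟨l, hl⟩ := hne
  obtain ⟨z, hz, hz'⟩ := hcalc.exists_mem_resolventSetOp hl
  obtain ⟨r, hr⟩ := hb.exists_norm_le
  set φ : I → ℂ := fun x => S.indicator (fun x : ℝ => (x : ℂ) - z) (x : ℝ) with hφ
  have hφb : IsBoundedBorel φ := by
    refine ⟨((Complex.continuous_ofReal.sub continuous_const).measurable.indicator hS).comp
      measurable_subtype_coe, |r| + ‖z‖, fun x => ?_⟩
    by_cases hx : (x : ℝ) ∈ S
    · simp only [hφ, Set.indicator_of_mem hx]
      refine (norm_sub_le _ _).trans ?_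
      have := hr _ hx
      rw [Complex.norm_real]
      linarith [le_abs_self r]
    · simp only [hφ, Set.indicator_of_notMem hx, norm_zero]
      positivity
  have h1 : spectralProj H I S u = resolventOp H z (borelCalc H I φ u) := by
    rw [hF.resolventOp_apply hI hcalc k hz hφb, hF.apply_resolventOp hI hcalc k hz hz' hφb,
      spectralProj]
    congr 2
    ext x
    have hx0 : ((x : ℝ) : ℂ) - z ≠ 0 := fun h => hz' (by simpa using congrArg Complex.im h)
    by_cases hx : (x : ℝ) ∈ S <;> simp [hφ, hx, hx0]
  rw [h1]
  exact resolventOp_mem hz _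

/-- On $\{\lambda\}$ the function $1/(x-z)$ is constant, so $R(z)$ acts on the range as
$(\lambda-z)^{-1}$. In particular the projection vanishes when $\lambda$ is not an eigenvalue. -/
theorem spectralProj_singleton_mem (hF : IsBorelCalculus H I (borelCalc H I)) (hI : IsOpen I)
    (hcalc : HasC0Calculus H I) (k : KreinStructure E) {l : ℝ} (hl : l ∈ I) (u : E) :
    spectralProj H I {l} u ∈ eigenspaceOp H (l : ℂ) := by
  obtain ⟨z, hz, hz'⟩ := hcalc.exists_mem_resolventSetOp hl
  have hlz : (l : ℂ) - z ≠ 0 := fun h => hz' (by simpa using congrArg Complex.im h)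
  have hb := isBoundedBorel_indicator_coe I (measurableSet_singleton l)
  have h1 : resolventOp H z (spectralProj H I {l} u) =
      ((l : ℂ) - z)⁻¹ • spectralProj H I {l} u := by
    rw [spectralProj, hF.resolventOp_apply hI hcalc k hz hb, hF.apply_resolventOp hI hcalc k hz hz' hb,
      ← smul_apply, ← hF.map_smul _ _ hb]
    congr 2
    ext x
    by_cases hx : (x : ℝ) = l <;> simp [hx]
  set v := spectralProj H I {l} u with hv
  have h2 : v = resolventOp H z (((l : ℂ) - z) • v) := by
    rw [map_smul, h1, smul_smul, mul_inv_cancel₀ hlz, one_smul]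
  rw [mem_eigenspaceOp]
  refine ⟨by rw [h2]; exact resolventOp_mem hz _, ?_⟩
  have h3 := apply_resolventOp hz (((l : ℂ) - z) • v)
  simp only [← h2] at h3
  rw [h3, ← add_smul, sub_add_cancel]

theorem spectralProj_apply_eigenvector (hF : IsBorelCalculus H I (borelCalc H I)) (hI : IsOpen I)
    (hcalc : HasC0Calculus H I) (k : KreinStructure E) {l : ℝ} (hl : l ∈ I) (hlS : l ∈ S)
    (hS : MeasurableSet S) {u : E} (hu : u ∈ eigenspaceOp H (l : ℂ)) :
    spectralProj H I S u = u := by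
  rw [spectralProj, hF.apply_eigenvector hI hcalc k hl hu (isBoundedBorel_indicator_coe I hS)]
  simp [hlS]

/-- The form is equivalent to the norm on the range of a nonnegative spectral projection. -/
theorem exists_norm_sq_le_form (hF : IsBorelCalculus H I (borelCalc H I)) (hI : IsOpen I)
    (hcalc : HasC0Calculus H I) (hH : k.IsSelfAdjointOp H) (hJ : MeasurableSet J)
    (hpos : k.IsNonneg (spectralProj H I J)) :
    ∃ C, 0 ≤ C ∧ ∀ u, spectralProj H I J u = u → ‖u‖ ^ 2 ≤ C * (k.form u u).re := by
  set P := spectralProj H I J with hP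
  -- Positivity makes $\langle u|Pv\rangle$ a semi-inner product, which provides Cauchy–Schwarz.
  let core : PreInnerProductSpace.Core ℂ E :=
    { inner := fun u v => k.form u (P v)
      conj_inner_symm := fun u v => by
        change conj (k.form v (P u)) = k.form u (P v)
        rw [form_spectralProj hF hI hcalc hH hJ v u, ← k.hermitian]
      re_inner_nonneg := fun u => (hpos u).1
      add_left := fun u v w => by
        change k.form (u + v) (P w) = k.form u (P w) + k.form v (P w)
        rw [map_add]; rfl
      smul_left := fun u v a => by
        change k.form (a • u) (P v) = conj a * k.form u (P v)
        rw [map_smulₛₗ]; rfl }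
  have hcs : ∀ u v, P u = u → ‖k.form v u‖ * ‖k.form v u‖ ≤
      (k.form v (P v)).re * (k.form u u).re := by
    intro u v hu
    have h1 := InnerProductSpace.Core.inner_mul_inner_self_le (c := core) v u
    have h2 : ‖k.form v (P u)‖ * ‖k.form u (P v)‖ ≤
      (k.form v (P v)).re * (k.form u (P u)).re := h1
    rw [form_spectralProj hF hI hcalc hH hJ u v, ← hP, hu, k.hermitian u v, RCLike.norm_conj] at h2
    exact h2
  -- Every continuous functional is some $\langle v|\cdot\rangle$, so by Cauchy–Schwarz the vectors
  -- $u=Pu$ with $\langle u|u\rangle\le1$ are weakly bounded, hence norm bounded.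
  obtain ⟨C, hC⟩ := banach_steinhaus (ι := {u : E // P u = u ∧ (k.form u u).re ≤ 1})
    (g := fun u => NormedSpace.inclusionInDoubleDual ℂ E u.1) (fun ℓ => by
      obtain ⟨v, rfl, -⟩ := k.represents ℓ
      refine ⟨(k.form v (P v)).re + 1, fun u => ?_⟩
      change ‖k.form v u.1‖ ≤ _
      have h1 := hcs u.1 v u.2.1
      have h2 : (k.form v (P v)).re * (k.form u.1 u.1).re ≤ (k.form v (P v)).re :=
        mul_le_of_le_one_right (hpos v).1 u.2.2
      nlinarith [norm_nonneg (k.form v u.1), (hpos v).1])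
  have hC' : ∀ u, P u = u → (k.form u u).re ≤ 1 → ‖u‖ ≤ C := fun u h1 h2 => by
    exact ((NormedSpace.inclusionInDoubleDualLi ℂ).norm_map u).symm.trans_le (hC ⟨u, h1, h2⟩)
  have hC0 : 0 ≤ C := (norm_nonneg _).trans (hC' 0 (map_zero _) (by simp))
  refine ⟨C ^ 2, by positivity, fun u hu => ?_⟩
  have hr0 : 0 ≤ (k.form u u).re := by
    have := (hpos u).1
    rwa [hu] at this
  refine le_of_forall_pos_le_add fun ε hε => ?_
  -- At this point $\langle u|u\rangle$ could still be $0$ with $u\ne0$, so $u$ is normalised with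
  -- $\langle u|u\rangle+\delta$ instead.
  set δ := ε / (C ^ 2 + 1) with hδ
  have hδ0 : 0 < δ := by positivity
  set s := (k.form u u).re + δ with hs
  have hs0 : 0 < s := by positivity
  have h1 := hC' (((√s)⁻¹ : ℝ) • u) (by rw [← Complex.coe_smul, map_smul, hu]) (by
    have e : ∀ a : ℝ, k.form (a • u) (a • u) = ((a * a : ℝ) : ℂ) * k.form u u := fun a => by
      rw [← Complex.coe_smul, k.form.map_smulₛₗ, smul_apply, (k.form u).map_smul,
        Complex.conj_ofReal, smul_eq_mul, smul_eq_mul]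
      push_cast
      ring
    rw [e, Complex.re_ofReal_mul]
    rw [← mul_inv, Real.mul_self_sqrt hs0.le, inv_mul_le_iff₀ hs0]
    linarith)
  rw [norm_smul, Real.norm_of_nonneg (by positivity), inv_mul_le_iff₀ (by positivity)] at h1
  have h2 : ‖u‖ ^ 2 ≤ s * C ^ 2 := by
    calc ‖u‖ ^ 2 ≤ (√s * C) ^ 2 := pow_le_pow_left₀ (norm_nonneg _) h1 2
      _ = s * C ^ 2 := by rw [mul_pow, Real.sq_sqrt hs0.le]
  have h3 : δ * C ^ 2 ≤ ε := by
    calc δ * C ^ 2 ≤ δ * (C ^ 2 + 1) := by nlinarith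
      _ = ε := by rw [hδ]; field_simp
  nlinarith

/-- If `1_{S n} → 0` pointwise, with `S n ⊆ J` and `1_J(H) ≥ 0`, then `1_{S n}(H) K → 0` in norm for
each compact operator `K`. -/
theorem eventually_norm_spectralProj_compact_le (hF : IsBorelCalculus H I (borelCalc H I))
    (hI : IsOpen I) (hcalc : HasC0Calculus H I) (hH : k.IsSelfAdjointOp H) (hJ : MeasurableSet J)
    {C : ℝ} (hC0 : 0 ≤ C)
    (hC : ∀ u, spectralProj H I J u = u → ‖u‖ ^ 2 ≤ C * (k.form u u).re)
    {K : E →L[ℂ] E} (hK : IsCompactOperator K) {S : ℕ → Set ℝ} (hS : ∀ n, MeasurableSet (S n))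
    (hSJ : ∀ n, S n ⊆ J) (hlim : ∀ x, ∀ᶠ n in atTop, x ∉ S n) {ε : ℝ} (hε : 0 < ε) :
    ∀ᶠ n in atTop, ∀ u, ‖spectralProj H I (S n) (K u)‖ ≤ ε * ‖u‖ := by
  have hsq : ∀ n w, ‖spectralProj H I (S n) w‖ ^ 2 ≤
      C * (k.form w (spectralProj H I (S n) w)).re := by
    intro n w
    have h1 := hC _ (spectralProj_apply_of_subset hF (hS n) hJ (hSJ n)
      (spectralProj_apply_self hF (hS n) w))
    rwa [← form_spectralProj hF hI hcalc hH (hS n), spectralProj_apply_self hF (hS n)] at h1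
  -- Dividing $\|P_nw\|^2\le C\langle w|P_nw\rangle$ by $\|P_nw\|$ gives a bound uniform in $n$.
  have hbd : ∀ n w, ‖spectralProj H I (S n) w‖ ≤ C * ‖k.form‖ * ‖w‖ := by
    intro n w
    rcases (norm_nonneg (spectralProj H I (S n) w)).eq_or_lt with h0 | h0
    · rw [← h0]; positivity
    · refine le_of_mul_le_mul_right ?_ h0
      rw [← sq]
      refine (hsq n w).trans ?_
      rw [mul_assoc C, mul_assoc C]
      exact mul_le_mul_of_nonneg_left ((Complex.re_le_norm _).trans (k.form.le_opNorm₂ _ _)) hC0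
  -- The calculus only gives weak convergence; the inequality `hsq` upgrades it to strong
  -- convergence.
  have hstrong : ∀ w, Tendsto (fun n => spectralProj H I (S n) w) atTop (𝓝 0) := by
    intro w
    rw [tendsto_zero_iff_norm_tendsto_zero]
    have h1 := hF.tendsto_weak (fun n x => (S n).indicator (fun _ => (1 : ℂ)) (x : ℝ)) 0 1
      (fun n => (isBoundedBorel_indicator_coe I (hS n)).1)
      (fun n x => by by_cases hx : (x : ℝ) ∈ S n <;> simp [hx])
      (fun x => tendsto_const_nhds.congr' ((hlim x).mono fun n hn => by simp [hn])) w (k.form w)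
    have h0 : borelCalc H I 0 = 0 := by
      simpa using hF.map_smul 0 0 ⟨measurable_const, 0, by simp⟩
    rw [h0, zero_apply, map_zero] at h1
    have h2 := ((Complex.continuous_re.tendsto _).comp h1).const_mul C
    have h3 : Tendsto (fun n => ‖spectralProj H I (S n) w‖ ^ 2) atTop (𝓝 0) := by
      refine squeeze_zero (fun n => by positivity) (fun n => hsq n w) ?_
      simpa [spectralProj] using h2
    have h4 := (Real.continuous_sqrt.tendsto _).comp h3
    simpa [Function.comp_def, Real.sqrt_sq (norm_nonneg _)] using h4
  -- Strong convergence of uniformly bounded operators is uniform on compact sets.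
  have hunif : ∀ᶠ n in atTop, ∀ y ∈ closure (K '' Metric.closedBall 0 1),
      ‖spectralProj H I (S n) y‖ < ε := by
    refine (hK.isCompact_closure_image_closedBall 1).induction_on
      (p := fun s => ∀ᶠ n in atTop, ∀ y ∈ s, ‖spectralProj H I (S n) y‖ < ε) ?_ ?_ ?_ ?_
    · simp
    · exact fun s t hst ht => ht.mono fun n hn y hy => hn y (hst hy)
    · exact fun s t hs ht => (hs.and ht).mono fun n hn y hy => hy.elim (hn.1 y) (hn.2 y)
    · intro y _
      have hB : 0 < C * ‖k.form‖ + 1 := by positivity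
      refine ⟨Metric.ball y (ε / 2 / (C * ‖k.form‖ + 1)), mem_nhdsWithin_of_mem_nhds
        (Metric.ball_mem_nhds _ (by positivity)), ?_⟩
      filter_upwards [(hstrong y).norm.eventually_lt_const (by simpa using half_pos hε :
        ‖(0 : E)‖ < ε / 2)] with n hn
      intro x hx
      have h1 : ‖x - y‖ * (C * ‖k.form‖ + 1) < ε / 2 :=
        (lt_div_iff₀ hB).1 (by rwa [Metric.mem_ball, dist_eq_norm] at hx)
      have h2 : ‖spectralProj H I (S n) x‖ ≤ ‖spectralProj H I (S n) (x - y)‖ +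
          ‖spectralProj H I (S n) y‖ := by
        have := norm_add_le (spectralProj H I (S n) (x - y)) (spectralProj H I (S n) y)
        rwa [← map_add, sub_add_cancel] at this
      have h3 := hbd n (x - y)
      nlinarith [norm_nonneg (x - y)]
  filter_upwards [hunif] with n hn u
  rcases eq_or_ne u 0 with rfl | hu
  · simp
  · have hu0 : 0 < ‖u‖ := norm_pos_iff.2 hu
    have h1 := hn (K ((‖u‖⁻¹ : ℂ) • u)) (subset_closure ⟨_, by
      rw [mem_closedBall_zero_iff, norm_smul, norm_inv, Complex.norm_real, norm_norm,
        inv_mul_cancel₀ hu0.ne'], rfl⟩)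
    rw [map_smul, map_smul, norm_smul, norm_inv, Complex.norm_real, norm_norm,
      inv_mul_lt_iff₀ hu0] at h1
    linarith

end SpectralProjections

/-! ### The virial theorem -/

section Virial

variable {E : Type*} [NormedAddCommGroup E] [NormedSpace ℂ E] [CompleteSpace E]

/-- By uniform boundedness the group is bounded for $|t|\le1$, so its strong continuity holds
jointly in $t$ and the vector. -/
theorem C0Group.tendsto_apply (W : C0Group E) {x : ℝ → E} {y : E} {l : Filter ℝ}
    (hl : l ≤ 𝓝 0) (hx : Tendsto x l (𝓝 y)) : Tendsto (fun t => W.toFun t (x t)) l (𝓝 y) := by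
  obtain ⟨B, hB⟩ := banach_steinhaus (ι := Set.Icc (-1 : ℝ) 1) (g := fun t => W.toFun t) (fun u => by
    obtain ⟨C, hC⟩ := isCompact_Icc.exists_bound_of_continuousOn
      (W.strong_continuity u).continuousOn
    exact ⟨C, fun t => hC t t.2⟩)
  have h1 : Tendsto (fun t => W.toFun t y) l (𝓝 y) := by
    have := (W.strong_continuity y).tendsto 0
    rw [W.map_zero] at this
    exact this.mono_left hl
  have h2 : Tendsto (fun t => W.toFun t (x t - y)) l (𝓝 0) := by
    have hx0 : Tendsto (fun t => B * ‖x t - y‖) l (𝓝 0) := by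
      simpa using (tendsto_iff_norm_sub_tendsto_zero.1 hx).const_mul B
    refine squeeze_zero_norm' ?_ hx0
    filter_upwards [hl (Icc_mem_nhds (by norm_num : (-1 : ℝ) < 0) one_pos)] with t ht
    exact (W.toFun t).le_of_opNorm_le (hB ⟨t, ht⟩) _
  have := h2.add h1
  rw [zero_add] at this
  exact this.congr fun t => by rw [← _root_.map_add, sub_add_cancel]

variable {k : KreinStructure E} {H : E →ₗ.[ℂ] E}

/-- The virial theorem. -/
theorem commForm_eigenvector (hH : k.IsSelfAdjointOp H) (W : C0Group E) {z : ℂ}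
    (hz : z ∈ resolventSetOp H) (hC1 : IsC1 W (resolventOp H z)) {l : ℝ} {u : H.domain}
    (hu : H u = (l : ℂ) • (u : E)) : commForm k W H z u u = 0 := by
  have hsub : ∀ w : ℂ, H u - w • (u : E) = ((l : ℂ) - w) • (u : E) := fun w => by
    rw [hu, sub_smul]
  rw [commForm, hsub, hsub]
  rcases eq_or_ne (l : ℂ) z with hlz | hlz
  · rw [← hlz, Complex.conj_ofReal, sub_self, zero_smul, map_zero]
    simp
  have hlz' : (l : ℂ) - z ≠ 0 := sub_ne_zero.2 hlz
  -- By selfadjointness $u$ is also a left eigenvector of $R(z)$ for the form.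
  have hform : ∀ w, ((l : ℂ) - z) * k.form u (resolventOp H z w) = k.form u w := by
    intro w
    have h := hH.form_apply u ⟨_, resolventOp_mem hz w⟩
    rw [apply_resolventOp hz, hu, k.form.map_smulₛₗ, smul_apply, Complex.conj_ofReal, map_add,
      map_smul, smul_eq_mul, smul_eq_mul] at h
    linear_combination h
  set y : E := ((l : ℂ) - z) • (u : E) with hy
  have hRy : resolventOp H z y = u := by
    rw [hy, map_smul, resolventOp_apply_eigenvector hu hz hlz', smul_smul, mul_inv_cancel₀ hlz',
      one_smul]
  set f : ℝ → E := fun t => W.toFun (-t) (resolventOp H z (W.toFun t y)) with hf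
  have hWf : ∀ t, W.toFun t (f t) = resolventOp H z (W.toFun t y) := by
    intro t
    have := W.map_add t (-t)
    rw [add_neg_cancel, W.map_zero] at this
    exact (congrArg (fun S : E →L[ℂ] E => S (resolventOp H z (W.toFun t y))) this).symm
  have hf0 : f 0 = u := by
    simp only [hf, neg_zero, W.map_zero, ContinuousLinearMap.id_apply]
    exact hRy
  -- Both $\langle u|R(z)W_ty\rangle$ and $\langle u|W_tu\rangle$ equal $(\lambda-z)^{-1}\langle
  -- u|W_ty\rangle$. Keeping $W_t$ in front of the difference quotient means that $u$ need not lie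
  -- in the domain of $A$.
  have hzero : ∀ t, k.form u (W.toFun t (f t - f 0)) = 0 := by
    intro t
    rw [map_sub, map_sub, hWf, hf0, sub_eq_zero]
    refine mul_left_cancel₀ hlz' ?_
    rw [hform, hy, map_smul, map_smul, smul_eq_mul]
  have hd : HasDerivAt f (commDeriv W (resolventOp H z) y) 0 :=
    ((hC1 y).differentiable (by simp)).differentiableAt.hasDerivAt
  have h1 := W.tendsto_apply nhdsWithin_le_nhds (hasDerivAt_iff_tendsto_slope.1 hd)
  have h2 : Tendsto (fun t => k.form u (W.toFun t (slope f 0 t))) (𝓝[≠] 0)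
      (𝓝 (k.form u (commDeriv W (resolventOp H z) y))) :=
    ((k.form (u : E)).continuous.tendsto _).comp h1
  have h3 : k.form u (commDeriv W (resolventOp H z) y) = 0 := by
    refine tendsto_nhds_unique h2 (tendsto_const_nhds.congr fun t => ?_)
    rw [slope_def_module, ← Complex.coe_smul, map_smul, map_smul, hzero, smul_zero]
  rw [k.form.map_smulₛₗ, smul_apply, h3, smul_zero, neg_zero]

end Virial

/-! ### A finite dimensionality criterion -/

section CompactOperators

/-- A subspace on which a compact operator is bounded below is finite dimensional. -/
theorem IsCompactOperator.finiteDimensional_of_bound {E : Type*} [NormedAddCommGroup E]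
    [NormedSpace ℂ E] {K : E →L[ℂ] E} (hK : IsCompactOperator K) (N : Submodule ℂ E) (D : ℝ)
    (h : ∀ u ∈ N, ‖u‖ ≤ D * ‖K u‖) : FiniteDimensional ℂ N := by
  by_contra hN
  -- In infinite dimension there is a bounded sequence with mutual distances at least $1$; its image
  -- has a Cauchy subsequence, contradicting the lower bound.
  obtain ⟨R, f, -, hfR, hf⟩ := exists_seq_norm_le_one_le_norm_sub (𝕜 := ℂ) hN
  obtain ⟨x, -, φ, hφ, hx⟩ := (hK.isCompact_closure_image_closedBall R).tendsto_subseq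
    (x := fun n => K (f n)) fun n => subset_closure ⟨f n, by
      rw [mem_closedBall_zero_iff]; exact hfR n, rfl⟩
  have hcau := hx.cauchySeq
  obtain ⟨n, hn⟩ := Metric.cauchySeq_iff'.1 hcau (1 / (|D| + 1)) (by positivity)
  have h1 := hn (n + 1) (by omega)
  have h2 := hf (hφ.injective.ne (show n + 1 ≠ n by omega))
  have h3 := h _ (f (φ (n + 1)) - f (φ n)).2
  simp only [Function.comp_apply, dist_eq_norm, ← map_sub] at h1
  rw [lt_div_iff₀ (by positivity)] at h1
  have h4 : D * ‖K ((f (φ (n + 1)) - f (φ n) : N) : E)‖ ≤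
      ‖K ((f (φ (n + 1)) : E) - f (φ n))‖ * (|D| + 1) := by
    rw [AddSubgroupClass.coe_sub]
    nlinarith [le_abs_self D, norm_nonneg (K ((f (φ (n + 1)) : E) - f (φ n)))]
  have h5 : (1 : ℝ) ≤ ‖((f (φ (n + 1)) - f (φ n) : N) : E)‖ := h2
  linarith

end CompactOperators

/-! ### Absorption of the compact term and the main theorem -/

section Mourre

variable {E : Type*} [NormedAddCommGroup E] [NormedSpace ℂ E] [CompleteSpace E]
  {k : KreinStructure E} {H : E →ₗ.[ℂ] E} {I J S : Set ℝ}

/-- The Mourre estimate with a compact error on vectors in the range of a spectral projection which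
makes the error small. -/
theorem mourre_estimate_of_small (hF : IsBorelCalculus H I (borelCalc H I)) (hI : IsOpen I)
    (hcalc : HasC0Calculus H I) (hH : k.IsSelfAdjointOp H) (W : C0Group E) {z₀ : ℂ}
    (hJ : MeasurableSet J) {C : ℝ}
    (hC : ∀ u, spectralProj H I J u = u → ‖u‖ ^ 2 ≤ C * (k.form u u).re)
    {a : ℝ} {K : E →L[ℂ] E}
    (hmourre : ∀ u ∈ H.domain, ∀ h : spectralProj H I J u ∈ H.domain,
      a * (k.form u (spectralProj H I J u)).re + (k.form u (K u)).re ≤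
        (commForm k W H z₀ ⟨spectralProj H I J u, h⟩ ⟨spectralProj H I J u, h⟩).re)
    (hS : MeasurableSet S) (hSJ : S ⊆ J) {ε : ℝ} (hε : 0 ≤ ε)
    (hK : ∀ u, ‖spectralProj H I S (K u)‖ ≤ ε * ‖u‖) {v : E} (hv : v ∈ H.domain)
    (hSv : spectralProj H I S v = v) :
    (a - C * ‖k.form‖ * ε) * (k.form v v).re ≤ (commForm k W H z₀ ⟨v, hv⟩ ⟨v, hv⟩).re := by
  have hJv := spectralProj_apply_of_subset hF hS hJ hSJ hSv
  have h1 := hmourre v hv (by rwa [hJv])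
  simp only [hJv] at h1
  have h2 : k.form v (K v) = k.form v (spectralProj H I S (K v)) := by
    rw [form_spectralProj hF hI hcalc hH hS, hSv]
  have h3 : -(C * ‖k.form‖ * ε * (k.form v v).re) ≤ (k.form v (K v)).re := by
    rw [h2]
    refine (neg_le_neg ?_).trans (neg_le_of_abs_le (Complex.abs_re_le_norm _))
    calc ‖k.form v (spectralProj H I S (K v))‖ ≤ ‖k.form‖ * ‖v‖ * (ε * ‖v‖) :=
          (k.form.le_opNorm₂ _ _).trans (mul_le_mul_of_nonneg_left (hK v) (by positivity))
      _ = ‖k.form‖ * ε * ‖v‖ ^ 2 := by ring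
      _ ≤ ‖k.form‖ * ε * (C * (k.form v v).re) :=
        mul_le_mul_of_nonneg_left (hC v hJv) (by positivity)
      _ = _ := by ring
  linarith

end Mourre
end

theorem mainTheorem7 {E : Type*} [NormedAddCommGroup E] [NormedSpace ℂ E] [CompleteSpace E]
    (k : KreinStructure E) (H : E →ₗ.[ℂ] E) (hH : k.IsSelfAdjointOp H)
    (W : C0Group E) (z₀ : ℂ) (hz₀ : z₀ ∈ resolventSetOp H) (hC1 : IsC1 W (resolventOp H z₀))
    (I : Set ℝ) (hI : IsOpen I) (hcalc : HasC0Calculus H I)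
    (J : Set ℝ) (hJ : MeasurableSet J) (hJI : J ⊆ I)
    (hpos : k.IsNonneg (spectralProj H I J))
    (a : ℝ) (ha : 0 < a) (K : E →L[ℂ] E) (hK : IsCompactOperator K)
    (hmourre : ∀ u ∈ H.domain, ∀ h : spectralProj H I J u ∈ H.domain,
      a * (k.form u (spectralProj H I J u)).re + (k.form u (K u)).re ≤
        (commForm k W H z₀ ⟨spectralProj H I J u, h⟩ ⟨spectralProj H I J u, h⟩).re) :
    {l : ℝ | l ∈ J ∧ eigenspaceOp H (l : ℂ) ≠ ⊥}.Finite ∧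
    (∀ l ∈ J, FiniteDimensional ℂ (eigenspaceOp H (l : ℂ))) ∧
    ∀ l ∈ J, eigenspaceOp H (l : ℂ) = ⊥ →
      (∃ L₀ : Set ℝ, L₀ ⊆ J ∧ IsCompact L₀ ∧ L₀ ∈ 𝓝[J] l) →
      ∀ b : ℝ, b < a →
        ∃ L : Set ℝ, L ⊆ J ∧ IsCompact L ∧ L ∈ 𝓝[J] l ∧
          ∀ u : E, ∃ h : spectralProj H I L u ∈ H.domain,
            b * (k.form u (spectralProj H I L u)).re ≤
              (commForm k W H z₀ ⟨spectralProj H I L u, h⟩ ⟨spectralProj H I L u, h⟩).re := by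
  have hF := hcalc.isBorelCalculus_borelCalc k hI
  obtain ⟨C, hC0, hC⟩ := exists_norm_sq_le_form hF hI hcalc hH hJ hpos
  have hvir : ∀ l ∈ J, ∀ u (_ : u ∈ eigenspaceOp H (l : ℂ)), ∃ hd : u ∈ H.domain,
      commForm k W H z₀ ⟨u, hd⟩ ⟨u, hd⟩ = 0 := by
    intro l _ u hu
    obtain ⟨hd, hu⟩ := mem_eigenspaceOp.1 hu
    exact ⟨hd, commForm_eigenvector hH W hz₀ hC1 hu⟩
  refine ⟨?_, fun l hl => ?_, fun l hl hker hL₀ b hb => ?_⟩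
  · by_contra hinf
    let e := Set.Infinite.natEmbedding _ hinf
    have hlim : ∀ x : ℝ, ∀ᶠ n in atTop, x ∉ ({(e n : ℝ)} : Set ℝ) := by
      intro x
      by_cases hx : ∃ m, (e m : ℝ) = x
      · obtain ⟨m, rfl⟩ := hx
        filter_upwards [eventually_gt_atTop m] with n hn h
        exact hn.ne (e.injective (Subtype.ext h))
      · exact .of_forall fun n h => hx ⟨n, (Set.mem_singleton_iff.1 h).symm⟩
    -- Makes the loss $C\|\langle\cdot|\cdot\rangle\|\varepsilon$ at most $a/2$; the $1$ guards
    -- against division by zero.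
    set ε := a / 2 / (C * ‖k.form‖ + 1) with hε
    have hε0 : 0 < ε := by positivity
    have hCε : C * ‖k.form‖ * ε < a := by
      calc C * ‖k.form‖ * ε ≤ (C * ‖k.form‖ + 1) * ε := by nlinarith
        _ = a / 2 := by rw [hε]; field_simp
        _ < a := half_lt_self ha
    obtain ⟨n, hn⟩ := (eventually_norm_spectralProj_compact_le hF hI hcalc hH hJ hC0 hC hK
      (S := fun n => {(e n : ℝ)}) (fun n => measurableSet_singleton _)
      (fun n => Set.singleton_subset_iff.2 (e n).2.1) hlim hε0).exists
    obtain ⟨u, hu, hu0⟩ := (Submodule.ne_bot_iff _).1 (e n).2.2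
    obtain ⟨hd, hc⟩ := hvir _ (e n).2.1 u hu
    have h1 := mourre_estimate_of_small hF hI hcalc hH W hJ hC hmourre
      (measurableSet_singleton _) (Set.singleton_subset_iff.2 (e n).2.1) hε0.le hn hd
      (spectralProj_apply_eigenvector hF hI hcalc k (hJI (e n).2.1) (Set.mem_singleton _)
        (measurableSet_singleton _) hu)
    rw [hc, Complex.zero_re] at h1
    have h2 := hC u (spectralProj_apply_eigenvector hF hI hcalc k (hJI (e n).2.1) (e n).2.1 hJ hu)
    have h3 : (k.form u u).re ≤ 0 := nonpos_of_mul_nonpos_right h1 (sub_pos.2 hCε)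
    have h4 : 0 < ‖u‖ ^ 2 := by
      have := norm_pos_iff.2 hu0
      positivity
    exact absurd (h4.trans_le h2) (not_lt.2 (mul_nonpos_of_nonneg_of_nonpos hC0 h3))
  -- The constant comes from $\|u\|^2\le C\langle u|u\rangle$ and, by the virial theorem, $a\langle
  -- u|u\rangle\le\|\langle\cdot|\cdot\rangle\|\,\|u\|\,\|Ku\|$.
  · refine hK.finiteDimensional_of_bound _ (C / a * ‖k.form‖) fun u hu => ?_
    obtain ⟨hd, hc⟩ := hvir _ hl u hu
    have hJu := spectralProj_apply_eigenvector hF hI hcalc k (hJI hl) hl hJ hu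
    have h1 := hmourre u hd (by rwa [hJu])
    simp only [hJu] at h1
    rw [hc, Complex.zero_re] at h1
    have h2 := hC u hJu
    have h3 : a * (k.form u u).re ≤ ‖k.form‖ * ‖u‖ * ‖K u‖ := by
      have := (Complex.abs_re_le_norm _).trans (k.form.le_opNorm₂ u (K u))
      linarith [neg_abs_le (k.form u (K u)).re]
    have h4 : (k.form u u).re ≤ ‖k.form‖ * ‖u‖ * ‖K u‖ / a := (le_div_iff₀' ha).2 h3
    rcases (norm_nonneg u).eq_or_lt with h0 | h0
    · rw [← h0]; positivity
    · refine le_of_mul_le_mul_right ?_ h0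
      rw [← sq]
      refine h2.trans ((mul_le_mul_of_nonneg_left h4 hC0).trans_eq ?_)
      ring
  · obtain ⟨L₀, hL₀J, hL₀c, hL₀⟩ := hL₀
    have hlL₀ : l ∈ L₀ := mem_of_mem_nhdsWithin hl hL₀
    set L : ℕ → Set ℝ := fun n => L₀ ∩ Metric.closedBall l (1 / (n + 1)) with hL
    have hLc : ∀ n, IsCompact (L n) := fun n => hL₀c.inter_right Metric.isClosed_closedBall
    have hLm : ∀ n, MeasurableSet (L n) := fun n => (hLc n).measurableSet
    have hLJ : ∀ n, L n ⊆ J := fun n => Set.inter_subset_left.trans hL₀J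
    have hlL : ∀ n, l ∈ L n := fun n => ⟨hlL₀, Metric.mem_closedBall_self (by positivity)⟩
    -- The sets `L n` shrink to $\{\lambda\}$, not to the empty set, so $\lambda$ is removed; `hP`
    -- shows that this does not change the projection.
    have hlim : ∀ x : ℝ, ∀ᶠ n in atTop, x ∉ L n \ {l} := by
      intro x
      by_cases hx : x = l
      · exact .of_forall fun n h => h.2 hx
      · have hd : 0 < dist x l := dist_pos.2 hx
        filter_upwards [tendsto_one_div_add_atTop_nhds_zero_nat.eventually_lt_const hd] with n hn h
        exact absurd (Metric.mem_closedBall.1 h.1.2) (not_le.2 hn)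
    set ε := (a - b) / (C * ‖k.form‖ + 1) with hε
    have hab : 0 < a - b := sub_pos.2 hb
    have hε0 : 0 < ε := by positivity
    have hCε : C * ‖k.form‖ * ε ≤ a - b := by
      calc C * ‖k.form‖ * ε ≤ (C * ‖k.form‖ + 1) * ε := by nlinarith
        _ = a - b := by rw [hε]; field_simp
    obtain ⟨n, hn⟩ := (eventually_norm_spectralProj_compact_le hF hI hcalc hH hJ hC0 hC hK
      (S := fun n => L n \ {l}) (fun n => (hLm n).diff (measurableSet_singleton l))
      (fun n => Set.sdiff_subset.trans (hLJ n)) hlim hε0).exists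
    have hP : spectralProj H I (L n) = spectralProj H I (L n \ {l}) := by
      rw [spectralProj_eq_add hF (hLm n) (hlL n)]
      ext u
      have := spectralProj_singleton_mem hF hI hcalc k (hJI hl) u
      rw [hker, Submodule.mem_bot] at this
      rw [add_apply, this, add_zero]
    rw [← hP] at hn
    refine ⟨L n, hLJ n, hLc n, Filter.inter_mem hL₀ (mem_nhdsWithin_of_mem_nhds
      (Metric.closedBall_mem_nhds l (by positivity))), fun u => ?_⟩
    have hd := spectralProj_mem_domain hF hI hcalc k ⟨l, hJI hl⟩ (hLm n) (hLc n).isBounded u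
    refine ⟨hd, ?_⟩
    have hself := spectralProj_apply_self hF (hLm n) u
    have h1 := mourre_estimate_of_small hF hI hcalc hH W hJ hC hmourre (hLm n) (hLJ n) hε0.le
      hn hd hself
    have hJv := spectralProj_apply_of_subset hF (hLm n) hJ (hLJ n) hself
    have h2 : 0 ≤ (k.form (spectralProj H I (L n) u) (spectralProj H I (L n) u)).re := by
      have := (hpos (spectralProj H I (L n) u)).1
      rwa [hJv] at this
    -- Rewriting with the projected vector exposes a nonnegative quantity, so that the constant can
    -- be lowered to $b$.
    have h3 : k.form u (spectralProj H I (L n) u) =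
        k.form (spectralProj H I (L n) u) (spectralProj H I (L n) u) := by
      rw [← form_spectralProj hF hI hcalc hH (hLm n), hself]
    rw [h3]
    refine le_trans (mul_le_mul_of_nonneg_right ?_ h2) h1
    linarith
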